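/- **Notation.** Let $G=PSL(3,\mathbb R)=GL(3,\mathbb R)/\mathbb R^\times$, $K=SO(3)$ with Haar probability measure $dk$, $\Gamma=SL(3,\mathbb Z)$, and write $g=xyk$ for the Iwasawa decomposition of $g\in G$, with $x=\begin{pmatrix}1&x_2&x_3\\&1&x_1\\&&1\end{pmatrix}\in U(\mathbb R)$, $y=\mathrm{diag}(y_1y_2,y_1,1)$, $y_1,y_2>0$, $k\in K$. Complex $3\times3$ matrices of trace zero act on smooth functions on $G$ by $(Xf)(g)=\frac{d}{dt}f(g\exp tX)|_{t=0}$ for real $X$, extended complex linearly. Put $$K_{\pm1}=\begin{pmatrix}0&0&\mp1\\0&0&-i\\\pm1&i&0\end{pmatrix},\ X_0=-\tfrac{\sqrt6}{3}\begin{pmatrix}1&&\\&1&\\&&-2\end{pmatrix},\ X_{\pm1}=-\begin{pmatrix}0&0&\pm1\\0&0&i\\\pm1&i&0\end{pmatrix},\ X_{\pm2}=\begin{pmatrix}1&\pm i&0\\\pm i&-1&0\\0&0&0\end{pmatrix}.$$ For $d\ge0$ let $\mathcal D^d=(\mathcal D^d_{m',m})_{|m'|,|m|\le d}$ be the Wigner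 $D$-matrix, i.e. the $(2d+1)$-dimensional irreducible unitary representation of $K$ with $\mathcal D^d_{m',m}=e^{-im\theta}\delta_{m'=m}$ at the rotation by $\theta$ about the third axis and $K_{\pm1}\mathcal D^d_{m',m}=\sqrt{d(d+1)-m(m\pm1)}\,\mathcal D^d_{m',m\pm1}$. Let $C^{d,k,a}_{m,i}=\langle k\,i\,d\,m\,|\,(d+a)\,(i+m)\rangle$ be the Clebsch–Gordan coefficients, which are zero outside their usual range. Let $\tilde C(G,\mathcal D^d)$ be the space of smooth $f:G\to\mathbb C$ of the form $f(xyk)=\sum_{|m'|,|m|\le d}f_{m',m}(xy)\mathcal D^d_{m',m}(k)$, and $C(G,\mathcal D^d)$ the space of smooth $f:G\to\mathbb C^{2d+1}$ (row vectors $(f_{-d},\dots,f_d)$; $f_m:=0$ for $|m|>d$) with $f(gk)=f(g)\mathcal D^d(k)$. Define the projections $$(\tilde P^d_mf)(g)=(2d+1)\int_Kf(gk)\overline{\mathcal D^d_{m,m}(k)}\,dk,\qquad (P^d_mf)(g)=(2d+1)\int_Kf(gk)\,\mathcal D^d_{m,\cdot}(k^{-1})\,dk,$$ the operators on functions on $U(\mathbb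 R)Y^+$ $$Z_{\pm2}=(2y_2\partial_{y_2}-y_1\partial_{y_1})\pm2iy_2\partial_{x_2},\quad Z_{\pm1}=-2iy_1(\partial_{x_1}+x_2\partial_{x_3})\mp2y_1y_2\partial_{x_3},\quad Z_0=-\sqrt6\,y_1\partial_{y_1},$$ the constants $(B^d_{-2},\dots,B^d_2)=\frac{\sqrt6}{3}(-2(d+1),-(d+3),-3,d-2,2d)$, and for $|a|,|j|\le2$ $$\tilde Y^{d,a}_{m',j}=C^{d,2,a}_{m'-j,j}\times\begin{cases}Z_{-2}-m'-2&j=-2\\Z_{-1}&j=-1\\Z_0-B^d_a&j=0\\Z_1&j=1\\Z_2+m'-2&j=2.\end{cases}$$ For $d+a\ge0$ define $\tilde Y^{d,a}$ on smooth scalar functions by $$(\tilde Y^{d,a}f)(xyk)=\sum_{|m'|\le d+a}\mathcal D^{d+a}_{m',0}(k)\sum_{j=-2}^2\tilde Y^{d,a}_{m',j}f_{m'-j}(xy),\qquad f_{m'}(xy)=(2d+1)\int_Kf(xyk)\overline{\mathcal D^d_{m',0}(k)}\,dk,$$ so that $\sum_{m'}\mathcal D^d_{m',0}(k)f_{m'}(xy)=(\tilde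 P^d_0f)(xyk)$, with $f_{m'}=0$ for $|m'|>d$. For $f:G\to\mathbb C^{2d+1}$ put $Y^af=P^{d+a}_0\tilde Y^{d,a}f_0$. Let $\mathcal A^d$ be the space of smooth vector-valued cusp forms of $K$-type $\mathcal D^d$: functions $f\in C(G,\mathcal D^d)$ that are left $\Gamma$-invariant, satisfy $\int_{U(\mathbb Z)\backslash U(\mathbb R)}f(ug)e^{2\pi i(n_1u_1+n_2u_2)}du=0$ for all $g\in G$ and all $n\in\mathbb Z^2$ with $n_1n_2=0$, have finite norm $\int_{\Gamma\backslash G}|f(g)|^2dg<\infty$, and are of uniform moderate growth: there is $r>0$ such that $\sup_g|(Xf)(g)|\,\|g\|^{-r}<\infty$ for every $X$ in the universal enveloping algebra of $\mathfrak{sl}_3(\mathbb C)$, where $\|g\|$ is the Euclidean norm of the representative of $g$ in $SL(3,\mathbb R)$. **Statement.** Let $d\ge0$ and $a\in\{-2,\dots,2\}$ with $d+a\ge0$. 1. If $f\in\tilde C(G,\mathcal D^d)$, then $\tilde Y^{d,a}f\in\tilde C(G,\mathcal D^{d+a})$ and $$\tilde P^{d+a}_0X_0f=C^{d,2,a}_{0,0}\,\tilde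 Y^{d,a}f,$$ $$\tilde P^{d+a}_{\pm1}X_{\pm1}f=\frac{C^{d,2,a}_{0,\pm1}}{\sqrt{(d+a)(d+a+1)}}\,K_{\pm1}\tilde Y^{d,a}f\qquad(d+a\ge1),$$ $$\tilde P^{d+a}_{\pm2}X_{\pm2}f=\frac{C^{d,2,a}_{0,\pm2}}{\sqrt{(d+a)(d+a+1)}\sqrt{(d+a)(d+a+1)-2}}\,K_{\pm1}K_{\pm1}\tilde Y^{d,a}f\qquad(d+a\ge2).$$ 2. If $f\in C(G,\mathcal D^d)$, then $Y^af\in C(G,\mathcal D^{d+a})$; the operator $Y^a$ commutes with left translations by elements of $G$; and $(Y^af)_{m'}(xy)=\sum_{j=-2}^2\tilde Y^{d,a}_{m',j}f_{m'-j}(xy)$ for $|m'|\le d+a$. 3. $Y^a$ maps $\mathcal A^d$ to $\mathcal A^{d+a}$. -/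

import Mathlib

noncomputable section

open scoped Matrix Polynomial ContDiff Nat

namespace SL3

open MeasureTheory Matrix

/-! ### The groups `G = PSL(3, ℝ) = GL(3, ℝ) / ℝˣ`, `K = SO(3)`, `Γ = SL(3, ℤ)` -/

/-- `G = GL(3, ℝ) / ℝˣ` (the scalars are the centre of `GL(3, ℝ)`). -/
def G : Type := GL (Fin 3) ℝ ⧸ Subgroup.center (GL (Fin 3) ℝ)

instance : Group G :=
  inferInstanceAs (Group (GL (Fin 3) ℝ ⧸ Subgroup.center (GL (Fin 3) ℝ)))

instance : TopologicalSpace G :=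
  inferInstanceAs (TopologicalSpace (GL (Fin 3) ℝ ⧸ Subgroup.center (GL (Fin 3) ℝ)))

instance : IsTopologicalGroup G :=
  inferInstanceAs (IsTopologicalGroup (GL (Fin 3) ℝ ⧸ Subgroup.center (GL (Fin 3) ℝ)))

instance : LocallyCompactSpace G := by
  have : LocallyCompactSpace (Matrix (Fin 3) (Fin 3) ℝ) :=
    inferInstanceAs (LocallyCompactSpace (Fin 3 → Fin 3 → ℝ))
  exact inferInstanceAs
    (LocallyCompactSpace (GL (Fin 3) ℝ ⧸ Subgroup.center (GL (Fin 3) ℝ)))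

instance : MeasurableSpace G := borel G

instance : BorelSpace G := ⟨rfl⟩

/-- The quotient map `GL(3, ℝ) → G`. -/
def toG : GL (Fin 3) ℝ →* G := QuotientGroup.mk' (Subgroup.center (GL (Fin 3) ℝ))

open Classical in
/-- The class in `G` of an invertible matrix (and `1` for a singular matrix, which is never used). -/
def cls (M : Matrix (Fin 3) (Fin 3) ℝ) : G :=
  if h : M.det ≠ 0 then toG (Matrix.GeneralLinearGroup.mkOfDetNeZero M h) else 1

/-- `K = SO(3)`. -/
abbrev K : Type := Matrix.specialOrthogonalGroup (Fin 3) ℝ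

instance : IsTopologicalGroup K where
  continuous_mul := by fun_prop
  continuous_inv := by
    refine Continuous.subtype_mk (f := fun x : K => star (x : Matrix (Fin 3) (Fin 3) ℝ)) ?_ _
    exact continuous_subtype_val.star

instance : CompactSpace K := by
  suffices h : IsCompact ((Matrix.specialOrthogonalGroup (Fin 3) ℝ : Submonoid _) :
      Set (Matrix (Fin 3) (Fin 3) ℝ)) from isCompact_iff_compactSpace.mp h
  have hbox : IsCompact {M : Matrix (Fin 3) (Fin 3) ℝ | ∀ i j, M i j ∈ Set.Icc (-1 : ℝ) 1} := by
    have h := isCompact_univ_pi (X := fun _ : Fin 3 => Fin 3 → ℝ)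
      (s := fun _ => {v : Fin 3 → ℝ | ∀ j, v j ∈ Set.Icc (-1 : ℝ) 1})
      (fun _ => isCompact_pi_infinite (fun _ => isCompact_Icc))
    have e : {M : Matrix (Fin 3) (Fin 3) ℝ | ∀ i j, M i j ∈ Set.Icc (-1 : ℝ) 1} =
      (Set.univ.pi fun _ => {v : Fin 3 → ℝ | ∀ j, v j ∈ Set.Icc (-1 : ℝ) 1} :
        Set (Fin 3 → Fin 3 → ℝ)) := by
      ext M; exact ⟨fun h i _ => h i, fun h i => h i trivial⟩
    rw [e]; exact h
  refine hbox.of_isClosed_subset ?_ ?_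
  · have e : ((Matrix.specialOrthogonalGroup (Fin 3) ℝ : Submonoid _) :
        Set (Matrix (Fin 3) (Fin 3) ℝ)) = {M | M * Mᵀ = 1} ∩ {M | M.det = 1} := by
      ext M
      exact Matrix.mem_specialOrthogonalGroup_iff.trans
        (and_congr_left fun _ => Matrix.mem_orthogonalGroup_iff (Fin 3) ℝ)
    rw [e]
    refine IsClosed.inter (isClosed_eq (by fun_prop) (by fun_prop))
      (isClosed_eq (by fun_prop) (by fun_prop))
  · intro M hM i j
    have hM' := (Matrix.mem_specialOrthogonalGroup_iff.mp hM).1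
    have := entry_norm_bound_of_unitary (𝕜 := ℝ) hM' i j
    exact abs_le.mp (by simpa using this)

instance : MeasurableSpace K := borel K

instance : BorelSpace K := ⟨rfl⟩

/-- The Haar probability measure `dk` on `K`. -/
def haarK : Measure K := Measure.haarMeasure ⊤

/-- The Haar measure `dg` on `G`. -/
def haarG : Measure G := Measure.haar

/-- The image of `k ∈ K` in `G`. -/
def ofK (k : K) : G := cls (k : Matrix (Fin 3) (Fin 3) ℝ)

/-- `Γ = SL(3, ℤ)` as a subgroup of `G`. -/
def Γ : Subgroup G :=
  (toG.comp (Matrix.SpecialLinearGroup.toGL.comp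
    (Matrix.SpecialLinearGroup.map (n := Fin 3) (Int.castRingHom ℝ)))).range

/-- The element `x ∈ U(ℝ)` with coordinates `x₁, x₂, x₃`. -/
def matU (x₁ x₂ x₃ : ℝ) : Matrix (Fin 3) (Fin 3) ℝ := !![1, x₂, x₃; 0, 1, x₁; 0, 0, 1]

/-- The element `y ∈ Y⁺` with coordinates `y₁, y₂`. -/
def matY (y₁ y₂ : ℝ) : Matrix (Fin 3) (Fin 3) ℝ := Matrix.diagonal ![y₁ * y₂, y₁, 1]

/-- The class of `x y`, `x ∈ U(ℝ)`, `y ∈ Y⁺`, in `G`. -/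
def pt (x₁ x₂ x₃ y₁ y₂ : ℝ) : G := cls (matU x₁ x₂ x₃ * matY y₁ y₂)

/-- Iwasawa coordinates of an element `x y k` of `G`. -/
structure Iwasawa where
  x₁ : ℝ
  x₂ : ℝ
  x₃ : ℝ
  y₁ : ℝ
  y₂ : ℝ
  k : K

instance : Nonempty Iwasawa := ⟨⟨0, 0, 0, 1, 1, 1⟩⟩

/-- The (unique) Iwasawa coordinates of `g`: `g = x y k` with `y₁, y₂ > 0`. -/
def iwasawa (g : G) : Iwasawa :=
  Classical.epsilon fun c : Iwasawa =>
    0 < c.y₁ ∧ 0 < c.y₂ ∧ pt c.x₁ c.x₂ c.x₃ c.y₁ c.y₂ * ofK c.k = g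

/-! ### Smooth functions and the action of the Lie algebra -/

/-- `f ∈ C^∞(G)`: the pull-back of `f` to the open set of invertible matrices is `C^∞`. -/
def IsSmooth (f : G → ℂ) : Prop :=
  ContDiffOn ℝ ∞ (fun M : Fin 3 → Fin 3 → ℝ => f (cls (Matrix.of M)))
    {M | (Matrix.of M).det ≠ 0}

/-- `(X f)(g) = d/dt f(g exp(tX))` at `t = 0` for a real matrix `X`. -/
def realLie (X : Matrix (Fin 3) (Fin 3) ℝ) (f : G → ℂ) (g : G) : ℂ :=
  deriv (fun t : ℝ => f (g * cls (NormedSpace.exp (t • X)))) 0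

/-- The action of a complex matrix, `(X + iY) f = X f + i Y f` for `X, Y` real. -/
def lie (X : Matrix (Fin 3) (Fin 3) ℂ) (f : G → ℂ) (g : G) : ℂ :=
  realLie (X.map Complex.re) f g + Complex.I * realLie (X.map Complex.im) f g

/-- `K_{±1}`; the argument `ε` is the sign `±1`. -/
def matK1 (ε : ℤ) : Matrix (Fin 3) (Fin 3) ℂ :=
  !![0, 0, -(ε : ℂ); 0, 0, -Complex.I; (ε : ℂ), Complex.I, 0]

/-- `X_0`. -/
def matX0 : Matrix (Fin 3) (Fin 3) ℂ :=
  (-((√6 / 3 : ℝ) : ℂ)) • !![1, 0, 0; 0, 1, 0; 0, 0, -2]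

/-- `X_{±1}`; the argument `ε` is the sign `±1`. -/
def matX1 (ε : ℤ) : Matrix (Fin 3) (Fin 3) ℂ :=
  -!![0, 0, (ε : ℂ); 0, 0, Complex.I; (ε : ℂ), Complex.I, 0]

/-- `X_{±2}`; the argument `ε` is the sign `±1`. -/
def matX2 (ε : ℤ) : Matrix (Fin 3) (Fin 3) ℂ :=
  !![1, (ε : ℂ) * Complex.I, 0; (ε : ℂ) * Complex.I, -1, 0; 0, 0, 0]

/-! ### The Wigner `D`-matrices -/

/-- The `SO(3)`-equivariant identification of `ℂ³` with binary quadratic forms in `u, v`,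
`x ↦ (v² - u²)/2`, `y ↦ i(u² + v²)/2`, `z ↦ uv`, dehomogenized by `u = X`, `v = 1`. -/
def quadForm (w : Fin 3 → ℂ) : ℂ[X] :=
  Polynomial.C (w 0 / 2) * (1 - Polynomial.X ^ 2) +
    Polynomial.C (Complex.I * w 1 / 2) * (1 + Polynomial.X ^ 2) +
    Polynomial.C (w 2) * Polynomial.X

/-- The vector corresponding to `u²` (if `0 ≤ m`), respectively to `v²` (if `m < 0`). -/
def extremal (m : ℤ) : Fin 3 → ℂ :=
  if 0 ≤ m then ![-1, -Complex.I, 0] else ![1, -Complex.I, 0]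

/-- The entry `D^d_{m',m}(k)`, `|m'|, |m| ≤ d`, of the Wigner `D`-matrix, i.e. the matrix of `k` on
the binary forms of degree `2d` in the basis `e_m = u^{d+m} v^{d-m} / √((d+m)! (d-m)!)`.  Here
`u^{d+m} v^{d-m}` is `(u²)^m (uv)^{d-m}` or `(v²)^{-m} (uv)^{d+m}`, and `k` acts on
`u², uv, v²` through `quadForm`.  Since `J_+ e_m = u ∂_v e_m = √(d(d+1) - m(m+1)) e_{m+1}`, this is
the irreducible unitary representation with `D^d(k(θ,0,0)) = diag(e^{idθ}, …, e^{-idθ})` in which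
`K_{±1}` raises or lowers the column with the coefficient `√(d(d+1) - m(m±1))`.
The entry is `0` if the indices are out of range. -/
def wignerD (d : ℕ) (m' m : ℤ) (k : Matrix (Fin 3) (Fin 3) ℝ) : ℂ :=
  if |m'| ≤ d ∧ |m| ≤ d then
    ((√((((d + m').toNat ! : ℝ) * ((d - m').toNat ! : ℝ)) /
        (((d + m).toNat ! : ℝ) * ((d - m).toNat ! : ℝ))) : ℝ) : ℂ) *
      (quadForm (k.map Complex.ofReal *ᵥ extremal m) ^ m.natAbs *
        quadForm (k.map Complex.ofReal *ᵥ ![0, 0, 1]) ^ (d - m.natAbs)).coeff (d + m').toNat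
  else 0

/-! ### Clebsch-Gordan coefficients -/

/-- The Clebsch-Gordan coefficient `⟨j₁ m₁ j₂ m₂ | J M⟩` for integral spins (Racah's formula). -/
def clebschGordan (j₁ m₁ j₂ m₂ J M : ℤ) : ℝ :=
  if M = m₁ + m₂ ∧ |m₁| ≤ j₁ ∧ |m₂| ≤ j₂ ∧ |M| ≤ J ∧ |j₁ - j₂| ≤ J ∧ J ≤ j₁ + j₂ then
    √((2 * J + 1 : ℝ) * (J + j₁ - j₂).toNat ! * (J - j₁ + j₂).toNat ! * (j₁ + j₂ - J).toNat ! /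
        (j₁ + j₂ + J + 1).toNat !) *
      √(((J + M).toNat ! : ℝ) * (J - M).toNat ! * (j₁ - m₁).toNat ! * (j₁ + m₁).toNat ! *
        (j₂ - m₂).toNat ! * (j₂ + m₂).toNat !) *
      ∑ t ∈ Finset.range (j₁ + j₂ - J + 1).toNat,
        if (t : ℤ) ≤ j₁ - m₁ ∧ (t : ℤ) ≤ j₂ + m₂ ∧ 0 ≤ J - j₂ + m₁ + t ∧ 0 ≤ J - j₁ - m₂ + t then
          (-1 : ℝ) ^ t / ((t ! : ℝ) * (j₁ + j₂ - J - t).toNat ! * (j₁ - m₁ - t).toNat ! *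
            (j₂ + m₂ - t).toNat ! * (J - j₂ + m₁ + t).toNat ! * (J - j₁ - m₂ + t).toNat !)
        else 0
  else 0

/-- `C^{d,k,a}_{m,i} = ⟨k i d m | (d+a) (i+m)⟩`. -/
def cg (d k : ℕ) (a m i : ℤ) : ℝ := clebschGordan k i d m (d + a) (i + m)

/-! ### `K`-types and projections -/

/-- The indices `-d, …, d`. -/
abbrev Idx (d : ℕ) : Type := Finset.Icc (-(d : ℤ)) (d : ℤ)

/-- The entry `f_m` of a row-vector-valued function `f = (f_{-d}, …, f_d)`, with `f_m = 0` for
`|m| > d`. -/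
def entry {d : ℕ} (f : G → Idx d → ℂ) (m : ℤ) : G → ℂ :=
  fun g => if h : m ∈ Finset.Icc (-(d : ℤ)) (d : ℤ) then f g ⟨m, h⟩ else 0

/-- The space of smooth scalar functions on `G` in the span of the entries of `D^d`:
`f(xyk) = ∑ f_{m',m}(xy) D^d_{m',m}(k)`. -/
def scalarType (d : ℕ) : Set (G → ℂ) :=
  {f | IsSmooth f ∧ ∃ c : Idx d → Idx d → G → ℂ, ∀ x₁ x₂ x₃ y₁ y₂ : ℝ, 0 < y₁ → 0 < y₂ → ∀ k : K,
    f (pt x₁ x₂ x₃ y₁ y₂ * ofK k) =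
      ∑ m' : Idx d, ∑ m : Idx d, c m' m (pt x₁ x₂ x₃ y₁ y₂) * wignerD d m' m k}

/-- The space of smooth row-vector-valued functions on `G` with `f(gk) = f(g) D^d(k)`. -/
def vectorType (d : ℕ) : Set (G → Idx d → ℂ) :=
  {f | (∀ m, IsSmooth fun g => f g m) ∧
    ∀ (g : G) (k : K) (m : Idx d), f (g * ofK k) m = ∑ m' : Idx d, f g m' * wignerD d m' m k}

/-- The projection onto the `m`-th column of `D^d`:
`f ↦ (2d+1) ∫_K f(gk) conj(D^d_{m,m}(k)) dk`. -/
def projCol (d : ℕ) (m : ℤ) (f : G → ℂ) (g : G) : ℂ :=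
  (2 * d + 1) * ∫ k : K, f (g * ofK k) * starRingEnd ℂ (wignerD d m m k) ∂haarK

/-- The vector projection `f ↦ (2d+1) ∫_K f(gk) D^d_{m,·}(k⁻¹) dk`. -/
def projVec (d : ℕ) (m : ℤ) (f : G → ℂ) (g : G) : Idx d → ℂ := fun n =>
  (2 * d + 1) * ∫ k : K, f (g * ofK k) * wignerD d m n (k⁻¹ : K) ∂haarK

/-! ### The operators `Ỹ^{d,a}` and `Y^a` -/

/-- Functions of the coordinates `x₁, x₂, x₃, y₁, y₂` of `U(ℝ) Y⁺`. -/
abbrev UYFun : Type := ℝ → ℝ → ℝ → ℝ → ℝ → ℂ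

/-- The differential operators `Z_j`, `|j| ≤ 2`, on functions on `U(ℝ) Y⁺`. -/
def Z (j : ℤ) (F : UYFun) : UYFun := fun x₁ x₂ x₃ y₁ y₂ =>
  let dx₁ := deriv (fun t => F t x₂ x₃ y₁ y₂) x₁
  let dx₂ := deriv (fun t => F x₁ t x₃ y₁ y₂) x₂
  let dx₃ := deriv (fun t => F x₁ x₂ t y₁ y₂) x₃
  let dy₁ := deriv (fun t => F x₁ x₂ x₃ t y₂) y₁
  let dy₂ := deriv (fun t => F x₁ x₂ x₃ y₁ t) y₂
  if j = 2 then (2 * y₂ * dy₂ - y₁ * dy₁) + 2 * Complex.I * y₂ * dx₂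
  else if j = 1 then -2 * Complex.I * y₁ * (dx₁ + x₂ * dx₃) - 2 * y₁ * y₂ * dx₃
  else if j = 0 then -((√6 : ℝ) : ℂ) * y₁ * dy₁
  else if j = -1 then -2 * Complex.I * y₁ * (dx₁ + x₂ * dx₃) + 2 * y₁ * y₂ * dx₃
  else if j = -2 then (2 * y₂ * dy₂ - y₁ * dy₁) - 2 * Complex.I * y₂ * dx₂
  else 0

/-- The constants `(√6/3) (-2(d+1), -(d+3), -3, d-2, 2d)`, indexed by `a = -2, …, 2`. -/
def constB (d : ℕ) (a : ℤ) : ℝ :=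
  √6 / 3 *
    (if a = -2 then -2 * ((d : ℝ) + 1)
    else if a = -1 then -((d : ℝ) + 3)
    else if a = 0 then -3
    else if a = 1 then (d : ℝ) - 2
    else if a = 2 then 2 * (d : ℝ)
    else 0)

/-- The operators `Ỹ^{d,a}_{m',j}`, `|a|, |j| ≤ 2`, on functions on `U(ℝ) Y⁺`. -/
def Yentry (d : ℕ) (a m' j : ℤ) (F : UYFun) : UYFun := fun x₁ x₂ x₃ y₁ y₂ =>
  cg d 2 a (m' - j) j *
    (Z j F x₁ x₂ x₃ y₁ y₂ +
      (if j = -2 then -(m' : ℂ) - 2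
      else if j = 0 then -((constB d a : ℝ) : ℂ)
      else if j = 2 then (m' : ℂ) - 2
      else 0) * F x₁ x₂ x₃ y₁ y₂)

/-- The coefficients `f_{m'}(xy)` in `∑_{m'} D^d_{m',0}(k) f_{m'}(xy) = (projCol d 0 f)(xyk)`, that is
`f_{m'}(xy) = (2d+1) ∫_K f(xyk) conj(D^d_{m',0}(k)) dk`; they vanish for `|m'| > d`. -/
def colCoeff (d : ℕ) (f : G → ℂ) (m' : ℤ) : UYFun := fun x₁ x₂ x₃ y₁ y₂ =>
  (2 * d + 1) * ∫ k : K, f (pt x₁ x₂ x₃ y₁ y₂ * ofK k) * starRingEnd ℂ (wignerD d m' 0 k) ∂haarK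

/-- The operator `Ỹ^{d,a}`, where `e = d + a`:
`(Ỹ^{d,a} f)(xyk) = ∑_{|m'| ≤ d+a} D^{d+a}_{m',0}(k) ∑_{|j| ≤ 2} Ỹ^{d,a}_{m',j} f_{m'-j}(xy)`. -/
def Ytilde (d e : ℕ) (f : G → ℂ) (g : G) : ℂ :=
  let c := iwasawa g
  ∑ m' ∈ Finset.Icc (-(e : ℤ)) e, wignerD e m' 0 c.k *
    ∑ j ∈ Finset.Icc (-2 : ℤ) 2,
      Yentry d ((e : ℤ) - d) m' j (colCoeff d f (m' - j)) c.x₁ c.x₂ c.x₃ c.y₁ c.y₂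

/-- The operator `Y^a` from functions with values in `ℂ^{2d+1}` to functions with values in
`ℂ^{2e+1}`, `e = d + a`: apply `Ỹ^{d,a}` to the central entry and project to the `K`-type `d + a`. -/
def Y (d e : ℕ) (f : G → Idx d → ℂ) : G → Idx e → ℂ :=
  projVec e 0 (Ytilde d e (entry f 0))

/-! ### Cusp forms -/

/-- The smooth vector-valued cusp forms for `Γ = SL(3, ℤ)` with `K`-type `D^d`. -/
structure IsCuspForm (d : ℕ) (f : G → Idx d → ℂ) : Prop where
  /-- `f` is smooth and `f(gk) = f(g) D^d(k)`. -/
  type_mem : f ∈ vectorType d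
  /-- `f` is a function on `Γ \ G`. -/
  invariant : ∀ γ ∈ Γ, ∀ g, f (γ * g) = f g
  /-- The degenerate Fourier coefficients `∫_{U(ℤ)\U(ℝ)} f(ug) ψ_n(u) du`, `n₁ n₂ = 0`, vanish. -/
  cuspidal : ∀ n₁ n₂ : ℤ, n₁ * n₂ = 0 → ∀ (g : G) (m : Idx d),
    ∫ x₁ in (0 : ℝ)..1, ∫ x₂ in (0 : ℝ)..1, ∫ x₃ in (0 : ℝ)..1,
      f (cls (matU x₁ x₂ x₃) * g) m *
        Complex.exp (2 * Real.pi * Complex.I * (n₁ * x₁ + n₂ * x₂)) = 0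
  /-- Uniform moderate growth: one exponent `r` for all `X₁ ⋯ X_n` in the enveloping algebra of
  `𝔤_ℂ`.  Here `G` is identified with `SL(3, ℝ) ⊂ ℝ⁹` and `‖g‖` is the Euclidean norm. -/
  growth : ∃ r : ℝ, 0 < r ∧ ∀ Xs : List (Matrix (Fin 3) (Fin 3) ℂ), (∀ X ∈ Xs, X.trace = 0) →
    ∃ C : ℝ, ∀ (M : Matrix.SpecialLinearGroup (Fin 3) ℝ) (m : Idx d),
      ‖Xs.foldr lie (fun g => f g m) (cls (M : Matrix (Fin 3) (Fin 3) ℝ))‖ ≤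
        C * √(∑ i, ∑ j, (M : Matrix (Fin 3) (Fin 3) ℝ) i j ^ 2) ^ r
  /-- `f` has finite norm, `∫_{Γ\G} ∑_m |f_m|² dg < ∞`. -/
  finite_norm : ∃ D : Set G, IsFundamentalDomain Γ D haarG ∧
    ∫⁻ g in D, ∑ m : Idx d, ‖f g m‖ₑ ^ 2 ∂haarG < ⊤

end SL3

end

noncomputable section

open scoped Matrix Polynomial ContDiff Nat

namespace SL3

open MeasureTheory Matrix

/-! ### Smooth functions on `G` through invertible matrices -/

/-! The theorem is the Wigner-Eckart principle for the five matrices `matX j`. Under conjugation by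
`K` they span the spin-2 representation (`adjoint_matX`), so differentiating the entries of a
function of `K`-type `d` produces a tensor of type `2 ⊗ d`. Contracting it with Clebsch-Gordan
coefficients isolates the component of spin `e = d + a`. This contraction, `Wop`, is transparently
left invariant and of `K`-type `e` (`Wop_mul_ofK`). All statements about `Ytilde` and `Y` are
deduced by identifying them with it (`Ytilde_eq_Wop`, `Y_eq_Wvec`).

The representation theory of `K` is obtained infinitesimally. A family of functions on `K` that
obeys the derivative rules of a row of `D^d` (`KDer`) is determined by its value at `1`: the rules
are skew-Hermitian, so pairings of such families are constant (`KDer.pairing`), because rotations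
about the axes generate `K`. Multiplicativity and unitarity of `D^d`, the rotation of the `X_j`, and
the Clebsch-Gordan series (`tens_wignerD`) all result from comparing values at `1`. The last one
rests on the recursions `cg_raise` and `cg_lower`, which become polynomial identities once the
square roots of factorials are cleared.

On `U(ℝ) Y⁺` each `X_j` splits into an upper triangular part, which differentiates along the
coordinates and gives `Z_j`, and a part in the complexified Lie algebra of `K`, which acts on the
index of the entry (`lie_matX_pt`). For `X_{±1}` the second part shifts that index, and the shifted
terms recombine into the constant `B^d_a` by `cg_constB`. This is `Wop_pt`. For scalar functions one
expands in columns of `D^d` and projects. The integral of `D^2 D^d` against the conjugate of `D^e`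
is a product of two Clebsch-Gordan coefficients (`integral_triple`), since it solves the recursions
that determine these up to a scalar. The operators `K_{±1}` then move between the components of
`Wop`.

For cusp forms, invariance, vanishing of constant terms and uniform moderate growth pass to
derivatives. Square integrability of the image comes from decay. A periodic function differs from
its mean by at most a high derivative; on a Siegel set each derivative in a unipotent direction
gains a factor of order `1 / y`, while the mean along a suitable unipotent radical vanishes
(`CuspScalar.siegel_bound`). Reduction theory (`exists_reduced`) moves every point into a Siegel
set, which is covered by dyadic translates of one compact set. These have equal Haar measure, so the
decay makes the sum of the integrals converge (`finite_norm_of_cuspScalar`). -/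

lemma cls_of_det_ne {M : Matrix (Fin 3) (Fin 3) ℝ} (h : M.det ≠ 0) :
    cls M = toG (Matrix.GeneralLinearGroup.mkOfDetNeZero M h) := dif_pos h

lemma cls_mul {M N : Matrix (Fin 3) (Fin 3) ℝ} (hM : M.det ≠ 0) (hN : N.det ≠ 0) :
    cls (M * N) = cls M * cls N := by
  have h : (M * N).det ≠ 0 := by rw [det_mul]; exact mul_ne_zero hM hN
  rw [cls_of_det_ne h, cls_of_det_ne hM, cls_of_det_ne hN, ← map_mul]
  congr 1
  ext1
  rfl

lemma cls_smul {M : Matrix (Fin 3) (Fin 3) ℝ} {c : ℝ} (hc : c ≠ 0) : cls (c • M) = cls M := by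
  by_cases hM : M.det = 0
  · have h : (c • M).det = 0 := by rw [det_smul, hM, mul_zero]
    simp [cls, hM, h]
  · have h : (c • M).det ≠ 0 := by
      rw [det_smul]; exact mul_ne_zero (pow_ne_zero _ hc) hM
    rw [cls_of_det_ne h, cls_of_det_ne hM]
    symm
    refine QuotientGroup.eq.mpr ?_
    rw [Matrix.GeneralLinearGroup.mem_center_iff_val_mem_range_scalar]
    refine ⟨c, ?_⟩
    have h1 : (Matrix.GeneralLinearGroup.mkOfDetNeZero (c • M) h : Matrix (Fin 3) (Fin 3) ℝ) =
      (Matrix.GeneralLinearGroup.mkOfDetNeZero M hM : Matrix (Fin 3) (Fin 3) ℝ) *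
        Matrix.scalar (Fin 3) c := by
      change c • M = M * Matrix.scalar (Fin 3) c
      ext i j
      simp [Matrix.scalar_apply, Matrix.mul_diagonal, mul_comm]
    rw [Units.val_mul, h1, ← mul_assoc, Units.inv_mul, one_mul]

lemma exists_cls (g : G) : ∃ M : Matrix (Fin 3) (Fin 3) ℝ, M.det ≠ 0 ∧ cls M = g := by
  obtain ⟨x, rfl⟩ := QuotientGroup.mk_surjective g
  have h : (x : Matrix (Fin 3) (Fin 3) ℝ).det ≠ 0 :=
    ((Matrix.isUnit_iff_isUnit_det _).mp x.isUnit).ne_zero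
  refine ⟨x, h, ?_⟩
  rw [cls_of_det_ne h]
  change toG _ = toG x
  congr 1
  ext1
  rfl

lemma cls_one : cls 1 = 1 := by
  have h : (1 : Matrix (Fin 3) (Fin 3) ℝ).det ≠ 0 := by simp
  have h1 := cls_mul h h
  rw [one_mul] at h1
  exact mul_eq_left.mp h1.symm

/-- The pull-back of `f` to the space of matrices. -/
def pull (f : G → ℂ) (M : Fin 3 → Fin 3 → ℝ) : ℂ := f (cls (Matrix.of M))

lemma isOpen_det : IsOpen {M : Fin 3 → Fin 3 → ℝ | (Matrix.of M).det ≠ 0} := by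
  have : Continuous fun M : Fin 3 → Fin 3 → ℝ => (Matrix.of M).det := by
    simp only [det_fin_three, Matrix.of_apply]; fun_prop
  exact isOpen_ne_fun this continuous_const

lemma IsSmooth.contDiffAt {f : G → ℂ} (hf : IsSmooth f) {M : Fin 3 → Fin 3 → ℝ}
    (hM : (Matrix.of M).det ≠ 0) : ContDiffAt ℝ ∞ (pull f) M :=
  ContDiffOn.contDiffAt hf (isOpen_det.mem_nhds hM)

lemma IsSmooth.differentiableAt {f : G → ℂ} (hf : IsSmooth f) {M : Fin 3 → Fin 3 → ℝ}
    (hM : (Matrix.of M).det ≠ 0) : DifferentiableAt ℝ (pull f) M :=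
  (hf.contDiffAt hM).differentiableAt (by simp)

/-- Entrywise derivative of a curve of matrices. -/
def CurveDeriv (γ : ℝ → Matrix (Fin 3) (Fin 3) ℝ) (v : Matrix (Fin 3) (Fin 3) ℝ) (t : ℝ) : Prop :=
  ∀ i j, HasDerivAt (fun s => γ s i j) (v i j) t

lemma CurveDeriv.hasDerivAt {γ : ℝ → Matrix (Fin 3) (Fin 3) ℝ} {v : Matrix (Fin 3) (Fin 3) ℝ}
    {t : ℝ} (h : CurveDeriv γ v t) :
    HasDerivAt (fun s => (Matrix.of.symm (γ s) : Fin 3 → Fin 3 → ℝ)) (Matrix.of.symm v) t :=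
  hasDerivAt_pi.mpr fun i => hasDerivAt_pi.mpr fun j => h i j

lemma CurveDeriv.mul_left {γ : ℝ → Matrix (Fin 3) (Fin 3) ℝ} {v : Matrix (Fin 3) (Fin 3) ℝ}
    {t : ℝ} (h : CurveDeriv γ v t) (N : Matrix (Fin 3) (Fin 3) ℝ) :
    CurveDeriv (fun s => N * γ s) (N * v) t := by
  intro i j
  simp only [Matrix.mul_apply]
  exact HasDerivAt.fun_sum fun l _ => (h l j).const_mul _

lemma CurveDeriv.mul_right {γ : ℝ → Matrix (Fin 3) (Fin 3) ℝ} {v : Matrix (Fin 3) (Fin 3) ℝ}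
    {t : ℝ} (h : CurveDeriv γ v t) (N : Matrix (Fin 3) (Fin 3) ℝ) :
    CurveDeriv (fun s => γ s * N) (v * N) t := by
  intro i j
  simp only [Matrix.mul_apply]
  exact HasDerivAt.fun_sum fun l _ => (h i l).mul_const _

/-- The derivative of `f` at the class of `M` in the direction of the matrix `V`. -/
def dpull (f : G → ℂ) (M V : Matrix (Fin 3) (Fin 3) ℝ) : ℂ :=
  fderiv ℝ (pull f) (Matrix.of.symm M) (Matrix.of.symm V)

lemma dpull_add (f : G → ℂ) (M V W : Matrix (Fin 3) (Fin 3) ℝ) :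
    dpull f M (V + W) = dpull f M V + dpull f M W :=
  map_add (fderiv ℝ (pull f) (Matrix.of.symm M)) (Matrix.of.symm V) (Matrix.of.symm W)

lemma dpull_smul (f : G → ℂ) (M V : Matrix (Fin 3) (Fin 3) ℝ) (c : ℝ) :
    dpull f M (c • V) = c * dpull f M V := by
  have := map_smul (fderiv ℝ (pull f) (Matrix.of.symm M)) c (Matrix.of.symm V)
  rw [Complex.real_smul] at this
  exact this

lemma hasDerivAt_curve {f : G → ℂ} (hf : IsSmooth f) {γ : ℝ → Matrix (Fin 3) (Fin 3) ℝ}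
    {v : Matrix (Fin 3) (Fin 3) ℝ} {t : ℝ} (h : CurveDeriv γ v t) (hdet : (γ t).det ≠ 0) :
    HasDerivAt (fun s => f (cls (γ s))) (dpull f (γ t) v) t := by
  have h1 : DifferentiableAt ℝ (pull f) (Matrix.of.symm (γ t)) := hf.differentiableAt hdet
  exact h1.hasFDerivAt.comp_hasDerivAt t h.hasDerivAt

lemma det_exp_ne (X : Matrix (Fin 3) (Fin 3) ℝ) : (NormedSpace.exp X).det ≠ 0 :=
  ((Matrix.isUnit_iff_isUnit_det _).mp (Matrix.isUnit_exp X)).ne_zero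

lemma curveDeriv_exp (X : Matrix (Fin 3) (Fin 3) ℝ) :
    CurveDeriv (fun t : ℝ => NormedSpace.exp (t • X)) X 0 := by
  have h : HasDerivAt (fun t : ℝ => NormedSpace.exp (t • X)) X 0 := by
    -- Differentiating the exponential requires a norm on matrices; the operator norm serves
    -- locally, and the result is then read entrywise.
    open scoped Matrix.Norms.Operator in
    have := hasDerivAt_exp_smul_const (𝕂 := ℝ) X 0
    simp only [zero_smul, NormedSpace.exp_zero, one_mul] at this
    exact this
  intro i j
  exact hasDerivAt_pi.mp (hasDerivAt_pi.mp h i) j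

/-- The curve `M exp(tX)` leaves `M` with velocity `M X`. Linearity in `X`, smoothness, and
independence of the chosen curve all come from this formula. -/
lemma realLie_cls {f : G → ℂ} (hf : IsSmooth f) (X : Matrix (Fin 3) (Fin 3) ℝ)
    {M : Matrix (Fin 3) (Fin 3) ℝ} (hM : M.det ≠ 0) :
    realLie X f (cls M) = dpull f M (M * X) := by
  have h := hasDerivAt_curve hf ((curveDeriv_exp X).mul_left M)
    (by rw [det_mul]; exact mul_ne_zero hM (det_exp_ne _))
  rw [zero_smul, NormedSpace.exp_zero, mul_one] at h
  rw [← h.deriv, realLie]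
  congr 1
  funext t
  rw [cls_mul hM (det_exp_ne _)]

/-- The derivative along any curve through `1` with tangent `X`. -/
lemma realLie_eq_of_curve {f : G → ℂ} (hf : IsSmooth f) {X : Matrix (Fin 3) (Fin 3) ℝ}
    {γ : ℝ → Matrix (Fin 3) (Fin 3) ℝ} (h : CurveDeriv γ X 0) (h0 : γ 0 = 1)
    (hdet : ∀ t, (γ t).det ≠ 0) (g : G) :
    HasDerivAt (fun t => f (g * cls (γ t))) (realLie X f g) 0 := by
  obtain ⟨M, hM, rfl⟩ := exists_cls g
  have h1 := hasDerivAt_curve hf (h.mul_left M)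
    (by rw [det_mul]; exact mul_ne_zero hM (hdet _))
  rw [h0, mul_one] at h1
  rw [realLie_cls hf X hM]
  refine h1.congr_of_eventuallyEq (Filter.Eventually.of_forall fun t => ?_)
  simp only []
  rw [cls_mul hM (hdet _)]

lemma isSmooth_iff_pull {f : G → ℂ} :
    IsSmooth f ↔ ContDiffOn ℝ ∞ (pull f) {M | (Matrix.of M).det ≠ 0} := Iff.rfl

lemma IsSmooth.add {f g : G → ℂ} (hf : IsSmooth f) (hg : IsSmooth g) :
    IsSmooth fun x => f x + g x := ContDiffOn.add hf hg

lemma IsSmooth.const_mul {f : G → ℂ} (c : ℂ) (hf : IsSmooth f) :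
    IsSmooth fun x => c * f x := ContDiffOn.mul contDiffOn_const hf

lemma isSmooth_zero : IsSmooth fun _ => 0 := contDiffOn_const

lemma IsSmooth.sum {ι : Type*} (s : Finset ι) {f : ι → G → ℂ} (h : ∀ i ∈ s, IsSmooth (f i)) :
    IsSmooth fun x => ∑ i ∈ s, f i x :=
  ContDiffOn.sum (f := fun i => pull (f i)) h

lemma contDiff_entries {γ : (Fin 3 → Fin 3 → ℝ) → Matrix (Fin 3) (Fin 3) ℝ}
    (h : ∀ i j, ContDiff ℝ ∞ fun M => γ M i j) :
    ContDiff ℝ ∞ fun M => (Matrix.of.symm (γ M) : Fin 3 → Fin 3 → ℝ) :=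
  contDiff_pi.mpr fun i => contDiff_pi.mpr fun j => h i j

lemma IsSmooth.mul_left {f : G → ℂ} (hf : IsSmooth f) (h : G) : IsSmooth fun g => f (h * g) := by
  obtain ⟨N, hN, rfl⟩ := exists_cls h
  have h2 : ContDiff ℝ ∞ fun M : Fin 3 → Fin 3 → ℝ =>
      (Matrix.of.symm (N * Matrix.of M) : Fin 3 → Fin 3 → ℝ) := by
    refine contDiff_entries fun i j => ?_
    simp only [Matrix.mul_apply, Matrix.of_apply]; fun_prop
  refine ContDiffOn.congr (ContDiffOn.comp (t := {M | (Matrix.of M).det ≠ 0}) hf h2.contDiffOn ?_) ?_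
  · intro M hM
    change (N * Matrix.of M).det ≠ 0
    rw [det_mul]; exact mul_ne_zero hN hM
  · intro M hM
    simp only [Function.comp, Equiv.apply_symm_apply]
    rw [cls_mul hN hM]

lemma IsSmooth.mul_right {f : G → ℂ} (hf : IsSmooth f) (h : G) : IsSmooth fun g => f (g * h) := by
  obtain ⟨N, hN, rfl⟩ := exists_cls h
  have h2 : ContDiff ℝ ∞ fun M : Fin 3 → Fin 3 → ℝ =>
      (Matrix.of.symm (Matrix.of M * N) : Fin 3 → Fin 3 → ℝ) := by
    refine contDiff_entries fun i j => ?_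
    simp only [Matrix.mul_apply, Matrix.of_apply]; fun_prop
  refine ContDiffOn.congr (ContDiffOn.comp (t := {M | (Matrix.of M).det ≠ 0}) hf h2.contDiffOn ?_) ?_
  · intro M hM
    change (Matrix.of M * N).det ≠ 0
    rw [det_mul]; exact mul_ne_zero hM hN
  · intro M hM
    simp only [Function.comp, Equiv.apply_symm_apply]
    rw [cls_mul hM hN]

lemma IsSmooth.realLie {f : G → ℂ} (hf : IsSmooth f) (X : Matrix (Fin 3) (Fin 3) ℝ) :
    IsSmooth (realLie X f) := by
  have h1 : ContDiffOn ℝ ∞ (fderiv ℝ (pull f)) {M | (Matrix.of M).det ≠ 0} :=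
    ((isSmooth_iff_pull.mp hf).fderiv_of_isOpen isOpen_det (by simp))
  have h2 : ContDiff ℝ ∞ fun M : Fin 3 → Fin 3 → ℝ =>
      (Matrix.of.symm (Matrix.of M * X) : Fin 3 → Fin 3 → ℝ) := by
    refine contDiff_entries fun i j => ?_
    simp only [Matrix.mul_apply, Matrix.of_apply]; fun_prop
  refine ContDiffOn.congr (h1.clm_apply h2.contDiffOn) ?_
  intro M hM
  exact realLie_cls hf X hM

lemma IsSmooth.lie {f : G → ℂ} (hf : IsSmooth f) (X : Matrix (Fin 3) (Fin 3) ℂ) :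
    IsSmooth (lie X f) := (hf.realLie _).add ((hf.realLie _).const_mul _)

lemma realLie_add_mat {f : G → ℂ} (hf : IsSmooth f) (X Y : Matrix (Fin 3) (Fin 3) ℝ) (g : G) :
    realLie (X + Y) f g = realLie X f g + realLie Y f g := by
  obtain ⟨M, hM, rfl⟩ := exists_cls g
  rw [realLie_cls hf _ hM, realLie_cls hf _ hM, realLie_cls hf _ hM, mul_add, dpull_add]

lemma realLie_smul_mat {f : G → ℂ} (hf : IsSmooth f) (c : ℝ) (X : Matrix (Fin 3) (Fin 3) ℝ)
    (g : G) : realLie (c • X) f g = c * realLie X f g := by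
  obtain ⟨M, hM, rfl⟩ := exists_cls g
  rw [realLie_cls hf _ hM, realLie_cls hf _ hM, mul_smul_comm, dpull_smul]

lemma hasDerivAt_realLie {f : G → ℂ} (hf : IsSmooth f) (X : Matrix (Fin 3) (Fin 3) ℝ) (g : G) :
    HasDerivAt (fun t : ℝ => f (g * cls (NormedSpace.exp (t • X)))) (realLie X f g) 0 :=
  realLie_eq_of_curve hf (curveDeriv_exp X) (by simp) (fun _ => det_exp_ne _) g

lemma realLie_sum_fun {ι : Type*} (s : Finset ι) {f : ι → G → ℂ} (h : ∀ i ∈ s, IsSmooth (f i))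
    (c : ι → ℂ) (X : Matrix (Fin 3) (Fin 3) ℝ) (g : G) :
    realLie X (fun x => ∑ i ∈ s, c i * f i x) g = ∑ i ∈ s, c i * realLie X (f i) g :=
  (HasDerivAt.fun_sum fun i hi => (hasDerivAt_realLie (h i hi) X g).const_mul (c i)).deriv

lemma lie_sum_fun {ι : Type*} (s : Finset ι) {f : ι → G → ℂ} (h : ∀ i ∈ s, IsSmooth (f i))
    (c : ι → ℂ) (X : Matrix (Fin 3) (Fin 3) ℂ) (g : G) :
    lie X (fun x => ∑ i ∈ s, c i * f i x) g = ∑ i ∈ s, c i * lie X (f i) g := by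
  simp only [lie, realLie_sum_fun s h, Finset.mul_sum, ← Finset.sum_add_distrib]
  exact Finset.sum_congr rfl fun i _ => by ring

lemma lie_add_mat {f : G → ℂ} (hf : IsSmooth f) (X Y : Matrix (Fin 3) (Fin 3) ℂ) (g : G) :
    lie (X + Y) f g = lie X f g + lie Y f g := by
  have h1 : (X + Y).map Complex.re = X.map Complex.re + Y.map Complex.re := by ext; simp
  have h2 : (X + Y).map Complex.im = X.map Complex.im + Y.map Complex.im := by ext; simp
  simp only [lie, h1, h2, realLie_add_mat hf]
  ring

lemma lie_smul_mat {f : G → ℂ} (hf : IsSmooth f) (c : ℂ) (X : Matrix (Fin 3) (Fin 3) ℂ) (g : G) :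
    lie (c • X) f g = c * lie X f g := by
  have h1 : (c • X).map Complex.re = c.re • X.map Complex.re + (-c.im) • X.map Complex.im := by
    ext; simp; ring
  have h2 : (c • X).map Complex.im = c.re • X.map Complex.im + c.im • X.map Complex.re := by
    ext; simp
  simp only [lie, h1, h2, realLie_add_mat hf, realLie_smul_mat hf]
  have hc : c = c.re + c.im * Complex.I := (Complex.re_add_im c).symm
  generalize realLie (X.map Complex.re) f g = u
  generalize realLie (X.map Complex.im) f g = v
  conv_rhs => rw [hc]
  push_cast
  linear_combination (-(c.im : ℂ) * v) * Complex.I_sq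

lemma lie_zero_mat {f : G → ℂ} (hf : IsSmooth f) (g : G) : lie 0 f g = 0 := by
  have := lie_smul_mat hf 0 0 g
  simpa using this

lemma lie_sum_mat {ι : Type*} (s : Finset ι) {f : G → ℂ} (hf : IsSmooth f) (c : ι → ℂ)
    (X : ι → Matrix (Fin 3) (Fin 3) ℂ) (g : G) :
    lie (∑ i ∈ s, c i • X i) f g = ∑ i ∈ s, c i * lie (X i) f g := by
  classical
  induction s using Finset.induction_on with
  | empty => simpa using lie_zero_mat hf g
  | insert i s hi ih =>
    rw [Finset.sum_insert hi, Finset.sum_insert hi, lie_add_mat hf, lie_smul_mat hf, ih]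

lemma lie_ofReal {f : G → ℂ} (hf : IsSmooth f) (X : Matrix (Fin 3) (Fin 3) ℝ) (g : G) :
    lie (X.map Complex.ofReal) f g = realLie X f g := by
  have h1 : (X.map Complex.ofReal).map Complex.re = X := by ext; simp
  have h2 : (X.map Complex.ofReal).map Complex.im = (0 : ℝ) • X := by ext; simp
  rw [lie, h1, h2, realLie_smul_mat hf]
  simp

lemma realLie_mul_left (X : Matrix (Fin 3) (Fin 3) ℝ) (f : G → ℂ) (h g : G) :
    realLie X (fun x => f (h * x)) g = realLie X f (h * g) := by
  simp only [realLie, mul_assoc]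

lemma lie_mul_left (X : Matrix (Fin 3) (Fin 3) ℂ) (f : G → ℂ) (h g : G) :
    lie X (fun x => f (h * x)) g = lie X f (h * g) := by
  simp only [lie, realLie_mul_left]

/-- Right translation by `k` conjugates the direction of differentiation. -/
lemma realLie_mul_right {f : G → ℂ} (hf : IsSmooth f) (X N : Matrix (Fin 3) (Fin 3) ℝ)
    (hN : N.det ≠ 0) (g : G) :
    realLie X f (g * cls N) = realLie (N * X * N⁻¹) (fun x => f (x * cls N)) g := by
  obtain ⟨M, hM, rfl⟩ := exists_cls g
  have hi : N⁻¹ * N = 1 := Matrix.nonsing_inv_mul _ hN.isUnit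
  have hs := hf.mul_right (cls N)
  have h1 := hasDerivAt_realLie hs (N * X * N⁻¹) (cls M)
  -- Both sides are derivatives at `0` along the curve `M exp(t N X N⁻¹) N`, which passes through `M
  -- N` with velocity `M N X`.
  have h2 : CurveDeriv (fun t : ℝ => NormedSpace.exp (t • (N * X * N⁻¹)) * N) (N * X) 0 := by
    have := (curveDeriv_exp (N * X * N⁻¹)).mul_right N
    rwa [mul_assoc (N * X), hi, mul_one] at this
  have h3 := hasDerivAt_curve hf (h2.mul_left M)
    (by simp only [det_mul]; exact mul_ne_zero hM (mul_ne_zero (det_exp_ne _) hN))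
  have h4 := h3.congr_of_eventuallyEq (f₁ := fun t : ℝ =>
    f (cls M * cls (NormedSpace.exp (t • (N * X * N⁻¹))) * cls N))
    (Filter.Eventually.of_forall fun t => by
      simp only []
      rw [← cls_mul hM (det_exp_ne _), ← cls_mul _ hN, mul_assoc]
      rw [det_mul]; exact mul_ne_zero hM (det_exp_ne _))
  rw [h1.unique h4, ← cls_mul hM hN, realLie_cls hf _ (by rw [det_mul]; exact mul_ne_zero hM hN)]
  simp [mul_assoc]

lemma lie_mul_right {f : G → ℂ} (hf : IsSmooth f) (X : Matrix (Fin 3) (Fin 3) ℂ)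
    (N : Matrix (Fin 3) (Fin 3) ℝ) (hN : N.det ≠ 0) (g : G) :
    lie X f (g * cls N) =
      lie (N.map Complex.ofReal * X * N⁻¹.map Complex.ofReal) (fun x => f (x * cls N)) g := by
  have h1 : (N.map Complex.ofReal * X * N⁻¹.map Complex.ofReal).map Complex.re =
      N * X.map Complex.re * N⁻¹ := by
    ext i j; simp [Matrix.mul_apply, Finset.sum_mul]
  have h2 : (N.map Complex.ofReal * X * N⁻¹.map Complex.ofReal).map Complex.im =
      N * X.map Complex.im * N⁻¹ := by
    ext i j; simp [Matrix.mul_apply, Finset.sum_mul]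
  simp only [lie, h1, h2, realLie_mul_right hf _ N hN]

/-! ### Rotations -/

/-- Rotation by `t` about the coordinate axis `ax`. -/
def rotMat (ax : Fin 3) (t : ℝ) : Matrix (Fin 3) (Fin 3) ℝ :=
  match ax with
  | 0 => !![1, 0, 0; 0, Real.cos t, -Real.sin t; 0, Real.sin t, Real.cos t]
  | 1 => !![Real.cos t, 0, Real.sin t; 0, 1, 0; -Real.sin t, 0, Real.cos t]
  | 2 => !![Real.cos t, -Real.sin t, 0; Real.sin t, Real.cos t, 0; 0, 0, 1]

/-- The infinitesimal rotation about the axis `ax`. -/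
def rotGen (ax : Fin 3) : Matrix (Fin 3) (Fin 3) ℝ :=
  match ax with
  | 0 => !![0, 0, 0; 0, 0, -1; 0, 1, 0]
  | 1 => !![0, 0, 1; 0, 0, 0; -1, 0, 0]
  | 2 => !![0, -1, 0; 1, 0, 0; 0, 0, 0]

lemma rotMat_mem (ax : Fin 3) (t : ℝ) : rotMat ax t ∈ specialOrthogonalGroup (Fin 3) ℝ := by
  have h := Real.sin_sq_add_cos_sq t
  rw [mem_specialOrthogonalGroup_iff, mem_orthogonalGroup_iff]
  constructor
  · fin_cases ax <;> ext i j <;> fin_cases i <;> fin_cases j <;>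
      simp [rotMat, Matrix.mul_apply, Fin.sum_univ_three] <;> linarith
  · fin_cases ax <;> simp [rotMat, det_fin_three] <;> linarith

/-- Rotation by `t` about the coordinate axis `ax`, as an element of `K`. -/
def rot (ax : Fin 3) (t : ℝ) : K := ⟨rotMat ax t, rotMat_mem ax t⟩

lemma rot_zero (ax : Fin 3) : rot ax 0 = 1 := by
  apply Subtype.ext
  fin_cases ax <;> ext i j <;> fin_cases i <;> fin_cases j <;> simp [rot, rotMat]

lemma rot_add (ax : Fin 3) (s t : ℝ) : rot ax (s + t) = rot ax s * rot ax t := by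
  apply Subtype.ext
  change rotMat ax (s + t) = rotMat ax s * rotMat ax t
  fin_cases ax <;> ext i j <;> fin_cases i <;> fin_cases j <;>
    simp [rotMat, Matrix.mul_apply, Fin.sum_univ_three, Real.sin_add, Real.cos_add] <;> ring

lemma curveDeriv_rot (ax : Fin 3) : CurveDeriv (rotMat ax) (rotGen ax) 0 := by
  have hs : HasDerivAt Real.sin 1 0 := by simpa using Real.hasDerivAt_sin 0
  have hc : HasDerivAt Real.cos 0 0 := by simpa using Real.hasDerivAt_cos 0
  have hs' : HasDerivAt (fun t => -Real.sin t) (-1) 0 := hs.neg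
  intro i j
  fin_cases ax <;> fin_cases i <;> fin_cases j <;>
    simp [rotMat, rotGen] <;>
    first | exact hs | exact hc | exact hs' | exact hasDerivAt_const _ _

lemma K_mul_transpose (k : K) : (k : Matrix (Fin 3) (Fin 3) ℝ) * (k : Matrix _ _ ℝ)ᵀ = 1 :=
  (mem_orthogonalGroup_iff (Fin 3) ℝ).mp (mem_specialOrthogonalGroup_iff.mp k.2).1

lemma K_transpose_mul (k : K) : (k : Matrix (Fin 3) (Fin 3) ℝ)ᵀ * (k : Matrix _ _ ℝ) = 1 :=
  mul_eq_one_comm.mp (K_mul_transpose k)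

lemma K_det (k : K) : (k : Matrix (Fin 3) (Fin 3) ℝ).det = 1 :=
  (mem_specialOrthogonalGroup_iff.mp k.2).2

lemma K_det_ne (k : K) : (k : Matrix (Fin 3) (Fin 3) ℝ).det ≠ 0 := by
  rw [K_det]; exact one_ne_zero

lemma ofK_mul (k l : K) : ofK (k * l) = ofK k * ofK l := cls_mul (K_det_ne k) (K_det_ne l)

lemma ofK_one : ofK 1 = 1 := cls_one

lemma exists_sin_cos (a b : ℝ) : ∃ t r : ℝ, 0 ≤ r ∧ a = r * Real.cos t ∧ b = r * Real.sin t := by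
  refine ⟨Complex.arg ⟨a, b⟩, ‖(⟨a, b⟩ : ℂ)‖, norm_nonneg _, ?_, ?_⟩
  · exact (Complex.norm_mul_cos_arg (⟨a, b⟩ : ℂ)).symm
  · exact (Complex.norm_mul_sin_arg (⟨a, b⟩ : ℂ)).symm

lemma rot_neg_mul (ax : Fin 3) (t : ℝ) : rot ax t * rot ax (-t) = 1 := by
  rw [← rot_add, add_neg_cancel, rot_zero]

/-- The orthogonality and determinant relations combine into `(v - p)² + (q + u)² = 0`, so the upper
left block is a planar rotation. -/
lemma planar_rotation {p q u v x y s : ℝ} (hs : 0 ≤ s) (h22 : s * s = 1)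
    (q22 : x * x + y * y + s * s = 1) (h00 : p * p + u * u + x * x = 1)
    (h11 : q * q + v * v + y * y = 1) (hd : (p * v - q * u) * s = 1) :
    s = 1 ∧ x = 0 ∧ y = 0 ∧ v = p ∧ q = -u ∧ p ^ 2 + u ^ 2 = 1 := by
  have s1 : s = 1 := by nlinarith
  subst s1
  have hx : x = 0 := by nlinarith [sq_nonneg x, sq_nonneg y]
  have hy : y = 0 := by nlinarith [sq_nonneg x, sq_nonneg y]
  subst hx hy
  have h : (v - p) ^ 2 + (q + u) ^ 2 = 0 := by linear_combination h00 + h11 - 2 * hd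
  have h1 : (v - p) ^ 2 = 0 := by nlinarith [sq_nonneg (v - p), sq_nonneg (q + u)]
  have h2 : (q + u) ^ 2 = 0 := by nlinarith [sq_nonneg (v - p), sq_nonneg (q + u)]
  exact ⟨rfl, rfl, rfl, by linarith [pow_eq_zero_iff (two_ne_zero) |>.mp h1],
    by linarith [pow_eq_zero_iff (two_ne_zero) |>.mp h2], by linarith⟩

lemma eq_rot_two (k : K) (f1 : k.1 0 2 = 0) (f2 : k.1 1 2 = 0) (f3 : 0 ≤ k.1 2 2) :
    ∃ c, k = rot 2 c := by
  have o1 := K_mul_transpose k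
  have o2 := K_transpose_mul k
  have dt := K_det k
  have p22 := congrFun (congrFun o2 2) 2
  have q22 := congrFun (congrFun o1 2) 2
  have p00 := congrFun (congrFun o2 0) 0
  have p11 := congrFun (congrFun o2 1) 1
  simp only [Matrix.mul_apply, Fin.sum_univ_three, Matrix.transpose_apply, Matrix.one_apply_eq]
    at p22 q22 p00 p11
  rw [det_fin_three] at dt
  rw [f1, f2] at p22 dt
  obtain ⟨h1, h2, h3, h4, h5, h6⟩ := planar_rotation f3 (by linarith) q22 p00 p11 (by linarith)
  obtain ⟨c, w, hw, h7, h8⟩ := exists_sin_cos (k.1 0 0) (k.1 1 0)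
  have w1 : w = 1 := by
    have : w ^ 2 = 1 := by
      rw [h7, h8] at h6
      linear_combination h6 - w ^ 2 * Real.sin_sq_add_cos_sq c
    nlinarith
  rw [w1, one_mul] at h7 h8
  refine ⟨c, Subtype.ext ?_⟩
  ext i j
  fin_cases i <;> fin_cases j
  · exact h7
  · exact h5.trans (congrArg _ h8)
  · exact f1
  · exact h8
  · exact h4.trans h7
  · exact f2
  · exact h2
  · exact h3
  · exact h1

/-- Euler's decomposition of a rotation. -/
lemma exists_euler (k : K) : ∃ a b c : ℝ, k = rot 2 a * rot 0 b * rot 2 c := by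
  obtain ⟨a, r, -, h1, h2⟩ := exists_sin_cos (-(k : Matrix (Fin 3) (Fin 3) ℝ) 1 2) (k.1 0 2)
  have sc := fun t => Real.sin_sq_add_cos_sq t
  -- remove the first coordinate of the last column
  set k1 : K := rot 2 (-a) * k with hk1
  have e1 : k1.1 0 2 = 0 := by
    simp only [hk1, rot, rotMat, Submonoid.coe_mul, Matrix.mul_apply, Fin.sum_univ_three]
    simp
    rw [h2, show k.1 1 2 = -(r * Real.cos a) by linarith]; ring
  -- The radius `s ≥ 0` becomes the last diagonal entry of `k2`; its sign rules out a last column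
  -- equal to minus the third basis vector.
  obtain ⟨b, s, hs, h3, h4⟩ := exists_sin_cos (k1.1 2 2) (-(k1.1 1 2))
  set k2 : K := rot 0 (-b) * k1 with hk2
  have f1 : k2.1 0 2 = 0 := by
    simp only [hk2, rot, rotMat, Submonoid.coe_mul, Matrix.mul_apply, Fin.sum_univ_three]
    simp [e1]
  have f2 : k2.1 1 2 = 0 := by
    simp only [hk2, rot, rotMat, Submonoid.coe_mul, Matrix.mul_apply, Fin.sum_univ_three]
    simp
    rw [h3, show k1.1 1 2 = -(s * Real.sin b) by linarith]; ring
  have f3 : k2.1 2 2 = s := by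
    simp only [hk2, rot, rotMat, Submonoid.coe_mul, Matrix.mul_apply, Fin.sum_univ_three]
    simp
    rw [h3, show k1.1 1 2 = -(s * Real.sin b) by linarith]
    linear_combination s * sc b
  obtain ⟨c, k2c⟩ := eq_rot_two k2 f1 f2 (f3 ▸ hs)
  refine ⟨a, b, c, ?_⟩
  rw [← k2c, hk2, hk1, mul_assoc (rot 2 a), ← mul_assoc (rot 0 b), rot_neg_mul, one_mul,
    ← mul_assoc, rot_neg_mul, one_mul]

/-- A function that is constant along rotations about the axes is constant. -/
lemma eq_of_rot_invariant {α : Type*} {s : K → α} (h : ∀ ax k t, s (k * rot ax t) = s k) (k : K) :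
    s k = s 1 := by
  obtain ⟨a, b, c, rfl⟩ := exists_euler k
  rw [h, h, ← one_mul (rot 2 a), h]

/-! ### The Wigner matrices: derivatives along rotations -/

/-- The coefficient of the raising operator. -/
def cp (d : ℕ) (m : ℤ) : ℂ := (√((d : ℝ) * (d + 1) - m * (m + 1)) : ℝ)

/-- The coefficient of the lowering operator. -/
def cm (d : ℕ) (m : ℤ) : ℂ := (√((d : ℝ) * (d + 1) - m * (m - 1)) : ℝ)

/-- The `K_1`-coordinate of `rotGen` in the basis `K_1, K_{-1}, L_z`. -/
def coefP (ax : Fin 3) : ℂ := ![-Complex.I / 2, -1 / 2, 0] ax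

/-- The `K_{-1}`-coordinate of `rotGen`. -/
def coefM (ax : Fin 3) : ℂ := ![-Complex.I / 2, 1 / 2, 0] ax

/-- The `L_z`-coordinate of `rotGen`. -/
def coefZ (ax : Fin 3) : ℂ := ![0, 0, 1] ax

/-- Writing the real generators in terms of `K_1`, `K_{-1}` and `L_z` lets one formula, `colDer`,
govern all three axes. -/
lemma rotGen_map (ax : Fin 3) : (rotGen ax).map Complex.ofReal =
    coefP ax • matK1 1 + coefM ax • matK1 (-1) + coefZ ax • (rotGen 2).map Complex.ofReal := by
  have hI := Complex.I_mul_I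
  fin_cases ax <;> ext i j <;> fin_cases i <;> fin_cases j <;>
    simp [rotGen, coefP, coefM, coefZ, matK1] <;> ring_nf <;> simp

/-- Coefficientwise derivative of a family of polynomials. -/
def PolyDeriv (p : ℝ → ℂ[X]) (p' : ℂ[X]) (t : ℝ) : Prop :=
  ∀ n, HasDerivAt (fun s => (p s).coeff n) (p'.coeff n) t

lemma PolyDeriv.mul {p q : ℝ → ℂ[X]} {p' q' : ℂ[X]} {t : ℝ} (hp : PolyDeriv p p' t)
    (hq : PolyDeriv q q' t) : PolyDeriv (fun s => p s * q s) (p' * q t + p t * q') t := by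
  intro n
  simp only [Polynomial.coeff_mul, Polynomial.coeff_add, ← Finset.sum_add_distrib]
  exact HasDerivAt.fun_sum fun x _ => (hp x.1).mul (hq x.2)

lemma PolyDeriv.pow {p : ℝ → ℂ[X]} {p' : ℂ[X]} {t : ℝ} (hp : PolyDeriv p p' t) (n : ℕ) :
    PolyDeriv (fun s => p s ^ n) (n * p t ^ (n - 1) * p') t := by
  induction n with
  | zero => intro n; simpa using hasDerivAt_const _ _
  | succ n ih =>
    have := ih.mul hp
    simp only [← pow_succ] at this
    convert this using 1
    rcases n with _ | n
    · simp
    · simp only [Nat.add_sub_cancel]; push_cast; ring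

/-! ### Infinitesimal rotations of binary forms. -/

/-- `k` acting on the quadratic form of `w`. -/
def actQ (k : Matrix (Fin 3) (Fin 3) ℝ) (w : Fin 3 → ℂ) : ℂ[X] :=
  quadForm (k.map Complex.ofReal *ᵥ w)

lemma quadForm_add (v w : Fin 3 → ℂ) : quadForm (v + w) = quadForm v + quadForm w := by
  simp only [quadForm, Pi.add_apply, mul_add, add_div, Polynomial.C_add, add_mul]; ring

lemma quadForm_smul (c : ℂ) (w : Fin 3 → ℂ) :
    quadForm (c • w) = Polynomial.C c * quadForm w := by
  simp only [quadForm, Pi.smul_apply, smul_eq_mul]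
  rw [mul_div_assoc, show Complex.I * (c * w 1) / 2 = c * (Complex.I * w 1 / 2) by ring]
  simp only [Polynomial.C_mul]; ring

lemma actQ_add (k : Matrix (Fin 3) (Fin 3) ℝ) (v w : Fin 3 → ℂ) :
    actQ k (v + w) = actQ k v + actQ k w := by
  simp only [actQ, mulVec_add, quadForm_add]

lemma actQ_smul (k : Matrix (Fin 3) (Fin 3) ℝ) (c : ℂ) (w : Fin 3 → ℂ) :
    actQ k (c • w) = Polynomial.C c * actQ k w := by
  simp only [actQ, mulVec_smul, quadForm_smul]

lemma polyDeriv_quadForm {w : ℝ → Fin 3 → ℂ} {w' : Fin 3 → ℂ} {t : ℝ}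
    (h : ∀ i, HasDerivAt (fun s => w s i) (w' i) t) :
    PolyDeriv (fun s => quadForm (w s)) (quadForm w') t := by
  intro n
  simp only [quadForm, Polynomial.coeff_add, Polynomial.coeff_C_mul]
  exact ((((h 0).div_const 2).mul_const _).add
    ((((h 1).const_mul Complex.I).div_const 2).mul_const _)).add ((h 2).mul_const _)

lemma polyDeriv_actQ {γ : ℝ → Matrix (Fin 3) (Fin 3) ℝ} {k X : Matrix (Fin 3) (Fin 3) ℝ} {t : ℝ}
    (h : CurveDeriv γ (k * X) t) (w : Fin 3 → ℂ) :
    PolyDeriv (fun s => actQ (γ s) w) (actQ k (X.map Complex.ofReal *ᵥ w)) t := by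
  refine polyDeriv_quadForm fun i => ?_
  rw [mulVec_mulVec]
  have e : k.map Complex.ofReal * X.map Complex.ofReal = (k * X).map Complex.ofReal :=
    (Matrix.map_mul (f := Complex.ofRealHom)).symm
  rw [e]
  simp only [mulVec, dotProduct, Matrix.map_apply]
  exact HasDerivAt.fun_sum fun j _ => ((h i j).ofReal_comp).mul_const _

/-- The spin-1 ladder on `u²`, `uv`, `v²`: `K_{-1}` sends `u²` to `2uv`, `K_1` kills it, and `L_z`
has eigenvalue `-i` on it. The next two lemmas treat `v²` and `uv`. -/
lemma gen_mulVec_plus (ax : Fin 3) : (rotGen ax).map Complex.ofReal *ᵥ extremal 1 =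
    (2 * coefM ax) • ![0, 0, 1] + (-Complex.I * coefZ ax) • extremal 1 := by
  rw [rotGen_map]
  ext i; fin_cases i <;>
    simp [matK1, rotGen, extremal, mulVec, dotProduct, Fin.sum_univ_three] <;>
    ring_nf <;> simp <;> ring

lemma gen_mulVec_minus (ax : Fin 3) : (rotGen ax).map Complex.ofReal *ᵥ extremal (-1) =
    (2 * coefP ax) • ![0, 0, 1] + (Complex.I * coefZ ax) • extremal (-1) := by
  rw [rotGen_map]
  ext i; fin_cases i <;>
    simp [matK1, rotGen, extremal, mulVec, dotProduct, Fin.sum_univ_three] <;>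
    ring_nf <;> simp <;> ring

lemma gen_mulVec_zero (ax : Fin 3) : (rotGen ax).map Complex.ofReal *ᵥ ![0, 0, 1] =
    coefP ax • extremal 1 + coefM ax • extremal (-1) := by
  rw [rotGen_map]
  ext i; fin_cases i <;>
    simp [matK1, rotGen, extremal, mulVec, dotProduct, Fin.sum_univ_three]

/-- At `k = 1` this is `u² v² = (uv)²`. In general, the quadratic forms `n0, n1, n2` of the three
columns of `k` satisfy `n0² + n1² + n2² = 0` by orthogonality, and the left side expands to `-n0² -
n1²`. -/
lemma actQ_isotropic (k : K) : actQ k (extremal 1) * actQ k (extremal (-1)) =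
    actQ k ![0, 0, 1] ^ 2 := by
  have o' : ∀ i j, ∑ l, Polynomial.C ((k.1 i l : ℝ) : ℂ) * Polynomial.C ((k.1 j l : ℝ) : ℂ) =
      (if i = j then 1 else 0 : ℂ[X]) := by
    intro i j
    have := congrArg (fun x : ℝ => Polynomial.C (x : ℂ))
      (congrFun (congrFun (K_mul_transpose k) i) j)
    simp only [Matrix.mul_apply, Matrix.transpose_apply, Matrix.one_apply] at this
    rw [Complex.ofReal_sum, map_sum] at this
    simp only [Complex.ofReal_mul, Polynomial.C_mul] at this
    rw [this]
    split_ifs <;> simp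
  have e00 := o' 0 0
  have e01 := o' 0 1
  have e02 := o' 0 2
  have e11 := o' 1 1
  have e12 := o' 1 2
  have e22 := o' 2 2
  have hI : Polynomial.C Complex.I * Polynomial.C Complex.I = (-1 : ℂ[X]) := by
    rw [← Polynomial.C_mul, Complex.I_mul_I]; simp
  have h2 : Polynomial.C (1 / 2 : ℂ) * 2 = (1 : ℂ[X]) := by
    rw [show (2 : ℂ[X]) = Polynomial.C 2 from rfl, ← Polynomial.C_mul]; norm_num
  have hexp : ∀ w : Fin 3 → ℂ, actQ k w = ∑ j, Polynomial.C (w j) *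
      (Polynomial.C ((k.1 0 j : ℝ) : ℂ) * (Polynomial.C (1 / 2) * (1 - Polynomial.X ^ 2)) +
        Polynomial.C ((k.1 1 j : ℝ) : ℂ) *
          (Polynomial.C Complex.I * Polynomial.C (1 / 2) * (1 + Polynomial.X ^ 2)) +
        Polynomial.C ((k.1 2 j : ℝ) : ℂ) * Polynomial.X) := by
    intro w
    simp only [actQ, quadForm, mulVec, dotProduct, Fin.sum_univ_three, Matrix.map_apply,
      div_eq_mul_inv, Polynomial.C_mul, Polynomial.C_add, one_mul]
    ring
  rw [hexp, hexp, hexp]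
  simp only [Fin.sum_univ_three, extremal, if_pos (show (0 : ℤ) ≤ 1 by norm_num),
    if_neg (show ¬ (0 : ℤ) ≤ -1 by norm_num), Matrix.cons_val_zero, Matrix.cons_val_one,
    Matrix.cons_val, Polynomial.C_neg, Polynomial.C_1, Polynomial.C_0] at *
  generalize Polynomial.C (1 / 2 : ℂ) = h at *
  generalize Polynomial.C Complex.I = J at *
  generalize Polynomial.C ((k.1 0 0 : ℝ) : ℂ) = a00 at *
  generalize Polynomial.C ((k.1 0 1 : ℝ) : ℂ) = a01 at *
  generalize Polynomial.C ((k.1 0 2 : ℝ) : ℂ) = a02 at *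
  generalize Polynomial.C ((k.1 1 0 : ℝ) : ℂ) = a10 at *
  generalize Polynomial.C ((k.1 1 1 : ℝ) : ℂ) = a11 at *
  generalize Polynomial.C ((k.1 1 2 : ℝ) : ℂ) = a12 at *
  generalize Polynomial.C ((k.1 2 0 : ℝ) : ℂ) = a20 at *
  generalize Polynomial.C ((k.1 2 1 : ℝ) : ℂ) = a21 at *
  generalize Polynomial.C ((k.1 2 2 : ℝ) : ℂ) = a22 at *
  generalize (Polynomial.X : ℂ[X]) = X at *
  have key : ∀ u v w : ℂ[X], (a00 * u + a10 * v + a20 * w) ^ 2 + (a01 * u + a11 * v + a21 * w) ^ 2 +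
      (a02 * u + a12 * v + a22 * w) ^ 2 = u ^ 2 + v ^ 2 + w ^ 2 := by
    intro u v w
    simp only [if_true, if_neg (show (0 : Fin 3) ≠ 1 by decide), 
      if_neg (show (0 : Fin 3) ≠ 2 by decide), if_neg (show (1 : Fin 3) ≠ 2 by decide)] at *
    linear_combination u ^ 2 * e00 + v ^ 2 * e11 + w ^ 2 * e22 + 2 * u * v * e01 +
      2 * u * w * e02 + 2 * v * w * e12
  have k1 := key (h * (1 - X ^ 2)) (J * h * (1 + X ^ 2)) X
  -- The quadratic forms of the standard basis vectors form a null vector; orthogonality of `k`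
  -- transports this to its columns.
  have k2 : (h * (1 - X ^ 2)) ^ 2 + (J * h * (1 + X ^ 2)) ^ 2 + X ^ 2 = 0 := by
    linear_combination h ^ 2 * (1 + X ^ 2) ^ 2 * hI - X ^ 2 * (2 * h + 1) * h2
  rw [k2] at k1
  generalize a00 * (h * (1 - X ^ 2)) + a10 * (J * h * (1 + X ^ 2)) + a20 * X = n0 at *
  generalize a01 * (h * (1 - X ^ 2)) + a11 * (J * h * (1 + X ^ 2)) + a21 * X = n1 at *
  generalize a02 * (h * (1 - X ^ 2)) + a12 * (J * h * (1 + X ^ 2)) + a22 * X = n2 at *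
  linear_combination n1 ^ 2 * hI - k1

/-- The `(m', m)` entry before normalization, as the `m'`-th coefficient of a polynomial. -/
def wignerPoly (d : ℕ) (m : ℤ) (k : Matrix (Fin 3) (Fin 3) ℝ) : ℂ[X] :=
  actQ k (extremal m) ^ m.natAbs * actQ k ![0, 0, 1] ^ (d - m.natAbs)

lemma extremal_of_nonneg {m : ℤ} (h : 0 ≤ m) : extremal m = extremal 1 := by simp [extremal, h]

lemma extremal_of_neg {m : ℤ} (h : m < 0) : extremal m = extremal (-1) := by
  simp [extremal, not_le.mpr h]

lemma polyDeriv_pow_mul_pow {A B : ℝ → ℂ[X]} {A' B' : ℂ[X]} {t : ℝ} (hA : PolyDeriv A A' t)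
    (hB : PolyDeriv B B' t) (n p : ℕ) :
    PolyDeriv (fun s => A s ^ n * B s ^ p)
      (n * A t ^ (n - 1) * A' * B t ^ p + A t ^ n * (p * B t ^ (p - 1) * B')) t :=
  (hA.pow n).mul (hB.pow p)

/-- Leibniz' rule on a power of `u²` or `v²` times a power of `uv`. Differentiating `uv` produces
products of `u²` and `v²`, which isotropy turns back into `(uv)²`. The sign of `m` decides which
extremal form occurs, hence three cases. -/
lemma polyDeriv_wignerPoly {γ : ℝ → Matrix (Fin 3) (Fin 3) ℝ} {k : K} (ax : Fin 3)
    (h : CurveDeriv γ (k * rotGen ax) 0) (h0 : γ 0 = k) (d : ℕ) (m : ℤ) (hm : |m| ≤ d) :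
    PolyDeriv (fun s => wignerPoly d m (γ s))
      (Polynomial.C (coefP ax * (d - m)) * wignerPoly d (m + 1) k +
        Polynomial.C (coefM ax * (d + m)) * wignerPoly d (m - 1) k +
        Polynomial.C (-Complex.I * coefZ ax * m) * wignerPoly d m k) 0 := by
  have hA := polyDeriv_actQ h (extremal 1)
  have hB := polyDeriv_actQ h ![0, 0, 1]
  have hC := polyDeriv_actQ h (extremal (-1))
  rw [gen_mulVec_plus, actQ_add, actQ_smul, actQ_smul] at hA
  rw [gen_mulVec_zero, actQ_add, actQ_smul, actQ_smul] at hB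
  rw [gen_mulVec_minus, actQ_add, actQ_smul, actQ_smul] at hC
  have hiso := actQ_isotropic k
  rcases lt_trichotomy m 0 with hm0 | rfl | hm0
  · obtain ⟨n, rfl⟩ : ∃ n : ℕ, m = -((n : ℤ) + 1) := ⟨(-m - 1).toNat, by omega⟩
    obtain ⟨p, rfl⟩ : ∃ p : ℕ, d = n + 1 + p := ⟨d - (n + 1), by
      rw [abs_of_neg hm0] at hm; omega⟩
    have := polyDeriv_pow_mul_pow hC hB (n + 1) p
    rw [h0] at this
    have e1 : (-((n : ℤ) + 1)).natAbs = n + 1 := by omega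
    have e2 : (-((n : ℤ) + 1) + 1).natAbs = n := by omega
    have e3 : (-((n : ℤ) + 1) - 1).natAbs = n + 2 := by omega
    have e4 : n + 1 + p - n = p + 1 := by omega
    have e5 : n + 1 + p - (n + 2) = p - 1 := by omega
    -- At `n = 0` the index `m + 1` is `0` and the extremal form switches, but its exponent is then
    -- zero.
    have e6 : actQ k (extremal (-((n : ℤ) + 1) + 1)) ^ n = actQ k (extremal (-1)) ^ n := by
      rcases n with _ | n
      · simp
      · rw [extremal_of_neg]; push_cast; omega
    simp only [wignerPoly, e1, e2, e3, e4, e5, e6, extremal_of_neg hm0,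
      extremal_of_neg (show -((n : ℤ) + 1) - 1 < 0 by omega), Nat.add_sub_cancel_left]
    convert this using 1
    generalize actQ k (extremal 1) = A at *
    generalize actQ k (extremal (-1)) = C at *
    generalize actQ k ![0, 0, 1] = B at *
    simp only [Polynomial.C_mul, Polynomial.C_add, Polynomial.C_sub, Polynomial.C_neg,
      Nat.add_sub_cancel]
    push_cast
    simp only [Polynomial.C_add, Polynomial.C_neg, map_natCast, map_one, map_ofNat]
    rcases p with _ | p
    · simp only [Nat.cast_zero, pow_zero]
      ring
    · simp only [Nat.add_sub_cancel]
      push_cast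
      linear_combination (-(Polynomial.C (coefP ax)) * (p + 1) * C ^ n * B ^ p) * hiso
  · have := polyDeriv_pow_mul_pow hC hB 0 d
    rw [h0] at this
    simp only [pow_zero, one_mul, Nat.cast_zero, zero_mul, zero_add] at this
    simp only [wignerPoly, Int.natAbs_zero, pow_zero, one_mul, Nat.sub_zero]
    convert this using 1
    rcases d with _ | d
    · simp
    · simp only [Nat.add_sub_cancel, zero_add, zero_sub, Int.natAbs_neg, Int.natAbs_one, pow_one,
        Polynomial.C_mul, Polynomial.C_add, Polynomial.C_sub, Int.cast_zero, Polynomial.C_0]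
      push_cast
      simp only [Polynomial.C_add, map_natCast, map_one]
      ring
  · obtain ⟨n, rfl⟩ : ∃ n : ℕ, m = (n : ℤ) + 1 := ⟨(m - 1).toNat, by omega⟩
    obtain ⟨p, rfl⟩ : ∃ p : ℕ, d = n + 1 + p := ⟨d - (n + 1), by
      rw [abs_of_pos hm0] at hm; omega⟩
    have := polyDeriv_pow_mul_pow hA hB (n + 1) p
    rw [h0] at this
    have e1 : ((n : ℤ) + 1).natAbs = n + 1 := by omega
    have e2 : ((n : ℤ) + 1 - 1).natAbs = n := by omega
    have e3 : ((n : ℤ) + 1 + 1).natAbs = n + 2 := by omega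
    have e4 : n + 1 + p - n = p + 1 := by omega
    have e5 : n + 1 + p - (n + 2) = p - 1 := by omega
    simp only [wignerPoly, e1, e2, e3, e4, e5, extremal_of_nonneg hm0.le,
      extremal_of_nonneg (show 0 ≤ (n : ℤ) + 1 - 1 by omega),
      extremal_of_nonneg (show 0 ≤ (n : ℤ) + 1 + 1 by omega), Nat.add_sub_cancel_left]
    convert this using 1
    generalize actQ k (extremal 1) = A at *
    generalize actQ k (extremal (-1)) = C at *
    generalize actQ k ![0, 0, 1] = B at *
    simp only [Polynomial.C_mul, Polynomial.C_add, Polynomial.C_sub, Polynomial.C_neg,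
      Nat.add_sub_cancel]
    push_cast
    simp only [Polynomial.C_add, Polynomial.C_neg, map_natCast, map_one, map_ofNat]
    rcases p with _ | p
    · simp only [Nat.cast_zero, pow_zero]
      ring
    · simp only [Nat.add_sub_cancel]
      push_cast
      linear_combination (-(Polynomial.C (coefM ax)) * (p + 1) * A ^ n * B ^ p) * hiso

/-! ### Normalization of the weight basis by factorials. -/

/-- `(d + m)! (d - m)!`. -/
def wt (d : ℕ) (m : ℤ) : ℝ := ((d + m).toNat ! : ℝ) * ((d - m).toNat ! : ℝ)

lemma wt_pos (d : ℕ) (m : ℤ) : 0 < wt d m := by unfold wt; positivity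

lemma wt_succ {d : ℕ} {m : ℤ} (h1 : -(d : ℤ) ≤ m) (h2 : m < d) :
    wt d (m + 1) * (d - m) = wt d m * (d + m + 1) := by
  obtain ⟨p, hp⟩ : ∃ p : ℕ, (d : ℤ) + m = p := ⟨((d : ℤ) + m).toNat, by omega⟩
  obtain ⟨q, hq⟩ : ∃ q : ℕ, (d : ℤ) - m = q + 1 := ⟨((d : ℤ) - m - 1).toNat, by omega⟩
  have e1 : ((d : ℤ) + (m + 1)).toNat = p + 1 := by omega
  have e2 : ((d : ℤ) - (m + 1)).toNat = q := by omega
  have e3 : ((d : ℤ) + m).toNat = p := by omega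
  have e4 : ((d : ℤ) - m).toNat = q + 1 := by omega
  have hp' : (d : ℝ) + m = p := by exact_mod_cast hp
  have hq' : (d : ℝ) - m = q + 1 := by exact_mod_cast hq
  rw [wt, wt, e1, e2, e3, e4, hp', hq', Nat.factorial_succ, Nat.factorial_succ]
  push_cast; ring

lemma cp_eq (d : ℕ) (m : ℤ) : cp d m = (√(((d : ℝ) - m) * (d + m + 1)) : ℝ) := by
  rw [cp]; congr 2; ring

lemma cm_succ (d : ℕ) (m : ℤ) : cm d (m + 1) = cp d m := by
  rw [cm, cp]; congr 2; push_cast; ring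

lemma cp_pred (d : ℕ) (m : ℤ) : cp d (m - 1) = cm d m := by
  rw [← cm_succ, sub_add_cancel]

lemma cp_neg (d : ℕ) (m : ℤ) : cp d (-m) = cm d m := by
  rw [cm, cp]; congr 2; push_cast; ring

lemma cp_self (d : ℕ) : cp d d = 0 := by rw [cp_eq]; simp

lemma cp_neg_self (d : ℕ) : cp d (-d - 1) = 0 := by
  rw [cp_eq]; push_cast; ring_nf; simp

/-- The normalization of the basis converts the unsymmetric factor `d - m` left by polynomial
differentiation into the symmetric ladder coefficient. -/
lemma sqrt_wt_succ {d : ℕ} {m : ℤ} (h1 : -(d : ℤ) ≤ m) (h2 : m < d) {A : ℝ} (hA : 0 ≤ A) :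
    √(A / wt d m) * (d - m) = √(((d : ℝ) - m) * (d + m + 1)) * √(A / wt d (m + 1)) := by
  have h1' : (0 : ℝ) < d + m + 1 := by
    have : (-(d : ℝ)) ≤ m := by exact_mod_cast h1
    linarith
  have h2' : (0 : ℝ) < d - m := by
    have : (m : ℝ) < d := by exact_mod_cast h2
    linarith
  have hw := wt_succ h1 h2
  have p1 := wt_pos d m
  have p2 := wt_pos d (m + 1)
  rw [← Real.sqrt_mul (by positivity)]
  conv_lhs => rw [← Real.sqrt_sq h2'.le, ← Real.sqrt_mul (by positivity)]
  congr 1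
  rw [div_mul_eq_mul_div, mul_div_assoc', div_eq_div_iff p1.ne' p2.ne']
  linear_combination A * ((d : ℝ) - m) * hw

lemma sqrt_wt_pred {d : ℕ} {m : ℤ} (h1 : -(d : ℤ) < m) (h2 : m ≤ d) {A : ℝ} (hA : 0 ≤ A) :
    √(A / wt d m) * (d + m) =
      √(((d : ℝ) - (m - 1 : ℤ)) * (d + (m - 1 : ℤ) + 1)) * √(A / wt d (m - 1)) := by
  have h1' : (0 : ℝ) < d + m := by
    have : (-(d : ℝ)) < m := by exact_mod_cast h1
    linarith
  have h2' : (0 : ℝ) < d - m + 1 := by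
    have : (m : ℝ) ≤ d := by exact_mod_cast h2
    linarith
  have hw := wt_succ (d := d) (m := m - 1) (by omega) (by omega)
  rw [sub_add_cancel] at hw
  have p1 := wt_pos d m
  have p2 := wt_pos d (m - 1)
  push_cast at hw ⊢
  rw [show ((d : ℝ) - (m - 1)) * (d + (m - 1) + 1) = (d - m + 1) * (d + m) by ring,
    ← Real.sqrt_mul (by positivity)]
  conv_lhs => rw [← Real.sqrt_sq h1'.le, ← Real.sqrt_mul (by positivity)]
  congr 1
  rw [div_mul_eq_mul_div, mul_div_assoc', div_eq_div_iff p1.ne' p2.ne']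
  linear_combination (-A) * ((d : ℝ) + m) * hw

lemma wignerD_of_mem {d : ℕ} {m' m : ℤ} (h1 : |m'| ≤ d) (h2 : |m| ≤ d)
    (k : Matrix (Fin 3) (Fin 3) ℝ) :
    wignerD d m' m k = (√(wt d m' / wt d m) : ℝ) * (wignerPoly d m k).coeff (d + m').toNat :=
  if_pos ⟨h1, h2⟩

lemma wignerD_of_lt_right {d : ℕ} {m' m : ℤ} (h : (d : ℤ) < |m|) (k : Matrix (Fin 3) (Fin 3) ℝ) :
    wignerD d m' m k = 0 := if_neg fun h' => absurd h'.2 (not_le.mpr h)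

lemma wignerD_of_lt_left {d : ℕ} {m' m : ℤ} (h : (d : ℤ) < |m'|) (k : Matrix (Fin 3) (Fin 3) ℝ) :
    wignerD d m' m k = 0 := if_neg fun h' => absurd h'.1 (not_le.mpr h)

/-- The action of the infinitesimal rotation `rotGen ax` on the columns of `D^d`. -/
def colDer (ax : Fin 3) (d : ℕ) (v : ℤ → ℂ) (m : ℤ) : ℂ :=
  coefP ax * cp d m * v (m + 1) + coefM ax * cm d m * v (m - 1) -
    Complex.I * coefZ ax * m * v m

lemma hasDerivAt_wignerD {γ : ℝ → Matrix (Fin 3) (Fin 3) ℝ} {k : K} (ax : Fin 3)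
    (h : CurveDeriv γ (k * rotGen ax) 0) (h0 : γ 0 = k) (d : ℕ) (m' m : ℤ) :
    HasDerivAt (fun t => wignerD d m' m (γ t))
      (colDer ax d (fun n => wignerD d m' n k) m) 0 := by
  by_cases h1 : |m'| ≤ d
  swap
  · simp only [wignerD_of_lt_left (not_le.mp h1), colDer, mul_zero, add_zero, sub_zero]
    exact hasDerivAt_const _ _
  by_cases h2 : |m| ≤ d
  swap
  · have h2' := not_le.mp h2
    simp only [wignerD_of_lt_right h2', colDer, mul_zero, sub_zero]
    -- A column just outside the range has a neighbour inside it; the ladder coefficient joining the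
    -- two is zero.
    have e1 : cp d m * wignerD d m' (m + 1) k = 0 := by
      by_cases h3 : |m + 1| ≤ d
      · rw [show m = -d - 1 by rw [abs_le] at h3; rw [lt_abs] at h2'; omega, cp_neg_self, zero_mul]
      · rw [wignerD_of_lt_right (not_le.mp h3), mul_zero]
    have e2 : cm d m * wignerD d m' (m - 1) k = 0 := by
      by_cases h3 : |m - 1| ≤ d
      · rw [show m = d + 1 by rw [abs_le] at h3; rw [lt_abs] at h2'; omega, cm_succ, cp_self,
          zero_mul]
      · rw [wignerD_of_lt_right (not_le.mp h3), mul_zero]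
    rw [mul_assoc, e1, mul_assoc, e2, mul_zero, mul_zero, add_zero]
    exact hasDerivAt_const _ _
  have hp := polyDeriv_wignerPoly ax h h0 d m h2 (d + m').toNat
  simp only [wignerD_of_mem h1 h2]
  refine (hp.const_mul _).congr_deriv ?_
  have hA := (wt_pos d m').le
  obtain ⟨h3, h4⟩ := abs_le.mp h2
  have e1 : ((√(wt d m' / wt d m) : ℝ) : ℂ) * (d - m) *
      (wignerPoly d (m + 1) k).coeff (d + m').toNat = cp d m * wignerD d m' (m + 1) k := by
    rcases h4.lt_or_eq with h5 | rfl
    · rw [wignerD_of_mem h1 (abs_le.mpr ⟨by omega, by omega⟩), cp_eq, ← mul_assoc]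
      congr 1
      exact_mod_cast sqrt_wt_succ h3 h5 hA
    · rw [cp_self]; simp
  have e2 : ((√(wt d m' / wt d m) : ℝ) : ℂ) * (d + m) *
      (wignerPoly d (m - 1) k).coeff (d + m').toNat = cm d m * wignerD d m' (m - 1) k := by
    rcases h3.lt_or_eq with h5 | rfl
    · rw [wignerD_of_mem h1 (abs_le.mpr ⟨by omega, by omega⟩), ← cp_pred, cp_eq, ← mul_assoc]
      congr 1
      have := sqrt_wt_pred (d := d) (m := m) h5 h4 hA
      push_cast at this ⊢
      exact_mod_cast this
    · rw [← cp_neg, neg_neg, cp_self]; simp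
  simp only [colDer, Polynomial.coeff_add, Polynomial.coeff_C_mul, wignerD_of_mem h1 h2]
  linear_combination coefP ax * e1 + coefM ax * e2

/-! ### Families of functions on `K` transforming like the columns of `D^d` -/

/-- `v` satisfies the differential equations of a row of `D^d`. -/
structure KDer (d : ℕ) (v : ℤ → K → ℂ) : Prop where
  eq_zero : ∀ m k, (d : ℤ) < |m| → v m k = 0
  deriv : ∀ ax m k, HasDerivAt (fun t => v m (k * rot ax t)) (colDer ax d (fun n => v n k) m) 0

lemma curveDeriv_mul_rot (k : K) (ax : Fin 3) :
    CurveDeriv (fun t => ((k * rot ax t : K) : Matrix (Fin 3) (Fin 3) ℝ))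
      ((k : Matrix (Fin 3) (Fin 3) ℝ) * rotGen ax) 0 :=
  (curveDeriv_rot ax).mul_left (k : Matrix (Fin 3) (Fin 3) ℝ)

lemma mul_rot_zero (k : K) (ax : Fin 3) : k * rot ax 0 = k := by rw [rot_zero, mul_one]

lemma kDer_wignerD (d : ℕ) (m' : ℤ) : KDer d fun m k => wignerD d m' m k where
  eq_zero _ _ h := wignerD_of_lt_right h _
  deriv ax m k := hasDerivAt_wignerD ax (curveDeriv_mul_rot k ax)
    (congrArg Subtype.val (mul_rot_zero k ax)) d m' m

/-- At the identity the forms `u²`, `uv`, `v²` dehomogenize to `X²`, `X`, `1`, so the `m`-th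
polynomial is the monomial `X^(d + m)`. -/
lemma wignerD_one (d : ℕ) (m' m : ℤ) :
    wignerD d m' m (1 : K) = if m' = m ∧ |m| ≤ d then 1 else 0 := by
  by_cases h2 : |m| ≤ d
  swap
  · rw [wignerD_of_lt_right (not_le.mp h2), if_neg fun h => h2 h.2]
  by_cases h1 : |m'| ≤ d
  swap
  · rw [wignerD_of_lt_left (not_le.mp h1), if_neg]; rintro ⟨rfl, h⟩; exact h1 h
  rw [wignerD_of_mem h1 h2]
  have hA : ∀ w, actQ (1 : K) w = quadForm w := by
    intro w
    have : (((1 : K) : Matrix (Fin 3) (Fin 3) ℝ)).map Complex.ofReal = 1 := by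
      ext i j; simp [Matrix.one_apply]; split_ifs <;> simp
    rw [actQ, this, one_mulVec]
  have hB : quadForm ![0, 0, 1] = Polynomial.X := by simp [quadForm]
  have hh : (Polynomial.C (1 / 2 : ℂ)) + Polynomial.C (1 / 2) = 1 := by
    rw [← Polynomial.C_add]; norm_num
  have hp : quadForm (extremal 1) = Polynomial.X ^ 2 := by
    simp only [quadForm, extremal, if_pos (show (0 : ℤ) ≤ 1 by norm_num), Matrix.cons_val_zero,
      Matrix.cons_val_one, Matrix.cons_val, mul_neg, Complex.I_mul_I, neg_neg, neg_div,
      Polynomial.C_neg, Polynomial.C_0]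
    linear_combination (Polynomial.X ^ 2) * hh
  have hm : quadForm (extremal (-1)) = 1 := by
    simp only [quadForm, extremal, if_neg (show ¬ (0 : ℤ) ≤ -1 by norm_num), Matrix.cons_val_zero,
      Matrix.cons_val_one, Matrix.cons_val, mul_neg, Complex.I_mul_I, neg_neg,
      Polynomial.C_0]
    linear_combination hh
  have hX : wignerPoly d m (1 : K) = Polynomial.X ^ (d + m).toNat := by
    rw [abs_le] at h2
    rw [wignerPoly, hA, hA, hB]
    rcases le_or_gt 0 m with h | h
    · rw [extremal_of_nonneg h, hp, ← pow_mul, ← pow_add]; congr 1; omega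
    · rw [extremal_of_neg h, hm, one_pow, one_mul]; congr 1; omega
  rw [hX, Polynomial.coeff_X_pow]
  rw [abs_le] at h1 h2
  by_cases h : m' = m
  · subst h
    rw [div_self (wt_pos d m').ne']
    simp [abs_le, h1]
  · rw [if_neg (by omega), if_neg fun h' => h h'.1, mul_zero]

/-! ### Unitarity and multiplicativity of the Wigner matrices. -/

lemma sum_Icc_shift {d : ℕ} {h : ℤ → ℂ} (h1 : h (-d) = 0) (h2 : h (d + 1) = 0) :
    ∑ m ∈ Finset.Icc (-(d : ℤ)) d, h (m + 1) = ∑ m ∈ Finset.Icc (-(d : ℤ)) d, h m := by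
  have e1 : ∑ m ∈ Finset.Icc (-(d : ℤ)) d, h (m + 1) =
      ∑ m ∈ Finset.Icc (-(d : ℤ) + 1) (d + 1), h m := by
    rw [← Finset.map_add_right_Icc, Finset.sum_map]; rfl
  rw [e1, Finset.sum_subset (Finset.Icc_subset_Icc_left (show -(d : ℤ) ≤ -d + 1 by omega)),
    ← Finset.sum_subset (Finset.Icc_subset_Icc_right (show (d : ℤ) ≤ d + 1 by omega))]
  · intro x hx hx'
    rw [Finset.mem_Icc] at hx hx'
    rw [show x = d + 1 by omega, h2]
  · intro x hx hx'
    rw [Finset.mem_Icc] at hx hx'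
    rw [show x = -d by omega, h1]

lemma conj_cp (d : ℕ) (m : ℤ) : starRingEnd ℂ (cp d m) = cp d m := Complex.conj_ofReal _

lemma conj_cm (d : ℕ) (m : ℤ) : starRingEnd ℂ (cm d m) = cm d m := Complex.conj_ofReal _

lemma conj_coefP (ax : Fin 3) : starRingEnd ℂ (coefP ax) = -coefM ax := by
  fin_cases ax <;> simp [coefP, coefM, map_ofNat] <;> norm_num <;> ring

lemma conj_coefM (ax : Fin 3) : starRingEnd ℂ (coefM ax) = -coefP ax := by
  rw [← neg_eq_iff_eq_neg, ← map_neg, ← conj_coefP, Complex.conj_conj]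

lemma conj_coefZ (ax : Fin 3) : starRingEnd ℂ (coefZ ax) = coefZ ax := by
  fin_cases ax <;> simp [coefZ]

lemma conj_colDer (ax : Fin 3) (d : ℕ) (w : ℤ → ℂ) (m : ℤ) :
    starRingEnd ℂ (colDer ax d w m) =
      -(coefM ax * cp d m * starRingEnd ℂ (w (m + 1)) + coefP ax * cm d m * starRingEnd ℂ (w (m - 1)) -
        Complex.I * coefZ ax * m * starRingEnd ℂ (w m)) := by
  simp only [colDer, map_sub, map_add, map_mul, conj_cp, conj_cm, conj_coefP, conj_coefM,
    conj_coefZ, Complex.conj_I, map_intCast]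
  ring

/-- The infinitesimal rotations act by skew-Hermitian matrices. -/
lemma sum_colDer_pairing (ax : Fin 3) {d : ℕ} {v w : ℤ → ℂ} (hv : ∀ m, (d : ℤ) < |m| → v m = 0)
    (hw : ∀ m, (d : ℤ) < |m| → w m = 0) :
    ∑ m ∈ Finset.Icc (-(d : ℤ)) d, (colDer ax d v m * starRingEnd ℂ (w m) +
      v m * starRingEnd ℂ (colDer ax d w m)) = 0 := by
  have v1 : v (d + 1) = 0 := hv _ (by rw [lt_abs]; omega)
  have w1 : w (d + 1) = 0 := hw _ (by rw [lt_abs]; omega)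
  have w2 : w (-d - 1) = 0 := hw _ (by rw [lt_abs]; omega)
  have v2 : v (-d - 1) = 0 := hv _ (by rw [lt_abs]; omega)
  -- Summation by parts: shifting the index by one matches the raising term on one factor with the
  -- lowering term on the other.
  have s1 := sum_Icc_shift (d := d) (h := fun m => cm d m * v m * starRingEnd ℂ (w (m - 1)))
    (by simp [w2]) (by simp [v1])
  have s2 := sum_Icc_shift (d := d) (h := fun m => cm d m * v (m - 1) * starRingEnd ℂ (w m))
    (by simp [v2]) (by simp [w1])
  simp only [cm_succ, add_sub_cancel_right] at s1 s2
  rw [← sub_eq_zero, ← Finset.sum_sub_distrib] at s1 s2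
  have := congrArg₂ (fun x y => coefP ax * x - coefM ax * y) s1 s2
  simp only [Finset.mul_sum, ← Finset.sum_sub_distrib, mul_zero, sub_zero] at this
  rw [← this]
  refine Finset.sum_congr rfl fun m _ => ?_
  rw [conj_colDer, colDer]
  ring

/-- Rotations about a fixed axis form a one-parameter group, so derivatives at time `0` from every
base point give derivatives at every time. -/
lemma hasDerivAt_rot_shift {F : K → ℂ} {F' : K → ℂ} {ax : Fin 3}
    (h : ∀ k, HasDerivAt (fun t => F (k * rot ax t)) (F' k) 0) (k : K) (t : ℝ) :
    HasDerivAt (fun t => F (k * rot ax t)) (F' (k * rot ax t)) t := by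
  have h1 := (h (k * rot ax t))
  rw [← sub_self t] at h1
  have h2 := h1.comp_sub_const t t
  refine h2.congr_of_eventuallyEq (Filter.Eventually.of_forall fun s => ?_)
  simp only []
  rw [mul_assoc, ← rot_add]; congr 3; ring

lemma hasDerivAt_conj {f : ℝ → ℂ} {f' : ℂ} {t : ℝ} (h : HasDerivAt f f' t) :
    HasDerivAt (fun s => starRingEnd ℂ (f s)) (starRingEnd ℂ f') t :=
  h.star

lemma eq_of_deriv_zero {F : K → ℂ}
    (h : ∀ ax k, HasDerivAt (fun t => F (k * rot ax t)) 0 0) (k : K) : F k = F 1 := by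
  refine eq_of_rot_invariant (fun ax k t => ?_) k
  have h1 := is_const_of_deriv_eq_zero (f := fun t => F (k * rot ax t))
    (fun t => (hasDerivAt_rot_shift (h ax) k t).differentiableAt)
    (fun t => (hasDerivAt_rot_shift (h ax) k t).deriv) t 0
  simpa [rot_zero] using h1

/-- The pairing of two families of type `d` is constant on `K`. -/
lemma KDer.pairing {d : ℕ} {v w : ℤ → K → ℂ} (hv : KDer d v) (hw : KDer d w) (k : K) :
    ∑ m ∈ Finset.Icc (-(d : ℤ)) d, v m k * starRingEnd ℂ (w m k) =
      ∑ m ∈ Finset.Icc (-(d : ℤ)) d, v m 1 * starRingEnd ℂ (w m 1) := by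
  refine eq_of_deriv_zero (F := fun k => ∑ m ∈ Finset.Icc (-(d : ℤ)) d,
    v m k * starRingEnd ℂ (w m k)) (fun ax k => ?_) k
  have := HasDerivAt.fun_sum (u := Finset.Icc (-(d : ℤ)) d) fun m _ =>
    (hv.deriv ax m k).mul (hasDerivAt_conj (hw.deriv ax m k))
  refine this.congr_deriv ?_
  simp only [mul_rot_zero]
  exact sum_colDer_pairing ax (fun m h => hv.eq_zero m k h) (fun m h => hw.eq_zero m k h)

/-- Orthonormality of the rows: their pairing is constant on `K`, and at the identity it is a
Kronecker delta. -/
lemma wignerD_mul_conj (d : ℕ) (m n : ℤ) (k : K) :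
    ∑ l ∈ Finset.Icc (-(d : ℤ)) d, wignerD d m l k * starRingEnd ℂ (wignerD d n l k) =
      if m = n ∧ |n| ≤ d then 1 else 0 := by
  rw [(kDer_wignerD d m).pairing (kDer_wignerD d n)]
  simp only [wignerD_one]
  by_cases h : |n| ≤ d
  · rw [Finset.sum_eq_single n]
    · simp [h]
    · intro l _ hl; simp [hl.symm]
    · intro hn; exact absurd (Finset.mem_Icc.mpr (abs_le.mp h)) hn
  · rw [if_neg fun h' => h h'.2]
    refine Finset.sum_eq_zero fun l hl => ?_
    have : n ≠ l := by rintro rfl; exact h (abs_le.mpr (Finset.mem_Icc.mp hl))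
    simp [this]

/-- A family of type `d` at `k` in terms of its value at `1`, in the form of scalar products. -/
lemma KDer.inner_wignerD {d : ℕ} {v : ℤ → K → ℂ} (hv : KDer d v) {n : ℤ} (hn : |n| ≤ d) (k : K) :
    ∑ m ∈ Finset.Icc (-(d : ℤ)) d, v m k * starRingEnd ℂ (wignerD d n m k) = v n 1 := by
  rw [hv.pairing (kDer_wignerD d n)]
  simp only [wignerD_one]
  rw [Finset.sum_eq_single n]
  · simp [hn]
  · intro l _ hl; simp [hl.symm]
  · intro h; exact absurd (Finset.mem_Icc.mpr (abs_le.mp hn)) h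

/-- For a square matrix, orthonormal rows imply orthonormal columns. -/
lemma wignerD_conj_mul (d : ℕ) (m n : ℤ) (k : K) :
    ∑ l ∈ Finset.Icc (-(d : ℤ)) d, starRingEnd ℂ (wignerD d l m k) * wignerD d l n k =
      if m = n ∧ |n| ≤ d then 1 else 0 := by
  by_cases hm : |m| ≤ d
  swap
  · simp only [wignerD_of_lt_right (not_le.mp hm), map_zero, zero_mul, Finset.sum_const_zero]
    rw [if_neg]; rintro ⟨rfl, h⟩; exact hm h
  by_cases hn : |n| ≤ d
  swap
  · simp only [wignerD_of_lt_right (not_le.mp hn), mul_zero, Finset.sum_const_zero]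
    rw [if_neg]; rintro ⟨rfl, h⟩; exact hn h
  let A : Matrix (Idx d) (Idx d) ℂ := Matrix.of fun i j => wignerD d i j k
  have hA : A * Aᴴ = 1 := by
    ext i j
    simp only [Matrix.mul_apply, Matrix.conjTranspose_apply, A, Matrix.of_apply]
    have := wignerD_mul_conj d i j k
    rw [← Finset.sum_coe_sort] at this
    refine this.trans ?_
    simp only [Matrix.one_apply, abs_le.mpr (Finset.mem_Icc.mp j.2), Subtype.ext_iff, and_true]
  have hA' := mul_eq_one_comm.mp hA
  have h := congrFun (congrFun hA' ⟨m, Finset.mem_Icc.mpr (abs_le.mp hm)⟩)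
    ⟨n, Finset.mem_Icc.mpr (abs_le.mp hn)⟩
  simp only [Matrix.mul_apply, Matrix.conjTranspose_apply, A, Matrix.of_apply] at h
  rw [← Finset.sum_coe_sort]
  refine h.trans ?_
  simp [Matrix.one_apply, hn]

/-- A family of type `d` is determined by its value at `1`. -/
lemma KDer.eq_sum {d : ℕ} {v : ℤ → K → ℂ} (hv : KDer d v) (m : ℤ) (k : K) :
    v m k = ∑ n ∈ Finset.Icc (-(d : ℤ)) d, v n 1 * wignerD d n m k := by
  by_cases hm : |m| ≤ d
  swap
  · simp [wignerD_of_lt_right (not_le.mp hm), hv.eq_zero m k (not_le.mp hm)]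
  have h1 : ∀ n ∈ Finset.Icc (-(d : ℤ)) d, v n 1 * wignerD d n m k =
      ∑ l ∈ Finset.Icc (-(d : ℤ)) d, v l k * (starRingEnd ℂ (wignerD d n l k) * wignerD d n m k) := by
    intro n hn
    rw [← hv.inner_wignerD (abs_le.mpr (Finset.mem_Icc.mp hn)) k, Finset.sum_mul]
    exact Finset.sum_congr rfl fun _ _ => mul_assoc _ _ _
  rw [Finset.sum_congr rfl h1, Finset.sum_comm]
  simp only [← Finset.mul_sum, wignerD_conj_mul]
  rw [Finset.sum_eq_single m]
  · simp [hm]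
  · intro l _ hl; simp [hl]
  · intro h; exact absurd (Finset.mem_Icc.mpr (abs_le.mp hm)) h

lemma KDer.comp_mul_left {d : ℕ} {v : ℤ → K → ℂ} (hv : KDer d v) (h : K) :
    KDer d fun m k => v m (h * k) where
  eq_zero m k hm := hv.eq_zero m _ hm
  deriv ax m k := by simpa only [mul_assoc] using hv.deriv ax m (h * k)

/-- A left translate of a row obeys the same derivative rules, and its value at `1` is the row at
`h`; `KDer.eq_sum` is then the matrix product. -/
lemma wignerD_mul (d : ℕ) (m' m : ℤ) (h k : K) : wignerD d m' m (h * k : K) =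
    ∑ n ∈ Finset.Icc (-(d : ℤ)) d, wignerD d m' n h * wignerD d n m k := by
  have := ((kDer_wignerD d m').comp_mul_left h).eq_sum m k
  simpa only [mul_one] using this

lemma wignerD_inv (d : ℕ) (m' m : ℤ) (k : K) :
    wignerD d m' m (k⁻¹ : K) = starRingEnd ℂ (wignerD d m m' k) := by
  by_cases hm : |m| ≤ d
  swap
  · rw [wignerD_of_lt_right (not_le.mp hm), wignerD_of_lt_left (not_le.mp hm), map_zero]
  by_cases hm' : |m'| ≤ d
  swap
  · rw [wignerD_of_lt_right (not_le.mp hm'), wignerD_of_lt_left (not_le.mp hm'), map_zero]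
  have hv := ((kDer_wignerD d m').comp_mul_left k⁻¹).inner_wignerD hm k
  simp only [inv_mul_cancel, mul_one, wignerD_one] at hv
  rw [← hv, Finset.sum_eq_single m']
  · simp [hm']
  · intro l _ hl; simp [hl.symm]
  · intro h; exact absurd (Finset.mem_Icc.mpr (abs_le.mp hm')) h

/-! ### Continuity of the matrix entries. -/

lemma continuous_coeff_mul {α : Type*} [TopologicalSpace α] {p q : α → ℂ[X]}
    (hp : ∀ n, Continuous fun x => (p x).coeff n) (hq : ∀ n, Continuous fun x => (q x).coeff n)
    (n : ℕ) : Continuous fun x => (p x * q x).coeff n := by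
  simp only [Polynomial.coeff_mul]
  exact continuous_finsetSum _ fun i _ => (hp i.1).mul (hq i.2)

lemma continuous_coeff_pow {α : Type*} [TopologicalSpace α] {p : α → ℂ[X]}
    (hp : ∀ n, Continuous fun x => (p x).coeff n) (r : ℕ) :
    ∀ n, Continuous fun x => (p x ^ r).coeff n := by
  induction r with
  | zero => intro n; simpa using continuous_const
  | succ r ih => intro n; simp only [pow_succ]; exact continuous_coeff_mul ih hp n

lemma continuous_coeff_actQ (w : Fin 3 → ℂ) (n : ℕ) :
    Continuous fun k : K => (actQ k w).coeff n := by
  have h : ∀ i j, Continuous fun k : K => (k : Matrix (Fin 3) (Fin 3) ℝ) i j := fun i j =>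
    (continuous_subtype_val.matrix_elem i j)
  simp only [actQ, quadForm, Polynomial.coeff_add, Polynomial.coeff_C_mul, mulVec, dotProduct,
    Matrix.map_apply]
  have h' : ∀ i j, Continuous fun k : K => (((k : Matrix (Fin 3) (Fin 3) ℝ) i j : ℝ) : ℂ) :=
    fun i j => Complex.continuous_ofReal.comp (h i j)
  fun_prop

lemma continuous_wignerD (d : ℕ) (m' m : ℤ) : Continuous fun k : K => wignerD d m' m k := by
  by_cases h : |m'| ≤ d ∧ |m| ≤ d
  · simp only [wignerD_of_mem h.1 h.2]
    exact continuous_const.mul (continuous_coeff_mul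
      (continuous_coeff_pow (continuous_coeff_actQ _) _)
      (continuous_coeff_pow (continuous_coeff_actQ _) _) _)
  · simp only [wignerD, if_neg h]; exact continuous_const

/-! ### Clebsch-Gordan coefficients with one spin equal to `2` -/

/-- The falling factorial `x (x - 1) ⋯ (x - n + 1)`. -/
def fallFac (x : ℝ) (n : ℕ) : ℝ := ∏ j ∈ Finset.range n, (x - j)

lemma fallFac_natCast (p n : ℕ) : fallFac p n = (p.descFactorial n : ℝ) := by
  induction n with
  | zero => simp [fallFac]
  | succ n ih =>
    rw [fallFac, Finset.prod_range_succ, ← fallFac, ih, Nat.descFactorial_succ]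
    rcases le_or_gt n p with h | h
    · push_cast [Nat.cast_sub h]; ring
    · rw [Nat.descFactorial_of_lt h]; simp

lemma factorial_eq_fallFac {p n : ℕ} (h : n ≤ p) : (p ! : ℝ) = (p - n)! * fallFac p n := by
  rw [fallFac_natCast]; exact_mod_cast (Nat.factorial_mul_descFactorial h).symm

lemma fallFac_eq_zero {p n : ℕ} (h : p < n) : fallFac p n = 0 := by
  rw [fallFac_natCast, Nat.descFactorial_of_lt h, Nat.cast_zero]

/-- The polynomial part of the Clebsch-Gordan coefficient `⟨2 i d m | (d+a) (i+m)⟩`, in the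
variables `x = d + m`, `y = d - m`. -/
def cgPoly (a i : ℤ) (x y : ℝ) : ℝ :=
  ∑ t ∈ Finset.range (3 - a).toNat,
    if (t : ℤ) ≤ 2 - i ∧ 0 ≤ a + i + t then
      (-1 : ℝ) ^ t / ((t ! : ℝ) * (2 - a - t).toNat ! * (2 - i - t).toNat ! * (a + i + t).toNat !) *
        (fallFac x t * fallFac y (2 - a - t).toNat)
    else 0

/-- The factor of the Clebsch-Gordan coefficients that only depends on the spins. -/
def cgConst (d : ℕ) (J : ℤ) : ℝ :=
  √((2 * J + 1 : ℝ) * (J + 2 - d).toNat ! * (J - 2 + d).toNat ! * (2 + d - J).toNat ! /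
        (2 + d + J + 1).toNat !)

lemma cg_eq_zero {d e : ℕ} {a m i : ℤ} (he : (e : ℤ) = d + a)
    (h : ¬ (|i| ≤ 2 ∧ |m| ≤ d ∧ |i + m| ≤ e ∧ |2 - (d : ℤ)| ≤ e ∧ (e : ℤ) ≤ 2 + d)) :
    cg d 2 a m i = 0 := by
  rw [cg, clebschGordan, if_neg]
  rintro ⟨-, h1, h2, h3, h4, h5⟩
  exact h ⟨h1, h2, by rwa [he], by rw [he]; exact_mod_cast h4, by rw [he]; exact_mod_cast h5⟩

/-- In Racah's sum the factor `(d + m)! (d - m)!` is pulled out of the square roots, and dividing it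
by the factorials in the denominators leaves falling factorials. These are polynomials in `d + m`
and `d - m` that vanish exactly where Racah's range conditions on `d ± m` fail. -/
lemma cg_eq {d e : ℕ} {a m i : ℤ} (he : (e : ℤ) = d + a) (ha : |a| ≤ 2) (hi : |i| ≤ 2)
    (hm : |m| ≤ d) (hM : |i + m| ≤ e) (ht : |2 - (d : ℤ)| ≤ e) :
    cg d 2 a m i = cgConst d e * (√(wt 2 i) * √(wt e (i + m)) / √(wt d m)) *
      cgPoly a i (d + m) (d - m) := by
  obtain ⟨ha1, ha2⟩ := abs_le.mp ha
  obtain ⟨hi1, hi2⟩ := abs_le.mp hi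
  obtain ⟨hm1, hm2⟩ := abs_le.mp hm
  obtain ⟨p, hp⟩ : ∃ p : ℕ, (d : ℤ) + m = p := ⟨((d : ℤ) + m).toNat, by omega⟩
  obtain ⟨q, hq⟩ : ∃ q : ℕ, (d : ℤ) - m = q := ⟨((d : ℤ) - m).toNat, by omega⟩
  have hp' : (d : ℝ) + m = p := by exact_mod_cast hp
  have hq' : (d : ℝ) - m = q := by exact_mod_cast hq
  rw [cg, clebschGordan, if_pos ⟨rfl, by exact_mod_cast hi, hm, by rwa [← he],
    by rw [← he]; exact_mod_cast ht, by push_cast; omega⟩, ← he, hp', hq']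
  have e1 : √(((((e : ℤ) + (i + m)).toNat ! : ℝ)) * ((e : ℤ) - (i + m)).toNat ! *
      (((2 : ℕ) : ℤ) - i).toNat ! * (((2 : ℕ) : ℤ) + i).toNat ! *
        ((d : ℤ) - m).toNat ! * ((d : ℤ) + m).toNat !) =
      √(wt 2 i) * √(wt e (i + m)) / √(wt d m) * wt d m := by
    have hpos := (wt_pos d m)
    rw [div_mul_eq_mul_div, mul_div_assoc, Real.div_sqrt,
      ← Real.sqrt_mul (wt_pos 2 i).le, ← Real.sqrt_mul (by have := wt_pos 2 i; have := wt_pos e (i + m); positivity)]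
    congr 1
    simp only [wt]
    push_cast
    ring
  rw [e1]
  have e2 : cgConst d e = √((2 * ((e : ℤ) : ℝ) + 1) * ((e : ℤ) + ((2 : ℕ) : ℤ) - d).toNat ! *
      ((e : ℤ) - ((2 : ℕ) : ℤ) + d).toNat ! * (((2 : ℕ) : ℤ) + d - e).toNat ! /
        (((2 : ℕ) : ℤ) + d + e + 1).toNat !) := rfl
  rw [← e2, ← mul_assoc (cgConst d e), mul_assoc _ (wt d m)]
  congr 1
  rw [cgPoly, Finset.mul_sum]
  have hr : (((2 : ℕ) : ℤ) + d - e + 1).toNat = (3 - a).toNat := by congr 1; push_cast; omega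
  rw [hr]
  refine Finset.sum_congr rfl fun t ht' => ?_
  have hta : (t : ℤ) < 3 - a := by have := Finset.mem_range.mp ht'; omega
  have hwt : wt d m = (p ! : ℝ) * q ! := by rw [wt, hp, hq]; simp
  obtain ⟨r, hr⟩ : ∃ r : ℕ, 2 - a - t = r := ⟨(2 - a - t).toNat, by omega⟩
  by_cases h1 : (t : ℤ) ≤ 2 - i ∧ 0 ≤ a + i + t
  swap
  · rw [if_neg h1, if_neg, mul_zero]
    rintro ⟨h2, -, h3, -⟩
    exact h1 ⟨by push_cast at h2; omega, by omega⟩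
  rw [if_pos h1]
  have hrn : (2 - a - (t : ℤ)).toNat = r := by omega
  by_cases h2 : t ≤ p ∧ r ≤ q
  · rw [if_pos ⟨by push_cast; omega, by omega, by omega, by push_cast; omega⟩, hwt,
      factorial_eq_fallFac h2.1, factorial_eq_fallFac h2.2, hrn,
      show (((2 : ℕ) : ℤ) + d - e - t).toNat = r by push_cast; omega,
      show (((2 : ℕ) : ℤ) - i - t).toNat = (2 - i - t).toNat by push_cast; rfl,
      show ((d : ℤ) + m - t).toNat = p - t by omega,
      show ((e : ℤ) - d + i + t).toNat = (a + i + t).toNat by congr 1; omega,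
      show ((e : ℤ) - ((2 : ℕ) : ℤ) - m + t).toNat = q - r by push_cast; omega]
    have := Nat.factorial_pos
    field_simp
  · have hz : fallFac p t * fallFac q r = 0 := by
      rcases not_and_or.mp h2 with h | h
      · rw [fallFac_eq_zero (not_le.mp h), zero_mul]
      · rw [fallFac_eq_zero (not_le.mp h), mul_zero]
    rw [hrn, hz, mul_zero, if_neg, mul_zero]
    rintro ⟨-, h3, -, h4⟩
    exact h2 ⟨by omega, by push_cast at h4; omega⟩

/-! Recursions for the polynomials `cgPoly`. -/

lemma fallFac_zero (x : ℝ) : fallFac x 0 = 1 := rfl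

lemma fallFac_succ (x : ℝ) (n : ℕ) : fallFac x (n + 1) = fallFac x n * (x - n) :=
  Finset.prod_range_succ _ _

/-- The coefficients of `cgPoly`. -/
def cgWeight (a i t : ℤ) : ℝ :=
  if t ≤ 2 - i ∧ 0 ≤ a + i + t then
    (-1 : ℝ) ^ t.toNat / ((t.toNat ! : ℝ) * (2 - a - t).toNat ! * (2 - i - t).toNat ! *
      (a + i + t).toNat !)
  else 0

lemma cgPoly_eq_sum (a i : ℤ) (x y : ℝ) : cgPoly a i x y =
    ∑ t ∈ Finset.range (3 - a).toNat,
      cgWeight a i t * (fallFac x t * fallFac y (2 - a - t).toNat) := by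
  refine Finset.sum_congr rfl fun t _ => ?_
  simp only [cgWeight, Int.toNat_natCast]
  split_ifs <;> simp

lemma toNat_two : Int.toNat 2 = 2 := rfl

lemma toNat_three : Int.toNat 3 = 3 := rfl

lemma toNat_four : Int.toNat 4 = 4 := rfl

lemma cgPoly_neg_two (i : ℤ) (x y : ℝ) : cgPoly (-2) i x y =
    cgWeight (-2) i 0 * (y * (y - 1) * (y - 2) * (y - 3)) +
    cgWeight (-2) i 1 * (x * (y * (y - 1) * (y - 2))) +
    cgWeight (-2) i 2 * (x * (x - 1) * (y * (y - 1))) +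
    cgWeight (-2) i 3 * (x * (x - 1) * (x - 2) * y) +
    cgWeight (-2) i 4 * (x * (x - 1) * (x - 2) * (x - 3)) := by
  rw [cgPoly_eq_sum, show (3 - (-2 : ℤ)).toNat = 5 from rfl]
  simp [Finset.sum_range_succ, fallFac_succ, fallFac_zero]

lemma cgPoly_neg_one (i : ℤ) (x y : ℝ) : cgPoly (-1) i x y =
    cgWeight (-1) i 0 * (y * (y - 1) * (y - 2)) +
    cgWeight (-1) i 1 * (x * (y * (y - 1))) +
    cgWeight (-1) i 2 * (x * (x - 1) * y) +
    cgWeight (-1) i 3 * (x * (x - 1) * (x - 2)) := by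
  rw [cgPoly_eq_sum, show (3 - (-1 : ℤ)).toNat = 4 from rfl]
  simp [Finset.sum_range_succ, fallFac_succ, fallFac_zero]

lemma cgPoly_zero (i : ℤ) (x y : ℝ) : cgPoly 0 i x y =
    cgWeight 0 i 0 * (y * (y - 1)) + cgWeight 0 i 1 * (x * y) +
    cgWeight 0 i 2 * (x * (x - 1)) := by
  rw [cgPoly_eq_sum, show (3 - (0 : ℤ)).toNat = 3 from rfl]
  simp [Finset.sum_range_succ, fallFac_succ, fallFac_zero]

lemma cgPoly_one (i : ℤ) (x y : ℝ) : cgPoly 1 i x y =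
    cgWeight 1 i 0 * y + cgWeight 1 i 1 * x := by
  rw [cgPoly_eq_sum, show (3 - (1 : ℤ)).toNat = 2 from rfl]
  simp [Finset.sum_range_succ, fallFac_succ, fallFac_zero]

lemma cgPoly_two (i : ℤ) (x y : ℝ) : cgPoly 2 i x y = cgWeight 2 i 0 := by
  rw [cgPoly_eq_sum, show (3 - (2 : ℤ)).toNat = 1 from rfl]
  simp [fallFac_zero]

/-- The recursion satisfied by the coefficients of `cgPoly`. -/
lemma cgWeight_raise {a i : ℤ} (ha : |a| ≤ 2) (hi : |i| ≤ 2) (t : ℤ) (ht : 0 ≤ t) (ht' : t ≤ 2 - a) :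
    (a + i + t) * cgWeight a i t - (3 - a - t) * (if t = 0 then 0 else cgWeight a i (t - 1)) =
      (3 - i) * cgWeight a (i - 1) t := by
  obtain ⟨ha1, ha2⟩ := abs_le.mp ha
  obtain ⟨hi1, hi2⟩ := abs_le.mp hi
  interval_cases a <;> interval_cases t <;> interval_cases i <;>
    norm_num [cgWeight, Nat.factorial, toNat_two, toNat_three, toNat_four]

/-- The raising recursion freed of square roots. For each `a` it is a comparison of coefficients of
products of falling factorials, and the comparison is `cgWeight_raise`. -/
lemma cgPoly_raise {a i : ℤ} (ha : |a| ≤ 2) (hi : |i| ≤ 2) (x y : ℝ) :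
    (x + a + i) * cgPoly a i x y =
      (3 - i) * cgPoly a (i - 1) x y + x * cgPoly a i (x - 1) (y + 1) := by
  obtain ⟨ha1, ha2⟩ := abs_le.mp ha
  have w0 := cgWeight_raise ha hi 0 le_rfl (by omega)
  -- The range conditions on `t` are left open here; they are settled once `a` has a concrete value.
  have w1 := cgWeight_raise ha hi 1
  have w2 := cgWeight_raise ha hi 2
  have w3 := cgWeight_raise ha hi 3
  have w4 := cgWeight_raise ha hi 4
  norm_num at w0 w1 w2 w3 w4
  interval_cases a
  · simp only [cgPoly_neg_two]
    norm_num at w0 w1 w2 w3 w4 ⊢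
    linear_combination w0 * (y * (y - 1) * (y - 2) * (y - 3)) +
      w1 * (x * (y * (y - 1) * (y - 2))) + w2 * (x * (x - 1) * (y * (y - 1))) +
      w3 * (x * (x - 1) * (x - 2) * y) + w4 * (x * (x - 1) * (x - 2) * (x - 3))
  · simp only [cgPoly_neg_one]
    norm_num at w0 w1 w2 w3 ⊢
    linear_combination w0 * (y * (y - 1) * (y - 2)) +
      w1 * (x * (y * (y - 1))) + w2 * (x * (x - 1) * y) + w3 * (x * (x - 1) * (x - 2))
  · simp only [cgPoly_zero]
    norm_num at w0 w1 w2 ⊢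
    linear_combination w0 * (y * (y - 1)) + w1 * (x * y) + w2 * (x * (x - 1))
  · simp only [cgPoly_one]
    norm_num at w0 w1 ⊢
    linear_combination w0 * y + w1 * x
  · simp only [cgPoly_two]
    norm_num at w0 ⊢
    linear_combination w0

lemma cgWeight_neg {a i : ℤ} (ha : |a| ≤ 2) (hi : |i| ≤ 2) (t : ℤ) (ht : 0 ≤ t) (ht' : t ≤ 2 - a) :
    cgWeight a (-i) (2 - a - t) = (-1) ^ a.natAbs * cgWeight a i t := by
  obtain ⟨ha1, ha2⟩ := abs_le.mp ha
  obtain ⟨hi1, hi2⟩ := abs_le.mp hi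
  interval_cases a <;> interval_cases t <;> interval_cases i <;>
    norm_num [cgWeight, Nat.factorial, toNat_two, toNat_three, toNat_four]

/-- Reversing the summation `t ↦ 2 - a - t` reflects all weights. Through this symmetry the lowering
rules follow from the raising rules. -/
lemma cgPoly_neg {a i : ℤ} (ha : |a| ≤ 2) (hi : |i| ≤ 2) (x y : ℝ) :
    cgPoly a (-i) y x = (-1) ^ a.natAbs * cgPoly a i x y := by
  have h := cgWeight_neg ha hi
  obtain ⟨ha1, ha2⟩ := abs_le.mp ha
  have w0 := h 0
  have w1 := h 1
  have w2 := h 2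
  have w3 := h 3
  have w4 := h 4
  interval_cases a
  · simp only [cgPoly_neg_two]
    norm_num at w0 w1 w2 w3 w4 ⊢
    linear_combination w0 * (y * (y - 1) * (y - 2) * (y - 3)) +
      w1 * (x * (y * (y - 1) * (y - 2))) + w2 * (x * (x - 1) * (y * (y - 1))) +
      w3 * (x * (x - 1) * (x - 2) * y) + w4 * (x * (x - 1) * (x - 2) * (x - 3))
  · simp only [cgPoly_neg_one]
    norm_num at w0 w1 w2 w3 ⊢
    linear_combination w0 * (y * (y - 1) * (y - 2)) +
      w1 * (x * (y * (y - 1))) + w2 * (x * (x - 1) * y) + w3 * (x * (x - 1) * (x - 2))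
  · simp only [cgPoly_zero]
    norm_num at w0 w1 w2 ⊢
    linear_combination w0 * (y * (y - 1)) + w1 * (x * y) + w2 * (x * (x - 1))
  · simp only [cgPoly_one]
    norm_num at w0 w1 ⊢
    linear_combination w0 * y + w1 * x
  · simp only [cgPoly_two]
    norm_num at w0 ⊢
    linear_combination w0

/-- `cgPoly` at the highest weight, with `x = p + 2 - i`, `y = i - a`. -/
lemma cgPoly_highest {a i : ℤ} (ha : |a| ≤ 2) (hi : |i| ≤ 2) (h : a ≤ i) (x : ℝ) :
    cgPoly a i x (i - a) = (-1) ^ i.natAbs * fallFac x (2 - i).toNat /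
      ((2 - i).toNat ! * (a + 2).toNat !) := by
  obtain ⟨ha1, ha2⟩ := abs_le.mp ha
  obtain ⟨hi1, hi2⟩ := abs_le.mp hi
  interval_cases a
  · simp only [cgPoly_neg_two]
    interval_cases i <;>
    norm_num [cgWeight, Nat.factorial, toNat_two, toNat_three, toNat_four, fallFac_succ,
        fallFac_zero] <;> ring
  · simp only [cgPoly_neg_one]
    interval_cases i <;> first | omega |
    (norm_num [cgWeight, Nat.factorial, toNat_two, toNat_three, toNat_four, fallFac_succ,
        fallFac_zero] <;> ring)
  · simp only [cgPoly_zero]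
    interval_cases i <;> first | omega |
    (norm_num [cgWeight, Nat.factorial, toNat_two, toNat_three, toNat_four, fallFac_succ,
        fallFac_zero] <;> ring)
  · simp only [cgPoly_one]
    interval_cases i <;> first | omega |
    (norm_num [cgWeight, Nat.factorial, toNat_two, toNat_three, toNat_four, fallFac_succ,
        fallFac_zero] <;> ring)
  · simp only [cgPoly_two]
    interval_cases i <;> first | omega |
    (norm_num [cgWeight, Nat.factorial, toNat_two, toNat_three, toNat_four, fallFac_succ,
        fallFac_zero] <;> ring)

/-- `cgPoly` vanishes beyond the highest weight. -/
lemma cgPoly_top {a i : ℤ} (ha : |a| ≤ 2) (hi : |i| ≤ 2) (h : a < i) (x : ℝ) :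
    cgPoly a i x (i - a - 1) = 0 := by
  obtain ⟨ha1, ha2⟩ := abs_le.mp ha
  obtain ⟨hi1, hi2⟩ := abs_le.mp hi
  rw [cgPoly_eq_sum]
  refine Finset.sum_eq_zero fun t ht => ?_
  have ht' := Finset.mem_range.mp ht
  by_cases hc : (t : ℤ) ≤ 2 - i ∧ 0 ≤ a + i + t
  · obtain ⟨q, hq⟩ : ∃ q : ℕ, i - a - 1 = q := ⟨(i - a - 1).toNat, by omega⟩
    have hq' : (i : ℝ) - a - 1 = q := by exact_mod_cast hq
    rw [hq', fallFac_eq_zero (n := (2 - a - t).toNat) (by omega), mul_zero, mul_zero]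
  · rw [cgWeight, if_neg hc, zero_mul]

/-- The range conditions on `t` are contradictory at `i = -3`; this lets the raising recursion hold
at the edge `i = -2`. -/
lemma cgPoly_neg_three {a : ℤ} (ha : |a| ≤ 2) (x y : ℝ) : cgPoly a (-3) x y = 0 := by
  obtain ⟨ha1, ha2⟩ := abs_le.mp ha
  rw [cgPoly_eq_sum]
  refine Finset.sum_eq_zero fun t ht => ?_
  have ht' := Finset.mem_range.mp ht
  rw [cgWeight, if_neg (by omega), zero_mul]

/-- The origin of the five values of `constB`: after elimination of `d` by `x + y = 2d`, each is
forced by a polynomial identity in `x` and `y`. -/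
lemma constB_cgPoly (d : ℕ) {a : ℤ} (ha : |a| ≤ 2) {x y : ℝ} (h : x + y = 2 * d) :
    2 * constB d a * cgPoly a 0 x y =
      √6 * (x * cgPoly a 1 (x - 1) (y + 1) + y * cgPoly a (-1) (x + 1) (y - 1)) := by
  obtain ⟨ha1, ha2⟩ := abs_le.mp ha
  have hd : (d : ℝ) = (x + y) / 2 := by linarith
  interval_cases a
  · simp only [cgPoly_neg_two, constB, hd]
    norm_num [cgWeight, Nat.factorial, toNat_two, toNat_three, toNat_four] <;> ring
  · simp only [cgPoly_neg_one, constB, hd]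
    norm_num [cgWeight, Nat.factorial, toNat_two, toNat_three, toNat_four] <;> ring
  · simp only [cgPoly_zero, constB, hd]
    norm_num [cgWeight, Nat.factorial, toNat_two, toNat_three, toNat_four] <;> ring
  · simp only [cgPoly_one, constB, hd]
    norm_num [cgWeight, Nat.factorial, toNat_two, toNat_three, toNat_four] <;> ring
  · simp only [cgPoly_two, constB, hd]
    norm_num [cgWeight, Nat.factorial, toNat_two, toNat_three, toNat_four] <;> ring

/-! ### Recursions for the Clebsch-Gordan coefficients -/

/-- The coefficient of the raising operator, as a real number. -/
def rp (d : ℕ) (m : ℤ) : ℝ := √(((d : ℝ) - m) * (d + m + 1))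

lemma cp_eq_rp (d : ℕ) (m : ℤ) : cp d m = rp d m := cp_eq d m

lemma cm_eq_rp (d : ℕ) (m : ℤ) : cm d m = rp d (m - 1) := by rw [← cp_eq_rp, cp_pred]

lemma rp_self (d : ℕ) : rp d d = 0 := by simp [rp]

lemma rp_neg_self (d : ℕ) : rp d (-d - 1) = 0 := by
  rw [rp]; push_cast; ring_nf; simp

lemma rp_neg (d : ℕ) (m : ℤ) : rp d (-m - 1) = rp d m := by
  rw [rp, rp]; congr 1; push_cast; ring

lemma rp_mul_sqrt_succ {d : ℕ} {m : ℤ} (h1 : -(d : ℤ) ≤ m) (h2 : m < d) :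
    rp d m * √(wt d (m + 1)) = (d + m + 1) * √(wt d m) := by
  have h1' : (0 : ℝ) < d + m + 1 := by
    have : (-(d : ℝ)) ≤ m := by exact_mod_cast h1
    linarith
  have h2' : (0 : ℝ) < d - m := by
    have : (m : ℝ) < d := by exact_mod_cast h2
    linarith
  have hw := wt_succ h1 h2
  rw [rp, ← Real.sqrt_mul (by positivity)]
  conv_rhs => rw [← Real.sqrt_sq h1'.le, ← Real.sqrt_mul (by positivity)]
  congr 1
  linear_combination (d + m + 1 : ℝ) * hw

lemma rp_mul_sqrt {d : ℕ} {m : ℤ} (h1 : -(d : ℤ) ≤ m) (h2 : m < d) :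
    rp d m * √(wt d m) = (d - m) * √(wt d (m + 1)) := by
  have h1' : (0 : ℝ) < d + m + 1 := by
    have : (-(d : ℝ)) ≤ m := by exact_mod_cast h1
    linarith
  have h2' : (0 : ℝ) < d - m := by
    have : (m : ℝ) < d := by exact_mod_cast h2
    linarith
  have hw := wt_succ h1 h2
  rw [rp, ← Real.sqrt_mul (by positivity)]
  conv_rhs => rw [← Real.sqrt_sq h2'.le, ← Real.sqrt_mul (by positivity)]
  congr 1
  linear_combination (-(d - m : ℝ)) * hw

lemma sqrt_wt_pos (d : ℕ) (m : ℤ) : 0 < √(wt d m) := Real.sqrt_pos.mpr (wt_pos d m)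

/-- The form of `cg_eq` used for the recursions: the value with the square roots cleared. -/
lemma cg_mul_sqrt {d e : ℕ} {a m i : ℤ} (he : (e : ℤ) = d + a) (ha : |a| ≤ 2) (hi : |i| ≤ 2)
    (hm : |m| ≤ d) (hM : |i + m| ≤ e) (ht : |2 - (d : ℤ)| ≤ e) :
    cg d 2 a m i * √(wt d m) = cgConst d e * √(wt 2 i) * √(wt e (i + m)) *
      cgPoly a i (d + m) (d - m) := by
  rw [cg_eq he ha hi hm hM ht]
  field_simp [(sqrt_wt_pos d m).ne']

/-- The Clebsch-Gordan coefficients intertwine the raising operators. -/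
lemma cg_raise {d e : ℕ} {a n i : ℤ} (he : (e : ℤ) = d + a) (ha : |a| ≤ 2) (hi : |i| ≤ 2)
    (hn : |n| ≤ d) :
    rp e (i + n - 1) * cg d 2 a n i =
      rp 2 (i - 1) * cg d 2 a n (i - 1) + rp d (n - 1) * cg d 2 a (n - 1) i := by
  by_cases ht : |2 - (d : ℤ)| ≤ e
  swap
  · simp only [cg_eq_zero he fun h => ht h.2.2.2.1, mul_zero, add_zero]
  have hi' := abs_le.mp hi
  have hn' := abs_le.mp hn
  have ha' := abs_le.mp ha
  by_cases hM : |i + n - 1| ≤ e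
  swap
  · have z1 : cg d 2 a n (i - 1) = 0 := cg_eq_zero he fun h => hM (by
      rw [show i + n - 1 = i - 1 + n by ring]; exact h.2.2.1)
    have z2 : cg d 2 a (n - 1) i = 0 := cg_eq_zero he fun h => hM (by
      rw [show i + n - 1 = i + (n - 1) by ring]; exact h.2.2.1)
    rw [z1, z2, mul_zero, mul_zero, add_zero]
    by_cases hM1 : |i + n| ≤ e
    -- Here `i + n` is the lowest weight of spin `e`, so the ladder coefficient on the left
    -- vanishes.
    · rw [show i + n - 1 = -(e : ℤ) - 1 by rw [abs_le] at hM hM1; omega, rp_neg_self, zero_mul]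
    · rw [cg_eq_zero he fun h => hM1 h.2.2.1, mul_zero]
  have hM' := abs_le.mp hM
  -- all terms are multiples of `c`
  have hs := sqrt_wt_pos d n
  set c := cgConst d e * √(wt 2 i) * √(wt e (i + n - 1)) with hc
  have t0 : rp e (i + n - 1) * cg d 2 a n i * √(wt d n) =
      c * ((d + n + a + i) * cgPoly a i (d + n) (d - n)) := by
    rcases hM'.2.lt_or_eq with hlt | heq
    · have h1 := rp_mul_sqrt_succ hM'.1 hlt
      rw [sub_add_cancel] at h1
      rw [mul_assoc, cg_mul_sqrt he ha hi hn (abs_le.mpr ⟨by omega, by omega⟩) ht, hc]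
      have he' : (e : ℝ) = d + a := by exact_mod_cast he
      push_cast at h1
      rw [he'] at h1
      linear_combination (cgConst d e * √(wt 2 i) * cgPoly a i (d + n) (d - n)) * h1
    -- Beyond the highest weight of spin `e` the left side vanishes through its ladder coefficient,
    -- and the polynomial has a zero.
    · have hz := cgPoly_top (a := a) (i := i) ha hi (by omega) (d + n)
      have e1 : (d : ℝ) - n = i - a - 1 := by
        have : (d : ℤ) - n = i - a - 1 := by omega
        exact_mod_cast this
      rw [heq, rp_self, e1, hz]; ring
  have t1 : rp 2 (i - 1) * cg d 2 a n (i - 1) * √(wt d n) =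
      c * ((3 - i) * cgPoly a (i - 1) (d + n) (d - n)) := by
    rcases hi'.1.lt_or_eq with hlt | heq
    · have h1 := rp_mul_sqrt (d := 2) (m := i - 1) (by push_cast; omega) (by push_cast; omega)
      rw [sub_add_cancel] at h1
      rw [mul_assoc, cg_mul_sqrt he ha (abs_le.mpr ⟨by omega, by omega⟩) hn
        (by rwa [show i - 1 + n = i + n - 1 by ring]) ht, hc,
        show i - 1 + n = i + n - 1 by ring]
      push_cast at h1
      linear_combination (cgConst d e * √(wt e (i + n - 1)) * cgPoly a (i - 1) (d + n) (d - n)) * h1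
    · rw [← heq, show (-2 - 1 : ℤ) = -3 by norm_num, cgPoly_neg_three ha,
        cg_eq_zero he (by intro h; have := h.1; norm_num at this)]; ring
  have t2 : rp d (n - 1) * cg d 2 a (n - 1) i * √(wt d n) =
      c * ((d + n) * cgPoly a i (d + n - 1) (d - n + 1)) := by
    rcases hn'.1.lt_or_eq with hlt | heq
    · have h1 := rp_mul_sqrt_succ (d := d) (m := n - 1) (by omega) (by omega)
      rw [sub_add_cancel] at h1
      have h2 := cg_mul_sqrt (m := n - 1) he ha hi (abs_le.mpr ⟨by omega, by omega⟩)
        (by rwa [show i + (n - 1) = i + n - 1 by ring]) ht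
      rw [show i + (n - 1) = i + n - 1 by ring, ← hc] at h2
      push_cast at h1 h2
      rw [show (d : ℝ) + (n - 1) = d + n - 1 by ring, show (d : ℝ) - (n - 1) = d - n + 1 by ring] at h2
      linear_combination cg d 2 a (n - 1) i * h1 + (d + n : ℝ) * h2
    · rw [← heq, rp_neg_self]; push_cast; ring
  have key := cgPoly_raise ha hi ((d : ℝ) + n) (d - n)
  refine mul_right_cancel₀ hs.ne' ?_
  rw [add_mul, t0, t1, t2]
  linear_combination c * key

lemma cg_neg {d e : ℕ} {a m i : ℤ} (he : (e : ℤ) = d + a) (ha : |a| ≤ 2) :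
    cg d 2 a (-m) (-i) = (-1) ^ a.natAbs * cg d 2 a m i := by
  have wneg : ∀ (d : ℕ) (m : ℤ), wt d (-m) = wt d m := by
    intro d m; rw [wt, wt, sub_neg_eq_add, ← sub_eq_add_neg, mul_comm]
  have e0 : -i + -m = -(i + m) := by ring
  by_cases h : |i| ≤ 2 ∧ |m| ≤ d ∧ |i + m| ≤ e ∧ |2 - (d : ℤ)| ≤ e ∧ (e : ℤ) ≤ 2 + d
  · have hM : |-i + -m| ≤ e := by rw [e0, abs_neg]; exact h.2.2.1
    rw [cg_eq he ha h.1 h.2.1 h.2.2.1 h.2.2.2.1, cg_eq he ha (by rw [abs_neg]; exact h.1)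
      (by rw [abs_neg]; exact h.2.1) hM h.2.2.2.1, e0, wneg, wneg, wneg]
    push_cast
    rw [sub_neg_eq_add, ← sub_eq_add_neg, cgPoly_neg ha h.1]
    ring
  · rw [cg_eq_zero he h, cg_eq_zero he, mul_zero]
    rwa [e0, abs_neg, abs_neg, abs_neg]

/-- The Clebsch-Gordan coefficients intertwine the lowering operators. -/
lemma cg_lower {d e : ℕ} {a n i : ℤ} (he : (e : ℤ) = d + a) (ha : |a| ≤ 2) (hi : |i| ≤ 2)
    (hn : |n| ≤ d) :
    rp e (i + n) * cg d 2 a n i =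
      rp 2 i * cg d 2 a n (i + 1) + rp d n * cg d 2 a (n + 1) i := by
  have h := cg_raise (n := -n) (i := -i) he ha (by rwa [abs_neg]) (by rwa [abs_neg])
  rw [show -i + -n - 1 = -(i + n) - 1 by ring, rp_neg, rp_neg, rp_neg, cg_neg he ha,
    show -i - 1 = -(i + 1) by ring, cg_neg he ha, show -n - 1 = -(n + 1) by ring,
    cg_neg he ha] at h
  have hs : ((-1 : ℝ) ^ a.natAbs) ≠ 0 := pow_ne_zero _ (by norm_num)
  refine mul_left_cancel₀ hs ?_
  linear_combination h

/-- The identity behind the constants `B^d_a`. -/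
lemma cg_constB {d e : ℕ} {a n : ℤ} (he : (e : ℤ) = d + a) (ha : |a| ≤ 2) (hn : |n| ≤ d) :
    constB d a * cg d 2 a n 0 =
      rp d (n - 1) * cg d 2 a (n - 1) 1 + rp d n * cg d 2 a (n + 1) (-1) := by
  by_cases ht : |2 - (d : ℤ)| ≤ e
  swap
  · simp only [cg_eq_zero he fun h => ht h.2.2.2.1, mul_zero, add_zero]
  by_cases hM : |n| ≤ e
  swap
  · rw [cg_eq_zero he fun h => hM (by simpa using h.2.2.1),
      cg_eq_zero he fun h => hM (by simpa using h.2.2.1),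
      cg_eq_zero he fun h => hM (by simpa using h.2.2.1)]; ring
  have hn' := abs_le.mp hn
  have hs := sqrt_wt_pos d n
  have w0 : √(wt 2 0) = 2 := by
    rw [show wt 2 0 = 2 ^ 2 by norm_num [wt, Nat.factorial, toNat_two]]; exact Real.sqrt_sq (by norm_num)
  have w1 : wt 2 1 = 6 := by norm_num [wt, Nat.factorial, toNat_three]
  have w2 : wt 2 (-1) = 6 := by norm_num [wt, Nat.factorial, toNat_three]
  have t0 := cg_mul_sqrt (m := n) (i := 0) he ha (by norm_num) hn (by simpa using hM) ht
  rw [w0, zero_add] at t0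
  have t1 : rp d (n - 1) * cg d 2 a (n - 1) 1 * √(wt d n) =
      cgConst d e * √6 * √(wt e n) * ((d + n) * cgPoly a 1 (d + n - 1) (d - n + 1)) := by
    rcases hn'.1.lt_or_eq with hlt | heq
    · have h1 := rp_mul_sqrt_succ (d := d) (m := n - 1) (by omega) (by omega)
      rw [sub_add_cancel] at h1
      have h2 := cg_mul_sqrt (m := n - 1) (i := 1) he ha (by norm_num)
        (abs_le.mpr ⟨by omega, by omega⟩) (by simpa using hM) ht
      rw [w1, show 1 + (n - 1) = n by ring] at h2
      push_cast at h1 h2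
      rw [show (d : ℝ) + (n - 1) = d + n - 1 by ring, show (d : ℝ) - (n - 1) = d - n + 1 by ring] at h2
      linear_combination cg d 2 a (n - 1) 1 * h1 + (d + n : ℝ) * h2
    · rw [← heq, rp_neg_self]; push_cast; ring
  have t2 : rp d n * cg d 2 a (n + 1) (-1) * √(wt d n) =
      cgConst d e * √6 * √(wt e n) * ((d - n) * cgPoly a (-1) (d + n + 1) (d - n - 1)) := by
    rcases hn'.2.lt_or_eq with hlt | heq
    · have h1 := rp_mul_sqrt (d := d) (m := n) (by omega) (by omega)
      have h2 := cg_mul_sqrt (m := n + 1) (i := -1) he ha (by norm_num)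
        (abs_le.mpr ⟨by omega, by omega⟩) (by simpa using hM) ht
      rw [w2, show -1 + (n + 1) = n by ring] at h2
      push_cast at h1 h2
      rw [show (d : ℝ) + (n + 1) = d + n + 1 by ring, show (d : ℝ) - (n + 1) = d - n - 1 by ring] at h2
      linear_combination cg d 2 a (n + 1) (-1) * h1 + (d - n : ℝ) * h2
    · rw [heq, rp_self]; push_cast; ring
  have key := constB_cgPoly d ha (x := d + n) (y := d - n) (by ring)
  refine mul_right_cancel₀ hs.ne' ?_
  rw [add_mul, t1, t2]
  linear_combination constB d a * t0 + cgConst d e * √(wt e n) * key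

/-- At `i = 2` the falling factorial in `cgPoly_highest` is empty, so a nonzero closed form remains.
This is the value that normalizes solutions of the recursions. -/
lemma cg_highest_ne_zero {d e : ℕ} {a : ℤ} (he : (e : ℤ) = d + a) (ha : |a| ≤ 2)
    (ht : |2 - (d : ℤ)| ≤ e) : cg d 2 a (e - 2) 2 ≠ 0 := by
  have ha' := abs_le.mp ha
  have ht' := abs_le.mp ht
  have h2 := cgPoly_highest (i := 2) ha (by norm_num) ha'.2 (d + ((e : ℤ) - 2 : ℤ))
  have e1 : (d : ℝ) - ((e : ℤ) - 2 : ℤ) = (2 : ℤ) - a := by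
    have : (d : ℤ) - (e - 2) = 2 - a := by omega
    exact_mod_cast this
  rw [cg_eq he ha (by norm_num) (abs_le.mpr ⟨by omega, by omega⟩)
    (abs_le.mpr ⟨by omega, by omega⟩) ht, e1, h2]
  have c1 : 0 < cgConst d e := by
    refine Real.sqrt_pos.mpr ?_
    have : (0 : ℝ) < 2 * (e : ℤ) + 1 := by push_cast; positivity
    positivity
  have := sqrt_wt_pos
  simp only [sub_self, Int.toNat_zero, fallFac_zero]
  norm_num
  refine ⟨⟨c1.ne', ⟨(this _ _).ne', (this _ _).ne'⟩, (this _ _).ne'⟩, Nat.factorial_ne_zero _⟩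

lemma sum_Icc_two {M : Type*} [AddCommMonoid M] (f : ℤ → M) :
    ∑ i ∈ Finset.Icc (-2 : ℤ) 2, f i = f (-2) + f (-1) + f 0 + f 1 + f 2 := by
  rw [show Finset.Icc (-2 : ℤ) 2 = {-2, -1, 0, 1, 2} from rfl]
  simp [add_assoc]

/-- The Clebsch-Gordan coefficients at the highest weight form a unit vector. -/
lemma sum_cg_sq {d e : ℕ} {a : ℤ} (he : (e : ℤ) = d + a) (ha : |a| ≤ 2)
    (ht : |2 - (d : ℤ)| ≤ e) : ∑ i ∈ Finset.Icc (-2 : ℤ) 2, cg d 2 a (e - i) i ^ 2 = 1 := by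
  have ha' := abs_le.mp ha
  have ht' := abs_le.mp ht
  -- Here `p = d + e - 2`, which is nonnegative by the triangle inequality; all the factorials
  -- involved are expressed through `p`.
  obtain ⟨p, hp⟩ : ∃ p : ℕ, 2 * (d : ℤ) + a - 2 = p := ⟨(2 * (d : ℤ) + a - 2).toNat, by omega⟩
  have hval : ∀ i ∈ Finset.Icc (-2 : ℤ) 2, cg d 2 a (e - i) i ^ 2 =
      if a ≤ i then (p + a + 3) * (2 - a).toNat ! * (p + a + 2).toNat ! / ((p + 5)! * (a + 2).toNat !) *
        ((2 + i).toNat ! * fallFac (p + (2 - i).toNat) (2 - i).toNat / ((2 - i).toNat ! * (i - a).toNat !))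
      else 0 := by
    intro i hi
    have hi' := Finset.mem_Icc.mp hi
    split_ifs with h
    swap
    · rw [cg_eq_zero he, zero_pow two_ne_zero]
      intro h'; have := abs_le.mp h'.2.1; omega
    have hi2 : |i| ≤ 2 := abs_le.mpr hi'
    have hm : |(e : ℤ) - i| ≤ d := abs_le.mpr ⟨by omega, by omega⟩
    obtain ⟨r, hr⟩ : ∃ r : ℕ, 2 - i = r := ⟨(2 - i).toNat, by omega⟩
    have e1 : (d : ℝ) - ((e : ℤ) - i : ℤ) = i - a := by
      have : (d : ℤ) - (e - i) = i - a := by omega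
      exact_mod_cast this
    have e2 : (d : ℝ) + ((e : ℤ) - i : ℤ) = (p + r : ℕ) := by
      have : (d : ℤ) + (e - i) = (p + r : ℕ) := by omega
      exact_mod_cast this
    rw [cg_eq he ha hi2 hm (by rw [add_sub_cancel]; simp) ht, e1, e2, cgPoly_highest ha hi2 h,
      mul_pow, mul_pow, div_pow, mul_pow, cgConst, Real.sq_sqrt, Real.sq_sqrt (wt_pos _ _).le,
      Real.sq_sqrt (wt_pos _ _).le, Real.sq_sqrt (wt_pos _ _).le]
    swap
    · have : (0 : ℝ) ≤ 2 * (e : ℤ) + 1 := by push_cast; positivity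
      positivity
    rw [wt, wt, wt, show ((2 : ℕ) : ℤ) = 2 from rfl, show (e : ℤ) + 2 - d = a + 2 by omega,
      show (e : ℤ) - 2 + d = p by omega, show 2 + (d : ℤ) - e = 2 - a by omega,
      show (2 + (d : ℤ) + e + 1) = (p + 5 : ℕ) by push_cast; omega,
      show (e : ℤ) + (i + (e - i)) = p + a + 2 by omega, show (e : ℤ) - (i + (e - i)) = 0 by omega,
      show (d : ℤ) + (e - i) = (p + r : ℕ) by push_cast; omega,
      show (d : ℤ) - (e - i) = i - a by omega, hr]
    have e3 : (2 : ℝ) * (e : ℤ) + 1 = p + a + 3 := by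
      have : 2 * (e : ℤ) + 1 = p + a + 3 := by omega
      exact_mod_cast this
    have hf := factorial_eq_fallFac (p := p + r) (n := r) (by omega)
    rw [Nat.add_sub_cancel] at hf
    simp only [Int.toNat_natCast, Int.toNat_zero, Nat.factorial_zero]
    rw [hf, e3]
    have hne : fallFac (p + r : ℕ) r ≠ 0 := by
      intro h0; rw [h0, mul_zero] at hf; exact (Nat.factorial_ne_zero _) (by exact_mod_cast hf)
    push_cast at hne ⊢
    have hfac : ∀ n : ℕ, (n ! : ℝ) ≠ 0 := fun n => by exact_mod_cast Nat.factorial_ne_zero n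
    have h1 := hfac p
    have h2 := hfac (p + 5)
    have h3 := hfac (a + 2).toNat
    have h4 := hfac (i - a).toNat
    have h5 := hfac r
    have hsg : ((-1 : ℝ) ^ i.natAbs) ^ 2 = 1 := by rw [← pow_mul, mul_comm, pow_mul]; norm_num
    simp only [div_pow, mul_pow, hsg]
    field_simp
  -- For each of the five values of `a` the remaining finite sum is a rational identity in `p`.
  rw [Finset.sum_congr rfl hval, sum_Icc_two]
  have hfac : ∀ n : ℕ, (n ! : ℝ) ≠ 0 := fun n => by exact_mod_cast Nat.factorial_ne_zero n
  have h1 := hfac p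
  obtain ⟨ha1, ha2⟩ := ha'
  clear hval
  interval_cases a <;>
  · first
    | rw [show ((p : ℤ) + -2 + 2).toNat = p by omega]
    | rw [show ((p : ℤ) + -1 + 2).toNat = p + 1 by omega]
    | rw [show ((p : ℤ) + 0 + 2).toNat = p + 2 by omega]
    | rw [show ((p : ℤ) + 1 + 2).toNat = p + 3 by omega]
    | rw [show ((p : ℤ) + 2 + 2).toNat = p + 4 by omega]
    norm_num [Nat.factorial, toNat_two, toNat_three, toNat_four, fallFac_succ, fallFac_zero]
    field_simp
    ring

/-! ### Tensor products of families and Clebsch-Gordan coefficients -/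

/-- The component of spin `d + a` of the tensor product of a family of spin `2` and one of
spin `d`. -/
def tens (d : ℕ) (a : ℤ) (v w : ℤ → ℂ) (M : ℤ) : ℂ :=
  ∑ i ∈ Finset.Icc (-2 : ℤ) 2, (cg d 2 a (M - i) i : ℂ) * (v i * w (M - i))

/-- The Leibniz rule for the infinitesimal rotations commutes with the projection to spin `e`,
because the coefficients intertwine raising and lowering. Terms with `i = ±3` drop out at the ends
of the spin-2 ladder. -/
lemma tens_colDer {d e : ℕ} {a : ℤ} (he : (e : ℤ) = d + a) (ha : |a| ≤ 2) {v w : ℤ → ℂ}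
    (hv : ∀ m, 2 < |m| → v m = 0) (hw : ∀ m, (d : ℤ) < |m| → w m = 0) (ax : Fin 3) (M : ℤ) :
    colDer ax e (tens d a v w) M = ∑ i ∈ Finset.Icc (-2 : ℤ) 2, (cg d 2 a (M - i) i : ℂ) *
      (colDer ax 2 v i * w (M - i) + v i * colDer ax d w (M - i)) := by
  have p3 : v 3 = 0 := hv 3 (by norm_num)
  have m3 : v (-3) = 0 := hv (-3) (by norm_num)
  have R : ∀ i, |i| ≤ 2 → (cp e M * cg d 2 a (M + 1 - i) i : ℂ) * w (M + 1 - i) =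
      (cp 2 (i - 1) * cg d 2 a (M + 1 - i) (i - 1) + cp d (M - i) * cg d 2 a (M - i) i) *
        w (M + 1 - i) := by
    intro i hi
    -- Outside the range of spin `d` the recursion is not available, but there `w` vanishes.
    by_cases hn : |M + 1 - i| ≤ d
    · have := cg_raise (n := M + 1 - i) he ha hi hn
      rw [show i + (M + 1 - i) - 1 = M by ring, show M + 1 - i - 1 = M - i by ring] at this
      rw [cp_eq_rp, cp_eq_rp, cp_eq_rp]
      congr 1; exact_mod_cast this
    · rw [hw _ (not_le.mp hn), mul_zero, mul_zero]
  have L : ∀ i, |i| ≤ 2 → (cm e M * cg d 2 a (M - 1 - i) i : ℂ) * w (M - 1 - i) =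
      (cp 2 i * cg d 2 a (M - 1 - i) (i + 1) + cm d (M - i) * cg d 2 a (M - i) i) *
        w (M - 1 - i) := by
    intro i hi
    by_cases hn : |M - 1 - i| ≤ d
    · have := cg_lower (n := M - 1 - i) he ha hi hn
      rw [show i + (M - 1 - i) = M - 1 by ring, show M - 1 - i + 1 = M - i by ring] at this
      rw [cm_eq_rp, cp_eq_rp, cm_eq_rp, show M - i - 1 = M - 1 - i by ring]
      congr 1; exact_mod_cast this
    · rw [hw _ (not_le.mp hn), mul_zero, mul_zero]
  have c2 : cp 2 2 = 0 := cp_self 2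
  have c3 : cp 2 (-3) = 0 := cp_neg_self 2
  have hcm : ∀ i, cm 2 i = cp 2 (i - 1) := fun i => (cp_pred 2 i).symm
  have r0 := R (-2) (by norm_num)
  have r1 := R (-1) (by norm_num)
  have r2 := R 0 (by norm_num)
  have r3 := R 1 (by norm_num)
  have r4 := R 2 (by norm_num)
  have l0 := L (-2) (by norm_num)
  have l1 := L (-1) (by norm_num)
  have l2 := L 0 (by norm_num)
  have l3 := L 1 (by norm_num)
  have l4 := L 2 (by norm_num)
  simp only [colDer, tens, sum_Icc_two, hcm] at *
  ring_nf at *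
  simp only [p3, m3, c2, c3, mul_zero, zero_mul, add_zero] at *
  push_cast
  linear_combination (coefP ax * v (-2)) * r0 + (coefP ax * v (-1)) * r1 + (coefP ax * v 0) * r2 +
    (coefP ax * v 1) * r3 + (coefP ax * v 2) * r4 +
    (coefM ax * v (-2)) * l0 + (coefM ax * v (-1)) * l1 + (coefM ax * v 0) * l2 +
    (coefM ax * v 1) * l3 + (coefM ax * v 2) * l4

lemma tens_eq_zero {d e : ℕ} {a : ℤ} (he : (e : ℤ) = d + a) (v w : ℤ → ℂ) {M : ℤ}
    (hM : (e : ℤ) < |M|) : tens d a v w M = 0 := by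
  refine Finset.sum_eq_zero fun i _ => ?_
  rw [cg_eq_zero he, Complex.ofReal_zero, zero_mul]
  intro h
  have := h.2.2.1
  rw [add_sub_cancel] at this
  omega

lemma KDer.tensor {d e : ℕ} {a : ℤ} (he : (e : ℤ) = d + a) (ha : |a| ≤ 2) {v w : ℤ → K → ℂ}
    (hv : KDer 2 v) (hw : KDer d w) :
    KDer e fun M k => tens d a (fun m => v m k) (fun m => w m k) M where
  eq_zero M k hM := tens_eq_zero he _ _ hM
  deriv ax M k := by
    have h := HasDerivAt.fun_sum (u := Finset.Icc (-2 : ℤ) 2) fun i _ =>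
      (((hv.deriv ax i k).mul (hw.deriv ax (M - i) k)).const_mul (cg d 2 a (M - i) i : ℂ))
    refine h.congr_deriv ?_
    simp only [mul_rot_zero]
    exact (tens_colDer he ha (fun m h => hv.eq_zero m k h) (fun m h => hw.eq_zero m k h) ax M).symm

/-- The Clebsch-Gordan series for the Wigner matrices. -/
lemma tens_wignerD {d e : ℕ} {a : ℤ} (he : (e : ℤ) = d + a) (ha : |a| ≤ 2) {i m : ℤ} (hi : |i| ≤ 2)
    (hm : |m| ≤ d) (M : ℤ) (k : K) :
    tens d a (fun j => wignerD 2 i j k) (fun n => wignerD d m n k) M =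
      cg d 2 a m i * wignerD e (i + m) M k := by
  rw [((kDer_wignerD 2 i).tensor he ha (kDer_wignerD d m)).eq_sum M k]
  have h1 : ∀ n, tens d a (fun j => wignerD 2 i j (1 : K)) (fun l => wignerD d m l (1 : K)) n =
      if n = i + m then (cg d 2 a m i : ℂ) else 0 := by
    intro n
    rw [tens, Finset.sum_eq_single i]
    · rw [wignerD_one, wignerD_one, if_pos ⟨rfl, by exact_mod_cast hi⟩]
      by_cases h : n = i + m
      · subst h; simp [hm]
      · rw [if_neg (by rintro ⟨rfl, -⟩; exact h (by ring)), if_neg h, mul_zero, mul_zero]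
    · intro j _ hj; rw [wignerD_one, if_neg (fun h => hj h.1.symm), zero_mul, mul_zero]
    · intro h; exact absurd (Finset.mem_Icc.mpr (abs_le.mp hi)) h
  simp only [h1, ite_mul, zero_mul, Finset.sum_ite_eq']
  split_ifs with h
  · rfl
  · rw [wignerD_of_lt_left, mul_zero]
    by_contra h'
    exact h (Finset.mem_Icc.mpr (abs_le.mp (not_lt.mp h')))

/-! ### Haar integrals -/

instance : haarK.IsHaarMeasure := by unfold haarK; infer_instance

instance : IsProbabilityMeasure haarK := ⟨by
  exact Measure.haarMeasure_self (K₀ := (⊤ : TopologicalSpace.PositiveCompacts K))⟩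

/-- A right translate of the Haar probability measure is again a Haar probability measure, hence
equal to it. -/
instance : haarK.IsMulRightInvariant where
  map_mul_right_eq_self g := by
    have : IsProbabilityMeasure (haarK.map (· * g)) :=
      Measure.isProbabilityMeasure_map (measurable_mul_const g).aemeasurable
    exact Measure.isHaarMeasure_eq_of_isProbabilityMeasure _ _

lemma integrable_of_continuous {F : K → ℂ} (hF : Continuous F) : Integrable F haarK :=
  hF.integrable_of_hasCompactSupport (HasCompactSupport.of_compactSpace F)

/-- The integral of the derivative along a one-parameter group vanishes. -/
lemma integral_deriv_eq_zero {F F' : K → ℂ} (hF : Continuous F) (hF' : Continuous F') (ax : Fin 3)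
    (h : ∀ k, HasDerivAt (fun t => F (k * rot ax t)) (F' k) 0) : ∫ k, F' k ∂haarK = 0 := by
  obtain ⟨C, hC⟩ := (isCompact_range hF'.norm).bddAbove
  have hb : ∀ k, ‖F' k‖ ≤ C := fun k => hC ⟨k, rfl⟩
  have h1 := hasDerivAt_integral_of_dominated_loc_of_deriv_le (μ := haarK) (x₀ := (0 : ℝ))
    (F := fun t k => F (k * rot ax t)) (F' := fun t k => F' (k * rot ax t)) (bound := fun _ => C)
    Filter.univ_mem
    (Filter.Eventually.of_forall fun t =>
      (integrable_of_continuous (hF.comp (continuous_mul_const _))).aestronglyMeasurable)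
    (integrable_of_continuous (hF.comp (continuous_mul_const _)))
    (integrable_of_continuous (hF'.comp (continuous_mul_const _))).aestronglyMeasurable
    (Filter.Eventually.of_forall fun k t _ => hb _) (integrable_const _)
    (Filter.Eventually.of_forall fun k t _ => hasDerivAt_rot_shift h k t)
  -- By right invariance the integral of the rotated function is constant in the angle, so its
  -- derivative is zero.
  have h2 := h1.2
  simp only [mul_rot_zero, integral_mul_right_eq_self F] at h2
  exact h2.unique (hasDerivAt_const _ _)

/-- Integration against a row of `conj D^e` intertwines the infinitesimal rotations. -/
lemma integral_colDer {e : ℕ} {n : ℤ} {F F' : K → ℂ} (hF : Continuous F) (hF' : Continuous F')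
    (ax : Fin 3) (h : ∀ k, HasDerivAt (fun t => F (k * rot ax t)) (F' k) 0) (N : ℤ) :
    ∫ k : K, F' k * starRingEnd ℂ (wignerD e n N k) ∂haarK =
      coefM ax * cp e N * ∫ k : K, F k * starRingEnd ℂ (wignerD e n (N + 1) k) ∂haarK +
      coefP ax * cm e N * ∫ k : K, F k * starRingEnd ℂ (wignerD e n (N - 1) k) ∂haarK -
      Complex.I * coefZ ax * N * ∫ k : K, F k * starRingEnd ℂ (wignerD e n N k) ∂haarK := by
  have hc : ∀ N, Continuous fun k : K => starRingEnd ℂ (wignerD e n N k) := fun N =>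
    Complex.continuous_conj.comp (continuous_wignerD e n N)
  have hi : ∀ N, Integrable (fun k : K => F k * starRingEnd ℂ (wignerD e n N k)) haarK := fun N =>
    integrable_of_continuous (hF.mul (hc N))
  have hi' : Integrable (fun k : K => F' k * starRingEnd ℂ (wignerD e n N k)) haarK :=
    integrable_of_continuous (hF'.mul (hc N))
  have key := integral_deriv_eq_zero (ax := ax)
    (F := fun k => F k * starRingEnd ℂ (wignerD e n N k))
    (F' := fun k => F' k * starRingEnd ℂ (wignerD e n N k) -
      (coefM ax * cp e N * (F k * starRingEnd ℂ (wignerD e n (N + 1) k)) +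
      coefP ax * cm e N * (F k * starRingEnd ℂ (wignerD e n (N - 1) k)) -
      Complex.I * coefZ ax * N * (F k * starRingEnd ℂ (wignerD e n N k))))
    (hF.mul (hc N)) (by have := hc N; have := hc (N + 1); have := hc (N - 1); fun_prop)
    (fun k => by
      refine ((h k).mul (hasDerivAt_conj ((kDer_wignerD e n).deriv ax N k))).congr_deriv ?_
      simp only [mul_rot_zero, conj_colDer]
      ring)
  have hA := (hi (N + 1)).const_mul (coefM ax * cp e N)
  have hB := (hi (N - 1)).const_mul (coefP ax * cm e N)
  have hC := (hi N).const_mul (Complex.I * coefZ ax * N)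
  have h1 := integral_sub hi' ((hA.add hB).sub hC)
  have h2 := integral_sub (hA.add hB) hC
  have h3 := integral_add hA hB
  simp only [Pi.add_apply, Pi.sub_apply] at h1 h2 h3
  rw [h1, h2, h3, integral_const_mul, integral_const_mul, integral_const_mul] at key
  exact sub_eq_zero.mp key

/-! ### Orthogonality relations -/

/-- The generators for the three axes are linearly independent combinations of `K_1`, `K_{-1}`,
`L_z`, so a relation valid for all axes splits into its three components. -/
lemma coef_separate {A B C : ℂ} (h : ∀ ax, coefP ax * A + coefM ax * B + coefZ ax * C = 0) :
    A = 0 ∧ B = 0 ∧ C = 0 := by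
  have h0 := h 0
  have h1 := h 1
  have h2 := h 2
  simp only [coefP, coefM, coefZ, Matrix.cons_val_zero, Matrix.cons_val_one, Matrix.cons_val] at h0 h1 h2
  have hI := Complex.I_mul_I
  refine ⟨?_, ?_, by linear_combination h2⟩
  · linear_combination Complex.I * h0 - h1 + (A + B) / 2 * hI
  · linear_combination Complex.I * h0 + h1 + (A + B) / 2 * hI

lemma cp_ne_zero {d : ℕ} {m : ℤ} (h1 : -(d : ℤ) ≤ m) (h2 : m < d) : cp d m ≠ 0 := by
  rw [cp_eq_rp, rp]
  have h1' : (0 : ℝ) < d + m + 1 := by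
    have : (-(d : ℝ)) ≤ m := by exact_mod_cast h1
    linarith
  have h2' : (0 : ℝ) < d - m := by
    have : (m : ℝ) < d := by exact_mod_cast h2
    linarith
  have := Real.sqrt_pos.mpr (mul_pos h2' h1')
  exact_mod_cast this.ne'

lemma continuous_conj_wignerD (d : ℕ) (m' m : ℤ) :
    Continuous fun k : K => starRingEnd ℂ (wignerD d m' m k) :=
  Complex.continuous_conj.comp (continuous_wignerD d m' m)

/-- Schur's orthogonality relations for the matrix entries of `D^d`. -/
lemma integral_wignerD_mul_conj (d : ℕ) {m' m n N : ℤ} (hm : |m| ≤ d) (hn : |n| ≤ d) :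
    (2 * d + 1 : ℂ) * ∫ k : K, wignerD d m' m k * starRingEnd ℂ (wignerD d n N k) ∂haarK =
      if m' = n ∧ m = N then 1 else 0 := by
  set S : ℤ → ℤ → ℂ := fun m N => ∫ k : K, wignerD d m' m k * starRingEnd ℂ (wignerD d n N k) ∂haarK
    with hS
  have hcol : ∀ ax m N, colDer ax d (fun m => S m N) m =
      coefM ax * cp d N * S m (N + 1) + coefP ax * cm d N * S m (N - 1) -
        Complex.I * coefZ ax * N * S m N := by
    intro ax m N
    have hc := continuous_wignerD d m'
    rw [← integral_colDer (hc m) (F' := fun k => colDer ax d (fun l => wignerD d m' l k) m)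
      (by unfold colDer; have := hc m; have := hc (m + 1); have := hc (m - 1); fun_prop)
      ax ((kDer_wignerD d m').deriv ax m) N]
    have hi : ∀ l, Integrable (fun k : K => wignerD d m' l k * starRingEnd ℂ (wignerD d n N k)) haarK :=
      fun l => integrable_of_continuous ((hc l).mul (continuous_conj_wignerD d n N))
    have hA := (hi (m + 1)).const_mul (coefP ax * cp d m)
    have hB := (hi (m - 1)).const_mul (coefM ax * cm d m)
    have hC := (hi m).const_mul (Complex.I * coefZ ax * m)
    have h2 := integral_sub (hA.add hB) hC
    have h3 := integral_add hA hB
    simp only [Pi.add_apply] at h2 h3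
    rw [h3, integral_const_mul, integral_const_mul, integral_const_mul] at h2
    simp only [colDer, hS]
    rw [← h2]
    congr 1
    funext k
    ring
  -- The `K_{±1}` components compare neighbouring entries; the `L_z` component kills entries of
  -- unequal weights.
  have hsep := fun m N => coef_separate (A := cp d m * S (m + 1) N - cm d N * S m (N - 1))
    (B := cm d m * S (m - 1) N - cp d N * S m (N + 1)) (C := -Complex.I * (m - N) * S m N)
    (fun ax => by have := hcol ax m N; unfold colDer at this; linear_combination this)
  have hdiag : ∀ m N, m ≠ N → S m N = 0 := by
    intro m N hne
    have := (hsep m N).2.2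
    have h0 : (m : ℂ) - N ≠ 0 := sub_ne_zero.mpr (by exact_mod_cast hne)
    simpa [h0] using this
  have hstep : ∀ j : ℕ, -(d : ℤ) + j ≤ d → S (-d + j) (-d + j) = S (-d) (-d) := by
    intro j
    induction j with
    | zero => simp
    | succ j ih =>
      intro hj
      push_cast at hj ⊢
      rw [← ih (by omega)]
      have h1 := (hsep (-d + j) (-d + j + 1)).1
      rw [cm_succ, add_sub_cancel_right, ← mul_sub] at h1
      have h2 := (mul_eq_zero.mp h1).resolve_left (cp_ne_zero (by omega) (by omega))
      rw [← add_assoc]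
      exact sub_eq_zero.mp h2
  have hconst : ∀ m : ℤ, |m| ≤ (d : ℤ) → S m m = S (-d) (-d) := by
    intro m hm
    rw [abs_le] at hm
    have := hstep (m + d).toNat (by omega)
    rwa [show -(d : ℤ) + (m + d).toNat = m by omega] at this
  -- The common diagonal value is fixed by its sum over the `2d + 1` weights, which unitarity
  -- evaluates pointwise on `K`.
  have hsum : ∑ l ∈ Finset.Icc (-(d : ℤ)) d, S l l = if m' = n then 1 else 0 := by
    simp only [hS]
    have hint : ∀ l ∈ Finset.Icc (-(d : ℤ)) d, Integrable (fun k : K => wignerD d m' l k *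
        starRingEnd ℂ (wignerD d n l k)) haarK := fun l _ => integrable_of_continuous
      ((continuous_wignerD d m' l).mul (continuous_conj_wignerD d n l))
    rw [← integral_finsetSum _ hint]
    simp only [wignerD_mul_conj]
    simp [hn]
  rw [Finset.sum_congr rfl fun l hl => hconst l (abs_le.mpr (Finset.mem_Icc.mp hl)),
    Finset.sum_const, Int.card_Icc, nsmul_eq_mul] at hsum
  have hcard : ((((d : ℤ) + 1 - -d).toNat : ℕ) : ℂ) = 2 * d + 1 := by
    rw [show ((d : ℤ) + 1 - -d).toNat = 2 * d + 1 by omega]; push_cast; ring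
  rw [hcard] at hsum
  change (2 * d + 1 : ℂ) * S m N = _
  by_cases h : m = N
  · subst h
    rw [hconst m hm, hsum]; simp
  · rw [hdiag m N h, mul_zero, if_neg fun h' => h h'.2]

/-! ### Integrals of triple products. -/

/-- A solution of the recursions for the Clebsch-Gordan coefficients is determined by one value. -/
lemma cg_recursion_unique {d e : ℕ} {T : ℤ → ℤ → ℤ → ℂ}
    (hP : ∀ i m N : ℤ, |i| ≤ 2 → |m| ≤ (d : ℤ) →
      cp 2 i * T (i + 1) m N + cp d m * T i (m + 1) N = cm e N * T i m (N - 1))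
    (hM : ∀ i m N : ℤ, |i| ≤ 2 → |m| ≤ (d : ℤ) →
      cm 2 i * T (i - 1) m N + cm d m * T i (m - 1) N = cp e N * T i m (N + 1))
    (hZ : ∀ i m N : ℤ, |i| ≤ 2 → |m| ≤ (d : ℤ) → i + m ≠ N → T i m N = 0)
    (hd : ∀ i m N, (d : ℤ) < |m| → T i m N = 0) (he : ∀ i m N, (e : ℤ) < |N| → T i m N = 0)
    (h2 : ∀ i m N, 2 < |i| → T i m N = 0)
    (h0 : T 2 (e - 2) e = 0) (i m N : ℤ) : T i m N = 0 := by
  -- At the top weight `N = e` the right side of the lowering relation vanishes, which propagates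
  -- the zero downwards in `i`.
  have htop : ∀ j : ℕ, j ≤ 4 → T (2 - j) (e - (2 - j)) e = 0 := by
    intro j
    induction j with
    | zero => intro _; simpa using h0
    | succ j ih =>
      intro hj
      by_cases hm : |(e : ℤ) - (2 - (j + 1 : ℕ))| ≤ d
      swap
      · exact hd _ _ _ (not_le.mp hm)
      have h := hM (2 - j) (e - (2 - (j + 1 : ℕ))) e (abs_le.mpr ⟨by omega, by omega⟩) hm
      rw [cp_self, zero_mul, show (e : ℤ) - (2 - (j + 1 : ℕ)) - 1 = e - (2 - j) by push_cast; ring,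
        ih (by omega), mul_zero, add_zero, ← cp_pred] at h
      have h' := (mul_eq_zero.mp h).resolve_left (cp_ne_zero (by push_cast; omega) (by push_cast; omega))
      rwa [show (2 : ℤ) - j - 1 = 2 - (j + 1 : ℕ) by push_cast; ring] at h'
  -- From one weight `N` to the next lower one the raising relation determines every entry.
  have hall : ∀ j : ℕ, ∀ i m, T i m (e - j) = 0 := by
    intro j
    induction j with
    | zero =>
      intro i m
      by_cases hi : |i| ≤ 2
      swap
      · exact h2 _ _ _ (not_le.mp hi)
      by_cases hm : |m| ≤ d
      swap
      · exact hd _ _ _ (not_le.mp hm)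
      by_cases hs : i + m = e
      · have hi' := abs_le.mp hi
        have := htop (2 - i).toNat (by omega)
        rw [show (2 : ℤ) - (2 - i).toNat = i by omega, show (e : ℤ) - i = m by omega] at this
        simpa using this
      · exact hZ _ _ _ hi hm (by simpa using hs)
    | succ j ih =>
      intro i m
      by_cases hi : |i| ≤ 2
      swap
      · exact h2 _ _ _ (not_le.mp hi)
      by_cases hm : |m| ≤ d
      swap
      · exact hd _ _ _ (not_le.mp hm)
      by_cases hN : |(e : ℤ) - (j + 1 : ℕ)| ≤ e
      swap
      · exact he _ _ _ (not_le.mp hN)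
      have h := hP i m (e - j) hi hm
      rw [ih, ih, mul_zero, mul_zero, add_zero, ← cp_pred] at h
      rw [abs_le] at hN
      have h' := (mul_eq_zero.mp h.symm).resolve_left (cp_ne_zero (by omega) (by omega))
      rwa [show (e : ℤ) - j - 1 = e - (j + 1 : ℕ) by push_cast; ring] at h'
  by_cases hN : |N| ≤ e
  · rw [abs_le] at hN
    have := hall (e - N).toNat i m
    rwa [show (e : ℤ) - ((e : ℤ) - N).toNat = N by omega] at this
  · exact he _ _ _ (not_le.mp hN)

/-- The integral of a product of three matrix entries. -/
lemma integral_triple {d e : ℕ} {a : ℤ} (he : (e : ℤ) = d + a) (ha : |a| ≤ 2) {i' m' n : ℤ}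
    (hi' : |i'| ≤ 2) (hm' : |m'| ≤ d) (hn : |n| ≤ e) (i m N : ℤ) :
    (2 * e + 1 : ℂ) * ∫ k : K, wignerD 2 i' i k * wignerD d m' m k *
        starRingEnd ℂ (wignerD e n N k) ∂haarK =
      if i' + m' = n ∧ i + m = N then (cg d 2 a m' i' * cg d 2 a m i : ℂ) else 0 := by
  set S : ℤ → ℤ → ℤ → ℂ := fun i m N => ∫ k : K, wignerD 2 i' i k * wignerD d m' m k *
        starRingEnd ℂ (wignerD e n N k) ∂haarK with hS
  have hcont : ∀ i m, Continuous fun k : K => wignerD 2 i' i k * wignerD d m' m k := fun i m =>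
    (continuous_wignerD 2 i' i).mul (continuous_wignerD d m' m)
  have hint : ∀ i m N, Integrable (fun k : K => wignerD 2 i' i k * wignerD d m' m k *
        starRingEnd ℂ (wignerD e n N k)) haarK := fun i m N =>
    integrable_of_continuous ((hcont i m).mul (continuous_conj_wignerD e n N))
  have hcol : ∀ ax i m N, colDer ax 2 (fun i => S i m N) i + colDer ax d (fun m => S i m N) m =
      coefM ax * cp e N * S i m (N + 1) + coefP ax * cm e N * S i m (N - 1) -
        Complex.I * coefZ ax * N * S i m N := by
    intro ax i m N
    have hc1 := continuous_wignerD 2 i'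
    have hc2 := continuous_wignerD d m'
    rw [← integral_colDer (hcont i m)
      (F' := fun k => colDer ax 2 (fun l => wignerD 2 i' l k) i * wignerD d m' m k +
        wignerD 2 i' i k * colDer ax d (fun l => wignerD d m' l k) m)
      (by
        unfold colDer
        have := hc1 i; have := hc1 (i + 1); have := hc1 (i - 1)
        have := hc2 m; have := hc2 (m + 1); have := hc2 (m - 1)
        fun_prop)
      ax (fun k => by
        have := ((kDer_wignerD 2 i').deriv ax i k).mul ((kDer_wignerD d m').deriv ax m k)
        simp only [mul_rot_zero] at this
        exact this) N]
    have hsplit : ∀ k : K, (colDer ax 2 (fun l => wignerD 2 i' l k) i * wignerD d m' m k +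
        wignerD 2 i' i k * colDer ax d (fun l => wignerD d m' l k) m) *
          starRingEnd ℂ (wignerD e n N k) =
        ∑ j : Fin 6, ![coefP ax * cp 2 i, coefM ax * cm 2 i, -(Complex.I * coefZ ax * i),
          coefP ax * cp d m, coefM ax * cm d m, -(Complex.I * coefZ ax * m)] j *
          (wignerD 2 i' (![i + 1, i - 1, i, i, i, i] j) k *
            wignerD d m' (![m, m, m, m + 1, m - 1, m] j) k * starRingEnd ℂ (wignerD e n N k)) := by
      intro k
      simp only [Fin.sum_univ_six, colDer, Matrix.cons_val_zero, Matrix.cons_val_one, Matrix.cons_val]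
      ring
    simp only [hsplit]
    rw [integral_finsetSum _ fun j _ => (hint _ _ N).const_mul _]
    simp only [integral_const_mul, Fin.sum_univ_six, colDer, Matrix.cons_val_zero,
      Matrix.cons_val_one, Matrix.cons_val, hS]
    ring
  have hsep := fun i m N => coef_separate
    (A := cp 2 i * S (i + 1) m N + cp d m * S i (m + 1) N - cm e N * S i m (N - 1))
    (B := cm 2 i * S (i - 1) m N + cm d m * S i (m - 1) N - cp e N * S i m (N + 1))
    (C := -Complex.I * (i + m - N) * S i m N)
    (fun ax => by have := hcol ax i m N; unfold colDer at this; linear_combination this)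
  -- the Clebsch-Gordan tensor satisfies the same relations
  set Cg : ℤ → ℤ → ℤ → ℂ := fun i m N => if i + m = N then (cg d 2 a m i : ℂ) else 0 with hCg
  have hCP : ∀ i m N : ℤ, |i| ≤ 2 → |m| ≤ (d : ℤ) →
      cp 2 i * Cg (i + 1) m N + cp d m * Cg i (m + 1) N = cm e N * Cg i m (N - 1) := by
    intro i m N hi hm
    simp only [hCg]
    by_cases h : i + m + 1 = N
    · rw [if_pos (by omega), if_pos (by omega), if_pos (by omega), cm_eq_rp, cp_eq_rp, cp_eq_rp]
      have := cg_lower he ha hi hm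
      rw [show i + m = N - 1 by omega] at this
      exact_mod_cast this.symm
    · rw [if_neg (by omega), if_neg (by omega), if_neg (by omega)]; ring
  have hCM : ∀ i m N : ℤ, |i| ≤ 2 → |m| ≤ (d : ℤ) →
      cm 2 i * Cg (i - 1) m N + cm d m * Cg i (m - 1) N = cp e N * Cg i m (N + 1) := by
    intro i m N hi hm
    simp only [hCg]
    by_cases h : i + m - 1 = N
    · rw [if_pos (by omega), if_pos (by omega), if_pos (by omega), cm_eq_rp, cm_eq_rp, cp_eq_rp]
      have := cg_raise he ha hi hm
      rw [h] at this
      exact_mod_cast this.symm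
    · rw [if_neg (by omega), if_neg (by omega), if_neg (by omega)]; ring
  -- The factor `τ` matches the two tensors at one entry. If the triangle inequality fails, then `|e
  -- - 2| > d` and the integral itself is zero there.
  obtain ⟨τ, hτ⟩ : ∃ τ : ℂ, S 2 (e - 2) e = τ * Cg 2 (e - 2) e := by
    by_cases ht : |2 - (d : ℤ)| ≤ e
    · have h0 : (cg d 2 a (e - 2) 2 : ℂ) ≠ 0 := by exact_mod_cast cg_highest_ne_zero he ha ht
      refine ⟨S 2 (e - 2) e / cg d 2 a (e - 2) 2, ?_⟩
      simp only [hCg]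
      rw [if_pos (by omega), div_mul_cancel₀ _ h0]
    · refine ⟨0, ?_⟩
      have : (d : ℤ) < |(e : ℤ) - 2| := by
        rw [not_le, lt_abs] at ht; rw [lt_abs]; rw [abs_le] at ha; omega
      simp only [hS, wignerD_of_lt_right this]
      simp
  have huniq := cg_recursion_unique (d := d) (e := e) (T := fun i m N => S i m N - τ * Cg i m N)
    (fun i m N hi hm => by linear_combination (hsep i m N).1 - τ * hCP i m N hi hm)
    (fun i m N hi hm => by linear_combination (hsep i m N).2.1 - τ * hCM i m N hi hm)
    (fun i m N _ _ hne => by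
      have h := (hsep i m N).2.2
      have h0 : (i : ℂ) + m - N ≠ 0 := by
        have : i + m - N ≠ 0 := sub_ne_zero.mpr hne
        exact_mod_cast this
      have h1 : S i m N = 0 := by simpa [h0] using h
      simp only [h1, hCg, if_neg hne]; ring)
    (fun i m N h => by
      have : cg d 2 a m i = 0 := cg_eq_zero he fun h' => absurd h'.2.1 (not_le.mpr h)
      simp [hS, hCg, wignerD_of_lt_right h, this])
    (fun i m N h => by
      have : i + m = N → cg d 2 a m i = 0 := by
        rintro rfl; exact cg_eq_zero he fun h' => absurd h'.2.2.1 (not_le.mpr h)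
      simp only [hS, hCg, wignerD_of_lt_right h]
      split_ifs with h1
      · simp [this h1]
      · simp)
    (fun i m N h => by
      have : cg d 2 a m i = 0 := cg_eq_zero he fun h' => absurd h'.1 (not_le.mpr h)
      simp [hS, hCg, wignerD_of_lt_right (d := 2) (by exact_mod_cast h), this])
    (by rw [hτ, sub_self])
  have hST : ∀ i m N, S i m N = τ * Cg i m N := fun i m N => sub_eq_zero.mp (huniq i m N)
  -- Contracting at the top weight turns the product `D^2 D^d` into a single entry of `D^e`, to
  -- which Schur's relations apply; together with `sum_cg_sq` this evaluates `τ`.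
  have hnorm : (2 * e + 1 : ℂ) * ∑ j ∈ Finset.Icc (-2 : ℤ) 2, (cg d 2 a (e - j) j : ℂ) * S j (e - j) e =
      if i' + m' = n then (cg d 2 a m' i' : ℂ) else 0 := by
    simp only [hS, ← integral_const_mul]
    rw [← integral_finsetSum _ fun j _ => (hint _ _ _).const_mul _]
    have : ∀ k : K, ∑ j ∈ Finset.Icc (-2 : ℤ) 2, (cg d 2 a (e - j) j : ℂ) *
        (wignerD 2 i' j k * wignerD d m' (e - j) k * starRingEnd ℂ (wignerD e n e k)) =
        cg d 2 a m' i' * (wignerD e (i' + m') e k * starRingEnd ℂ (wignerD e n e k)) := by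
      intro k
      rw [← mul_assoc, ← tens_wignerD he ha hi' hm' e k, tens, Finset.sum_mul]
      exact Finset.sum_congr rfl fun j _ => by ring
    simp only [this]
    rw [integral_const_mul, mul_left_comm, integral_wignerD_mul_conj e (by simp) hn]
    simp
  change (2 * e + 1 : ℂ) * S i m N = _
  rw [hST]
  by_cases ht : |2 - (d : ℤ)| ≤ e
  · have hτ' : (2 * e + 1 : ℂ) * τ = if i' + m' = n then (cg d 2 a m' i' : ℂ) else 0 := by
      rw [← hnorm]
      have hsq := sum_cg_sq he ha ht
      congr 1
      have : ∀ j ∈ Finset.Icc (-2 : ℤ) 2, (cg d 2 a (e - j) j : ℂ) * S j (e - j) e =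
          τ * ((cg d 2 a (e - j) j ^ 2 : ℝ) : ℂ) := by
        intro j _
        rw [hST]
        simp only [hCg]
        rw [if_pos (by omega)]
        push_cast; ring
      rw [Finset.sum_congr rfl this, ← Finset.mul_sum, ← Complex.ofReal_sum, hsq]
      simp
    rw [← mul_assoc, hτ']
    simp only [hCg]
    by_cases h1 : i' + m' = n <;> by_cases h2 : i + m = N <;> simp [h1, h2]
  · have hz : ∀ m i, cg d 2 a m i = 0 := fun m i => cg_eq_zero he fun h => ht h.2.2.2.1
    simp [hCg, hz]

/-! ### The tensor operator `X_j` -/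

/-- The matrices `X_j`, `|j| ≤ 2`. -/
def matX (j : ℤ) : Matrix (Fin 3) (Fin 3) ℂ :=
  if j = 2 then matX2 1
  else if j = 1 then matX1 1
  else if j = 0 then matX0
  else if j = -1 then matX1 (-1)
  else if j = -2 then matX2 (-1)
  else 0

lemma matX_trace (j : ℤ) : (matX j).trace = 0 := by
  unfold matX
  split_ifs <;> simp [matX2, matX1, matX0, Matrix.trace_fin_three]
  ring

lemma matX_of_lt {j : ℤ} (h : 2 < |j|) : matX j = 0 := by
  rw [lt_abs] at h
  rw [matX, if_neg (by omega), if_neg (by omega), if_neg (by omega), if_neg (by omega),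
    if_neg (by omega)]

lemma sqrt_six_mul : ((√6 : ℝ) : ℂ) * ((√6 : ℝ) : ℂ) = 6 := by
  rw [← Complex.ofReal_mul, Real.mul_self_sqrt (by norm_num)]; norm_num

lemma cp_two_neg_two : cp 2 (-2) = 2 := by
  rw [cp, show ((2 : ℕ) : ℝ) * ((2 : ℕ) + 1) - (-2 : ℤ) * ((-2 : ℤ) + 1) = 2 ^ 2 by norm_num,
    Real.sqrt_sq (by norm_num)]; norm_num

lemma cp_two_one : cp 2 1 = 2 := by
  rw [cp, show ((2 : ℕ) : ℝ) * ((2 : ℕ) + 1) - (1 : ℤ) * ((1 : ℤ) + 1) = 2 ^ 2 by norm_num,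
    Real.sqrt_sq (by norm_num)]; norm_num

lemma cp_two_zero : cp 2 0 = (√6 : ℝ) := by
  rw [cp]; norm_num

lemma cp_two_neg_one : cp 2 (-1) = (√6 : ℝ) := by
  rw [cp]; norm_num

/-- The symmetric matrix of trace zero with the given entries. -/
def symMat (u v w p q : ℂ) : Matrix (Fin 3) (Fin 3) ℂ := !![u, v, p; v, w, q; p, q, -u - w]

lemma matX_two : matX 2 = symMat 1 Complex.I (-1) 0 0 := by
  simp [matX, matX2, symMat]

lemma matX_neg_two : matX (-2) = symMat 1 (-Complex.I) (-1) 0 0 := by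
  simp [matX, matX2, symMat]

lemma matX_one : matX 1 = symMat 0 0 0 (-1) (-Complex.I) := by
  simp [matX, matX1, symMat]

lemma matX_neg_one : matX (-1) = symMat 0 0 0 1 (-Complex.I) := by
  simp [matX, matX1, symMat]

lemma matX_zero : matX 0 = symMat (-((√6 : ℝ) : ℂ) / 3) 0 (-((√6 : ℝ) : ℂ) / 3) 0 0 := by
  simp [matX, matX0, symMat, neg_div]
  ring_nf

lemma smul_symMat (c u v w p q : ℂ) :
    c • symMat u v w p q = symMat (c * u) (c * v) (c * w) (c * p) (c * q) := by
  simp [symMat]; ring_nf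

lemma matK1_commutator (ε : ℤ) (u v w p q : ℂ) :
    matK1 ε * symMat u v w p q - symMat u v w p q * matK1 ε =
      symMat (-2 * ε * p) (-Complex.I * p - ε * q) (-2 * Complex.I * q)
        (ε * (2 * u + w) + Complex.I * v) (ε * v + Complex.I * (u + 2 * w)) := by
  simp only [matK1, symMat]
  ext i j
  fin_cases i <;> fin_cases j <;> simp <;> ring_nf

lemma rotGen_two_commutator (u v w p q : ℂ) :
    (rotGen 2).map Complex.ofReal * symMat u v w p q -
      symMat u v w p q * (rotGen 2).map Complex.ofReal =
      symMat (-2 * v) (u - w) (2 * v) (-q) p := by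
  have h : (rotGen 2).map Complex.ofReal = !![0, -1, 0; 1, 0, 0; 0, 0, 0] := by
    ext i j; fin_cases i <;> fin_cases j <;> simp [rotGen]
  simp only [h, symMat]
  ext i j
  fin_cases i <;> fin_cases j <;> simp <;> ring_nf

lemma symMat_congr {u v w p q u' v' w' p' q' : ℂ} (h1 : u = u') (h2 : v = v') (h3 : w = w')
    (h4 : p = p') (h5 : q = q') : symMat u v w p q = symMat u' v' w' p' q' := by
  rw [h1, h2, h3, h4, h5]

lemma matX_three : matX 3 = symMat 0 0 0 0 0 := by
  rw [matX_of_lt (by norm_num)]; ext i j; fin_cases i <;> fin_cases j <;> simp [symMat]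

lemma matX_neg_three : matX (-3) = symMat 0 0 0 0 0 := by
  rw [matX_of_lt (by norm_num)]; ext i j; fin_cases i <;> fin_cases j <;> simp [symMat]

/-- The `X_j` form a spin-2 ladder under commutators. The scaling of `X_0` is the one that yields
the coefficients `√6` on both sides of weight `0`. -/
lemma matK1_one_commutator (i : ℤ) (hi : |i| ≤ 2) :
    matK1 1 * matX i - matX i * matK1 1 = cp 2 i • matX (i + 1) := by
  have hI := Complex.I_mul_I
  have h6 := sqrt_six_mul
  rw [abs_le] at hi
  obtain ⟨h1, h2⟩ := hi
  interval_cases i <;> simp only [matX_two, matX_one, matX_zero, matX_neg_one, matX_neg_two,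
    show (-2 + 1 : ℤ) = -1 by norm_num, show (-1 + 1 : ℤ) = 0 by norm_num,
    show (0 + 1 : ℤ) = 1 by norm_num, show (1 + 1 : ℤ) = 2 by norm_num,
    show (2 + 1 : ℤ) = 3 by norm_num, matX_three,
    cp_two_neg_two, cp_two_one, cp_two_zero, cp_two_neg_one, matK1_commutator, smul_symMat,
    Int.cast_one, Int.reduceNeg]
  all_goals apply symMat_congr
  all_goals first
    | ring1
    | linear_combination hI
    | linear_combination -hI
    | linear_combination 2 * hI
    | linear_combination -2 * hI
    | linear_combination (1 / 3 : ℂ) * h6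
    | linear_combination (1 / 3 : ℂ) * h6 + 2 * hI

lemma matK1_neg_one_commutator (i : ℤ) (hi : |i| ≤ 2) :
    matK1 (-1) * matX i - matX i * matK1 (-1) = cm 2 i • matX (i - 1) := by
  have hI := Complex.I_mul_I
  have h6 := sqrt_six_mul
  have c2 : cm 2 2 = 2 := (cm_succ 2 1).trans cp_two_one
  have c1 : cm 2 1 = (√6 : ℝ) := (cm_succ 2 0).trans cp_two_zero
  have c0 : cm 2 0 = (√6 : ℝ) := (cm_succ 2 (-1)).trans cp_two_neg_one
  have c3 : cm 2 (-1) = 2 := (cm_succ 2 (-2)).trans cp_two_neg_two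
  rw [abs_le] at hi
  obtain ⟨h1, h2⟩ := hi
  interval_cases i <;> simp only [matX_two, matX_one, matX_zero, matX_neg_one, matX_neg_two,
    show (-2 - 1 : ℤ) = -3 by norm_num, show (-1 - 1 : ℤ) = -2 by norm_num,
    show (0 - 1 : ℤ) = -1 by norm_num, show (1 - 1 : ℤ) = 0 by norm_num,
    show (2 - 1 : ℤ) = 1 by norm_num, matX_neg_three,
    c0, c1, c2, c3, matK1_commutator, smul_symMat,
    Int.cast_one, Int.cast_neg, Int.reduceNeg]
  all_goals apply symMat_congr
  all_goals first
    | ring1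
    | linear_combination hI
    | linear_combination -hI
    | linear_combination 2 * hI
    | linear_combination -2 * hI
    | linear_combination (1 / 3 : ℂ) * h6
    | linear_combination (1 / 3 : ℂ) * h6 + 2 * hI

lemma rotGen_two_commutator_matX (i : ℤ) (hi : |i| ≤ 2) :
    (rotGen 2).map Complex.ofReal * matX i - matX i * (rotGen 2).map Complex.ofReal =
      (-Complex.I * i) • matX i := by
  have hI := Complex.I_mul_I
  rw [abs_le] at hi
  obtain ⟨h1, h2⟩ := hi
  interval_cases i <;> simp only [matX_two, matX_one, matX_zero, matX_neg_one, matX_neg_two,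
    rotGen_two_commutator, smul_symMat, Int.cast_one, Int.cast_neg, Int.cast_zero, Int.cast_ofNat,
    Int.reduceNeg]
  all_goals apply symMat_congr
  all_goals first
    | ring1
    | linear_combination hI
    | linear_combination -hI
    | linear_combination 2 * hI

/-- Outside `|i| ≤ 2` the left side is zero; the right side is too, either because `i + s` is also
out of range or because the coefficient vanishes. -/
lemma commutator_eq {i : ℤ} {L : Matrix (Fin 3) (Fin 3) ℂ} {c : ℤ → ℂ} {s : ℤ}
    (h : |i| ≤ 2 → L * matX i - matX i * L = c i • matX (i + s))
    (hc : 2 < |i| → |i + s| ≤ 2 → c i = 0) : L * matX i - matX i * L = c i • matX (i + s) := by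
  by_cases hi : |i| ≤ 2
  · exact h hi
  · rw [not_le] at hi
    rw [matX_of_lt hi]
    by_cases h2 : |i + s| ≤ 2
    · rw [hc hi h2]; simp
    · rw [matX_of_lt (not_le.mp h2)]; simp

lemma rotGen_commutator (ax : Fin 3) (i : ℤ) :
    (rotGen ax).map Complex.ofReal * matX i - matX i * (rotGen ax).map Complex.ofReal =
      (coefP ax * cp 2 i) • matX (i + 1) + (coefM ax * cm 2 i) • matX (i - 1) -
        (Complex.I * coefZ ax * i) • matX i := by
  have h1 : matK1 1 * matX i - matX i * matK1 1 = cp 2 i • matX (i + 1) := by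
    refine commutator_eq (c := cp 2) (matK1_one_commutator i) fun h2 h3 => ?_
    rw [lt_abs] at h2; rw [abs_le] at h3
    obtain rfl : i = -3 := by omega
    exact cp_neg_self 2
  have h2 : matK1 (-1) * matX i - matX i * matK1 (-1) = cm 2 i • matX (i - 1) := by
    refine commutator_eq (c := cm 2) (s := -1) (matK1_neg_one_commutator i)
      fun h2 h3 => ?_
    rw [lt_abs] at h2; rw [abs_le] at h3
    obtain rfl : i = 2 + 1 := by omega
    rw [cm_succ]; exact cp_self 2
  have h3 : (rotGen 2).map Complex.ofReal * matX i - matX i * (rotGen 2).map Complex.ofReal =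
      (-Complex.I * i) • matX i := by
    have := commutator_eq (i := i) (c := fun i => -Complex.I * i) (s := 0)
      (L := (rotGen 2).map Complex.ofReal)
      (by simpa using rotGen_two_commutator_matX i) fun h2 h3 => by
        rw [add_zero] at h3; omega
    simpa using this
  calc _ = coefP ax • (matK1 1 * matX i - matX i * matK1 1) +
      coefM ax • (matK1 (-1) * matX i - matX i * matK1 (-1)) +
      coefZ ax • ((rotGen 2).map Complex.ofReal * matX i -
        matX i * (rotGen 2).map Complex.ofReal) := by
        rw [rotGen_map ax]
        simp only [add_mul, mul_add, Matrix.smul_mul, Matrix.mul_smul, smul_sub]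
        abel
    _ = _ := by
        rw [h1, h2, h3]
        module

lemma rotGen_transpose (ax : Fin 3) : (rotGen ax)ᵀ = -rotGen ax := by
  fin_cases ax <;> ext i j <;> fin_cases i <;> fin_cases j <;> simp [rotGen]

/-- Differentiating `k X kᵀ` along a rotation gives `k [L, X] kᵀ`, and the commutators with the
`X_i` follow the spin-2 rules. -/
lemma kDer_adjoint (p q : Fin 3) : KDer 2 fun i k =>
    (k.1.map Complex.ofReal * matX i * (k.1ᵀ).map Complex.ofReal) p q where
  eq_zero m k h := by rw [matX_of_lt (by exact_mod_cast h)]; simp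
  deriv ax m k := by
    have hc := curveDeriv_mul_rot k ax
    have h1 : HasDerivAt (fun t => ((k * rot ax t : K).1.map Complex.ofReal * matX m *
        ((k * rot ax t : K).1ᵀ).map Complex.ofReal) p q)
        (((k.1 * rotGen ax).map Complex.ofReal * matX m * (k.1ᵀ).map Complex.ofReal +
          k.1.map Complex.ofReal * matX m * ((k.1 * rotGen ax)ᵀ).map Complex.ofReal) p q) 0 := by
      simp only [Matrix.mul_apply, Matrix.add_apply, Matrix.map_apply, Matrix.transpose_apply,
        Finset.sum_mul, ← Finset.sum_add_distrib]
      refine HasDerivAt.fun_sum fun b _ => HasDerivAt.fun_sum fun c _ => ?_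
      have h2 := ((hc p c).ofReal_comp.mul_const (matX m c b)).mul (hc q b).ofReal_comp
      simp only [mul_rot_zero, Matrix.mul_apply] at h2
      exact h2
    refine h1.congr_deriv ?_
    have h2 : (k.1 * rotGen ax).map Complex.ofReal * matX m * (k.1ᵀ).map Complex.ofReal +
        k.1.map Complex.ofReal * matX m * ((k.1 * rotGen ax)ᵀ).map Complex.ofReal =
        k.1.map Complex.ofReal * ((rotGen ax).map Complex.ofReal * matX m -
          matX m * (rotGen ax).map Complex.ofReal) * (k.1ᵀ).map Complex.ofReal := by
      have e1 : ∀ A B : Matrix (Fin 3) (Fin 3) ℝ, (A * B).map Complex.ofReal =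
          A.map Complex.ofReal * B.map Complex.ofReal := fun A B =>
        Matrix.map_mul (f := Complex.ofRealHom)
      have e2 : ∀ A : Matrix (Fin 3) (Fin 3) ℝ, (-A).map Complex.ofReal =
          -A.map Complex.ofReal := fun A => by ext; simp
      rw [Matrix.transpose_mul, rotGen_transpose, e1, e1, e2]
      simp only [mul_sub, sub_mul, Matrix.mul_assoc, Matrix.neg_mul, Matrix.mul_neg]
      abel
    rw [h2, rotGen_commutator]
    simp only [mul_sub, mul_add, sub_mul, add_mul, Matrix.mul_smul, Matrix.smul_mul,
      Matrix.sub_apply, Matrix.add_apply, Matrix.smul_apply, smul_eq_mul, colDer]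

lemma adjoint_matX (i : ℤ) (k : K) :
    k.1.map Complex.ofReal * matX i * (k.1ᵀ).map Complex.ofReal =
      ∑ n ∈ Finset.Icc (-2 : ℤ) 2, wignerD 2 n i k • matX n := by
  ext p q
  have h := (kDer_adjoint p q).eq_sum i k
  simp only [Matrix.sum_apply, Matrix.smul_apply, smul_eq_mul]
  refine h.trans (Finset.sum_congr rfl fun n _ => ?_)
  rw [mul_comm]
  congr 1
  simp [Matrix.map_one]

/-- The tensor operator property: evaluating at a point moved by `k` rotates the index of `X_i` by
`D^2(k)`. -/
lemma lie_matX_mul_ofK {f : G → ℂ} (hf : IsSmooth f) (i : ℤ) (k : K) (g : G) :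
    lie (matX i) f (g * ofK k) =
      ∑ n ∈ Finset.Icc (-2 : ℤ) 2, wignerD 2 n i k * lie (matX n) (fun x => f (x * ofK k)) g := by
  have h : (k.1)⁻¹ = k.1ᵀ := Matrix.inv_eq_right_inv (K_mul_transpose k)
  rw [ofK, lie_mul_right hf _ _ (K_det_ne k), h, adjoint_matX,
    lie_sum_mat _ (hf.mul_right _)]

/-! ### Vector-valued functions -/

lemma entry_of_lt {d : ℕ} (F : G → Idx d → ℂ) {m : ℤ} (h : (d : ℤ) < |m|) : entry F m = 0 := by
  funext g
  rw [entry, dif_neg]; · rfl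
  rw [Finset.mem_Icc, ← abs_le]; omega

lemma sum_Idx {d : ℕ} (h : ℤ → ℂ) : ∑ m : Idx d, h m = ∑ m ∈ Finset.Icc (-(d : ℤ)) d, h m :=
  Finset.sum_coe_sort _ h

lemma entry_coe {d : ℕ} (F : G → Idx d → ℂ) (m : Idx d) (g : G) : entry F m g = F g m := by
  rw [entry, dif_pos m.2]

variable {d : ℕ} {F : G → Idx d → ℂ}

lemma isSmooth_entry (hF : F ∈ vectorType d) (m : ℤ) : IsSmooth (entry F m) := by
  by_cases h : m ∈ Finset.Icc (-(d : ℤ)) d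
  · have : entry F m = fun g => F g ⟨m, h⟩ := by funext g; rw [entry, dif_pos h]
    rw [this]; exact hF.1 _
  · have : entry F m = fun _ => 0 := by funext g; rw [entry, dif_neg h]
    rw [this]; exact isSmooth_zero

lemma entry_mul_ofK (hF : F ∈ vectorType d) (m : ℤ) (g : G) (k : K) :
    entry F m (g * ofK k) = ∑ n ∈ Finset.Icc (-(d : ℤ)) d, entry F n g * wignerD d n m k := by
  by_cases h : m ∈ Finset.Icc (-(d : ℤ)) d
  · rw [← sum_Idx, entry, dif_pos h, hF.2]
    exact Finset.sum_congr rfl fun n _ => by rw [entry_coe]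
  · rw [Finset.mem_Icc, ← abs_le, not_le] at h
    rw [entry_of_lt F h, Finset.sum_eq_zero]; · rfl
    intro n _
    rw [wignerD_of_lt_right h, mul_zero]

lemma kDer_entry (hF : F ∈ vectorType d) (g : G) : KDer d fun m k => entry F m (g * ofK k) where
  eq_zero m k h := by simp only [entry_of_lt F h]; rfl
  deriv ax m k := by
    simp only [entry_mul_ofK hF]
    refine (HasDerivAt.fun_sum fun n _ =>
      ((kDer_wignerD d n).deriv ax m k).const_mul (entry F n g)).congr_deriv ?_
    simp only [colDer, Finset.mul_sum, ← Finset.sum_add_distrib, ← Finset.sum_sub_distrib]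
    exact Finset.sum_congr rfl fun n _ => by ring

/-- The Lie derivative along a rotation and the derivative dictated by the `K`-type are derivatives
of one and the same curve. -/
lemma realLie_rotGen_entry (hF : F ∈ vectorType d) (ax : Fin 3) (m : ℤ) (g : G) :
    realLie (rotGen ax) (entry F m) g = colDer ax d (fun n => entry F n g) m := by
  have h1 := realLie_eq_of_curve (isSmooth_entry hF m) (curveDeriv_rot ax)
    (congrArg Subtype.val (rot_zero ax)) (fun t => K_det_ne (rot ax t)) g
  have h2 := (kDer_entry hF g).deriv ax m 1
  simp only [one_mul, ofK_one, mul_one] at h2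
  exact h1.unique h2

lemma lie_matK1 (f : G → ℂ) (ε : ℤ) (g : G) (hf : IsSmooth f) : lie (matK1 ε) f g =
    -ε * realLie (rotGen 1) f g + Complex.I * realLie (rotGen 0) f g := by
  have h1 : (matK1 ε).map Complex.re = (-(ε : ℝ)) • rotGen 1 := by
    ext i j; fin_cases i <;> fin_cases j <;> simp [matK1, rotGen]
  have h2 : (matK1 ε).map Complex.im = rotGen 0 := by
    ext i j; fin_cases i <;> fin_cases j <;> simp [matK1, rotGen]
  rw [lie, h1, h2, realLie_smul_mat hf]
  push_cast; ring

lemma lie_matK1_entry (hF : F ∈ vectorType d) (m : ℤ) (g : G) :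
    lie (matK1 1) (entry F m) g = cp d m * entry F (m + 1) g := by
  rw [lie_matK1 _ _ _ (isSmooth_entry hF m), realLie_rotGen_entry hF, realLie_rotGen_entry hF]
  simp [colDer, coefP, coefM, coefZ]
  linear_combination (-(1 / 2) * (cp d m * entry F (m + 1) g + cm d m * entry F (m - 1) g)) * Complex.I_mul_I

lemma lie_matK1_neg_entry (hF : F ∈ vectorType d) (m : ℤ) (g : G) :
    lie (matK1 (-1)) (entry F m) g = cm d m * entry F (m - 1) g := by
  rw [lie_matK1 _ _ _ (isSmooth_entry hF m), realLie_rotGen_entry hF, realLie_rotGen_entry hF]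
  simp [colDer, coefP, coefM, coefZ]
  linear_combination (-(1 / 2) * (cp d m * entry F (m + 1) g + cm d m * entry F (m - 1) g)) * Complex.I_mul_I

/-! ### The operator `W` -/

/-- The components of `Y^a F`: the tensor operator `X` contracted with the entries of `F`. -/
def Wop (d : ℕ) (a : ℤ) (F : G → Idx d → ℂ) (M : ℤ) (g : G) : ℂ :=
  ∑ i ∈ Finset.Icc (-2 : ℤ) 2, (cg d 2 a (M - i) i : ℂ) * lie (matX i) (entry F (M - i)) g

lemma sum_Icc_reindex {d e : ℕ} (i : ℤ) {h : ℤ → ℂ} (h1 : ∀ n, (d : ℤ) < |n| → h n = 0)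
    (h2 : ∀ n, (e : ℤ) < |i + n| → h n = 0) :
    ∑ N ∈ Finset.Icc (-(e : ℤ)) e, h (N - i) = ∑ n ∈ Finset.Icc (-(d : ℤ)) d, h n := by
  refine Finset.sum_bij_ne_zero (fun N _ _ => N - i) ?_ ?_ ?_ ?_
  · intro N _ hN
    rw [Finset.mem_Icc, ← abs_le]
    exact not_lt.mp fun hc => hN (h1 _ hc)
  · intro N _ _ N' _ _ h; simpa using h
  · intro n _ hn
    refine ⟨i + n, ?_, by simpa using hn, by simp⟩
    rw [Finset.mem_Icc, ← abs_le]
    exact not_lt.mp fun hc => hn (h2 _ hc)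
  · intros; rfl

variable {d e : ℕ} {a : ℤ} {F : G → Idx d → ℂ}

lemma isSmooth_Wop (hF : F ∈ vectorType d) (M : ℤ) : IsSmooth (Wop d a F M) :=
  IsSmooth.sum _ fun i _ => ((isSmooth_entry hF _).lie _).const_mul _

lemma Wop_of_lt (he : (e : ℤ) = d + a) {M : ℤ} (hM : (e : ℤ) < |M|) (g : G) :
    Wop d a F M g = 0 := by
  refine Finset.sum_eq_zero fun i _ => ?_
  rw [cg_eq_zero he fun h => ?_]
  · simp
  · have := h.2.2.1
    rw [add_sub_cancel] at this
    omega

lemma Wop_mul_left (h : G) (M : ℤ) (g : G) :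
    Wop d a (fun x => F (h * x)) M g = Wop d a F M (h * g) := by
  refine Finset.sum_congr rfl fun i _ => ?_
  rw [← lie_mul_left]; rfl

lemma lie_entry_mul_ofK (hF : F ∈ vectorType d) (X : Matrix (Fin 3) (Fin 3) ℂ) (m : ℤ) (k : K)
    (g : G) : lie X (fun x => entry F m (x * ofK k)) g =
      ∑ n ∈ Finset.Icc (-(d : ℤ)) d, wignerD d n m k * lie X (entry F n) g := by
  rw [← lie_sum_fun _ fun n _ => isSmooth_entry hF n]
  congr 1
  funext x
  rw [entry_mul_ofK hF]
  exact Finset.sum_congr rfl fun n _ => mul_comm _ _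

lemma lie_matX_entry_mul_ofK (hF : F ∈ vectorType d) (i m : ℤ) (k : K) (g : G) :
    lie (matX i) (entry F m) (g * ofK k) = ∑ j ∈ Finset.Icc (-2 : ℤ) 2,
      ∑ n ∈ Finset.Icc (-(d : ℤ)) d,
        wignerD 2 j i k * wignerD d n m k * lie (matX j) (entry F n) g := by
  rw [lie_matX_mul_ofK (isSmooth_entry hF m)]
  refine Finset.sum_congr rfl fun j _ => ?_
  rw [lie_entry_mul_ofK hF, Finset.mul_sum]
  exact Finset.sum_congr rfl fun n _ => by ring

/-- The indices of `X_i` and of the entry rotate by `D^2` and `D^d`; after contraction with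
Clebsch-Gordan coefficients the series `tens_wignerD` leaves only `D^e`. -/
lemma Wop_mul_ofK (he : (e : ℤ) = d + a) (ha : |a| ≤ 2) (hF : F ∈ vectorType d) (M : ℤ) (g : G)
    (k : K) : Wop d a F M (g * ofK k) =
      ∑ N ∈ Finset.Icc (-(e : ℤ)) e, Wop d a F N g * wignerD e N M k := by
  have h1 : Wop d a F M (g * ofK k) = ∑ j ∈ Finset.Icc (-2 : ℤ) 2,
      ∑ n ∈ Finset.Icc (-(d : ℤ)) d, lie (matX j) (entry F n) g *
        (cg d 2 a n j * wignerD e (j + n) M k) := by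
    simp only [Wop, lie_matX_entry_mul_ofK hF, Finset.mul_sum]
    rw [Finset.sum_comm]
    refine Finset.sum_congr rfl fun j hj => ?_
    rw [Finset.sum_comm]
    refine Finset.sum_congr rfl fun n hn => ?_
    rw [← tens_wignerD he ha (abs_le.mpr (Finset.mem_Icc.mp hj))
      (abs_le.mpr (Finset.mem_Icc.mp hn)), tens, Finset.mul_sum]
    exact Finset.sum_congr rfl fun i _ => by ring
  rw [h1]
  simp only [Wop, Finset.sum_mul]
  symm
  rw [Finset.sum_comm]
  refine Finset.sum_congr rfl fun j _ => ?_
  have h2 := sum_Icc_reindex (d := d) (e := e) j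
    (h := fun n => lie (matX j) (entry F n) g * (cg d 2 a n j * wignerD e (j + n) M k)) ?_ ?_
  · rw [← h2]
    refine Finset.sum_congr rfl fun N _ => ?_
    rw [add_sub_cancel]; ring
  · intro n hn
    rw [cg_eq_zero he fun h => absurd h.2.1 (not_le.mpr hn)]; simp
  · intro n hn
    rw [wignerD_of_lt_left hn]; simp

/-- `Wop` as a vector-valued function. -/
def Wvec (d e : ℕ) (a : ℤ) (F : G → Idx d → ℂ) (g : G) (M : Idx e) : ℂ := Wop d a F M g

lemma entry_Wvec (he : (e : ℤ) = d + a) (M : ℤ) : entry (Wvec d e a F) M = Wop d a F M := by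
  funext g
  by_cases h : M ∈ Finset.Icc (-(e : ℤ)) e
  · rw [entry, dif_pos h]; rfl
  · rw [entry, dif_neg h, Wop_of_lt he]
    rw [Finset.mem_Icc, ← abs_le] at h; omega

lemma Wvec_mem (he : (e : ℤ) = d + a) (ha : |a| ≤ 2) (hF : F ∈ vectorType d) :
    Wvec d e a F ∈ vectorType e := by
  refine ⟨fun m => isSmooth_Wop hF m, fun g k m => ?_⟩
  rw [Wvec, Wop_mul_ofK he ha hF, ← sum_Idx]; rfl

/-! ### Values on `U(ℝ) Y⁺` -/

lemma det_pt {x₁ x₂ x₃ y₁ y₂ : ℝ} (h1 : 0 < y₁) (h2 : 0 < y₂) :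
    (matU x₁ x₂ x₃ * matY y₁ y₂).det ≠ 0 := by
  rw [det_mul, matU, matY, det_fin_three, det_diagonal, Fin.prod_univ_three]
  simp
  exact ⟨⟨h1.ne', h2.ne'⟩, h1.ne'⟩

lemma matU_mul_matY (x₁ x₂ x₃ y₁ y₂ : ℝ) : matU x₁ x₂ x₃ * matY y₁ y₂ =
    !![y₁ * y₂, x₂ * y₁, x₃; 0, y₁, x₁; 0, 0, 1] := by
  ext i j; fin_cases i <;> fin_cases j <;> simp [matU, matY, Matrix.mul_apply, Fin.sum_univ_three]

variable {f : G → ℂ} {x₁ x₂ x₃ y₁ y₂ : ℝ}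

lemma deriv_pt (hf : IsSmooth f) (h1 : 0 < y₁) (h2 : 0 < y₂) :
    deriv (fun t => f (pt t x₂ x₃ y₁ y₂)) x₁ =
      dpull f (matU x₁ x₂ x₃ * matY y₁ y₂) !![0, 0, 0; 0, 0, 1; 0, 0, 0] ∧
    deriv (fun t => f (pt x₁ t x₃ y₁ y₂)) x₂ =
      dpull f (matU x₁ x₂ x₃ * matY y₁ y₂) !![0, y₁, 0; 0, 0, 0; 0, 0, 0] ∧
    deriv (fun t => f (pt x₁ x₂ t y₁ y₂)) x₃ =
      dpull f (matU x₁ x₂ x₃ * matY y₁ y₂) !![0, 0, 1; 0, 0, 0; 0, 0, 0] ∧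
    deriv (fun t => f (pt x₁ x₂ x₃ t y₂)) y₁ =
      dpull f (matU x₁ x₂ x₃ * matY y₁ y₂) !![y₂, x₂, 0; 0, 1, 0; 0, 0, 0] ∧
    deriv (fun t => f (pt x₁ x₂ x₃ y₁ t)) y₂ =
      dpull f (matU x₁ x₂ x₃ * matY y₁ y₂) !![y₁, 0, 0; 0, 0, 0; 0, 0, 0] := by
  have hdet : (matU x₁ x₂ x₃ * matY y₁ y₂).det ≠ 0 := det_pt h1 h2
  have hid := fun x : ℝ => hasDerivAt_id' x
  have key : ∀ (γ : ℝ → Matrix (Fin 3) (Fin 3) ℝ) (V : Matrix (Fin 3) (Fin 3) ℝ) (t : ℝ),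
      CurveDeriv γ V t → γ t = matU x₁ x₂ x₃ * matY y₁ y₂ →
      deriv (fun t => f (cls (γ t))) t = dpull f (matU x₁ x₂ x₃ * matY y₁ y₂) V := by
    intro γ V t h h0
    rw [← h0]
    exact (hasDerivAt_curve hf h (by rw [h0]; exact hdet)).deriv
  refine ⟨key (fun t => matU t x₂ x₃ * matY y₁ y₂) _ _ ?_ rfl,
    key (fun t => matU x₁ t x₃ * matY y₁ y₂) _ _ ?_ rfl,
    key (fun t => matU x₁ x₂ t * matY y₁ y₂) _ _ ?_ rfl,
    key (fun t => matU x₁ x₂ x₃ * matY t y₂) _ _ ?_ rfl,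
    key (fun t => matU x₁ x₂ x₃ * matY y₁ t) _ _ ?_ rfl⟩ <;>
    intro i j <;> simp only [matU_mul_matY] <;>
    fin_cases i <;> fin_cases j <;> simp [hasDerivAt_const, hid, hasDerivAt_mul_const] <;>
    simpa using (hid _).const_mul _

/-- Scalars are trivial in `G`, so functions are constant along rays. This permits adding multiples
of the identity to a direction. -/
lemma dpull_self (hf : IsSmooth f) {M : Matrix (Fin 3) (Fin 3) ℝ} (hM : M.det ≠ 0) :
    dpull f M M = 0 := by
  have h := hasDerivAt_curve hf (γ := fun t => t • M) (v := M) (t := 1) (fun i j => by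
    simpa using (hasDerivAt_id' (1 : ℝ)).mul_const (M i j)) (by simpa using hM)
  rw [one_smul] at h
  refine h.unique ?_
  refine (hasDerivAt_const (1 : ℝ) (f (cls M))).congr_of_eventuallyEq ?_
  filter_upwards [eventually_ne_nhds (one_ne_zero (α := ℝ))] with t ht
  simp only [cls_smul ht]

/-- The coordinates of a function on `U(ℝ) Y⁺`. -/
lemma realLie_pt (hf : IsSmooth f) (h1 : 0 < y₁) (h2 : 0 < y₂) :
    realLie !![0, 1, 0; 0, 0, 0; 0, 0, 0] f (pt x₁ x₂ x₃ y₁ y₂) =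
      y₂ * deriv (fun t => f (pt x₁ t x₃ y₁ y₂)) x₂ ∧
    realLie !![0, 0, 1; 0, 0, 0; 0, 0, 0] f (pt x₁ x₂ x₃ y₁ y₂) =
      y₁ * y₂ * deriv (fun t => f (pt x₁ x₂ t y₁ y₂)) x₃ ∧
    realLie !![0, 0, 0; 0, 0, 1; 0, 0, 0] f (pt x₁ x₂ x₃ y₁ y₂) =
      y₁ * (deriv (fun t => f (pt t x₂ x₃ y₁ y₂)) x₁ +
        x₂ * deriv (fun t => f (pt x₁ x₂ t y₁ y₂)) x₃) ∧
    realLie !![1, 0, 0; 0, -1, 0; 0, 0, 0] f (pt x₁ x₂ x₃ y₁ y₂) =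
      2 * y₂ * deriv (fun t => f (pt x₁ x₂ x₃ y₁ t)) y₂ -
        y₁ * deriv (fun t => f (pt x₁ x₂ x₃ t y₂)) y₁ ∧
    realLie !![1, 0, 0; 0, 1, 0; 0, 0, -2] f (pt x₁ x₂ x₃ y₁ y₂) =
      3 * y₁ * deriv (fun t => f (pt x₁ x₂ x₃ t y₂)) y₁ := by
  obtain ⟨d1, d2, d3, d4, d5⟩ := deriv_pt (x₁ := x₁) (x₂ := x₂) (x₃ := x₃) hf h1 h2
  have hdet : (matU x₁ x₂ x₃ * matY y₁ y₂).det ≠ 0 := det_pt h1 h2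
  rw [d1, d2, d3, d4, d5, pt]
  have hs := dpull_self hf hdet
  set A := matU x₁ x₂ x₃ * matY y₁ y₂ with hA
  have sm : ∀ (c : ℝ) V, (c : ℂ) * dpull f A V = dpull f A (c • V) := fun c V =>
    (dpull_smul _ _ _ _).symm
  have hsub : ∀ V W, dpull f A V - dpull f A W = dpull f A (V + (-1 : ℝ) • W) := fun V W => by
    rw [dpull_add, dpull_smul]; push_cast; ring
  have eA : A = !![y₁ * y₂, x₂ * y₁, x₃; 0, y₁, x₁; 0, 0, 1] := matU_mul_matY _ _ _ _ _
  refine ⟨?_, ?_, ?_, ?_, ?_⟩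
  · rw [realLie_cls hf _ hdet, sm]; congr 1
    rw [eA]; ext i j; fin_cases i <;> fin_cases j <;> simp [mul_comm]
  · rw [realLie_cls hf _ hdet, ← Complex.ofReal_mul, sm]; congr 1
    rw [eA]; ext i j; fin_cases i <;> fin_cases j <;> simp
  · rw [realLie_cls hf _ hdet, sm, ← dpull_add, sm]; congr 1
    rw [eA]; ext i j; fin_cases i <;> fin_cases j <;> simp [mul_comm]
  · rw [realLie_cls hf _ hdet, ← Complex.ofReal_ofNat, ← Complex.ofReal_mul, sm, sm,
      hsub]
    congr 1
    rw [eA]; ext i j; fin_cases i <;> fin_cases j <;> simp <;> ring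
  · rw [realLie_cls hf _ hdet, ← Complex.ofReal_ofNat, ← Complex.ofReal_mul, sm]
    -- Adding twice the identity gives `diag(3, 3, 0)`, which is three times the direction of `y₁`.
    have h3 : dpull f A (A * !![1, 0, 0; 0, 1, 0; 0, 0, -2]) = dpull f A (A * !![1, 0, 0; 0, 1, 0; 0, 0, -2] + (2 : ℝ) • A) := by
      rw [dpull_add, ← sm, hs]; simp
    rw [h3]; congr 1
    rw [eA]; ext i j; fin_cases i <;> fin_cases j <;> simp <;> ring

/-- An infinitesimal Iwasawa decomposition of `X_2`, like the following ones for the other `X_j`: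
the triangular part moves within `U(ℝ) Y⁺`, and the remainder acts through the `K`-type. -/
lemma matX_two_eq : matX 2 = (1 : ℂ) • (!![1, 0, 0; 0, -1, 0; 0, 0, 0] : Matrix (Fin 3) (Fin 3) ℝ).map Complex.ofReal +
    (2 * Complex.I) • (!![0, 1, 0; 0, 0, 0; 0, 0, 0] : Matrix (Fin 3) (Fin 3) ℝ).map Complex.ofReal +
    Complex.I • (rotGen 2).map Complex.ofReal := by
  rw [matX_two]; ext i j; fin_cases i <;> fin_cases j <;> simp [symMat, rotGen] ; ring

lemma matX_neg_two_eq : matX (-2) = (1 : ℂ) • (!![1, 0, 0; 0, -1, 0; 0, 0, 0] : Matrix (Fin 3) (Fin 3) ℝ).map Complex.ofReal +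
    (-2 * Complex.I) • (!![0, 1, 0; 0, 0, 0; 0, 0, 0] : Matrix (Fin 3) (Fin 3) ℝ).map Complex.ofReal +
    (-Complex.I) • (rotGen 2).map Complex.ofReal := by
  rw [matX_neg_two]; ext i j; fin_cases i <;> fin_cases j <;> simp [symMat, rotGen] ; ring

lemma matX_one_eq : matX 1 = (-2 : ℂ) • (!![0, 0, 1; 0, 0, 0; 0, 0, 0] : Matrix (Fin 3) (Fin 3) ℝ).map Complex.ofReal +
    (-2 * Complex.I) • (!![0, 0, 0; 0, 0, 1; 0, 0, 0] : Matrix (Fin 3) (Fin 3) ℝ).map Complex.ofReal +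
    (-1 : ℂ) • matK1 1 := by
  rw [matX_one]; ext i j; fin_cases i <;> fin_cases j <;> simp [symMat, matK1] <;> ring

lemma matX_neg_one_eq : matX (-1) = (2 : ℂ) • (!![0, 0, 1; 0, 0, 0; 0, 0, 0] : Matrix (Fin 3) (Fin 3) ℝ).map Complex.ofReal +
    (-2 * Complex.I) • (!![0, 0, 0; 0, 0, 1; 0, 0, 0] : Matrix (Fin 3) (Fin 3) ℝ).map Complex.ofReal +
    (-1 : ℂ) • matK1 (-1) := by
  rw [matX_neg_one]; ext i j; fin_cases i <;> fin_cases j <;> simp [symMat, matK1] <;> ring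

lemma matX_zero_eq : matX 0 = (-((√6 : ℝ) : ℂ) / 3) •
    (!![1, 0, 0; 0, 1, 0; 0, 0, -2] : Matrix (Fin 3) (Fin 3) ℝ).map Complex.ofReal := by
  rw [matX_zero]; ext i j; fin_cases i <;> fin_cases j <;> simp [symMat]; ring

/-- The operators `X_j` in the coordinates of `U(ℝ) Y⁺`. -/
lemma lie_matX_pt (hF : F ∈ vectorType d) (h1 : 0 < y₁) (h2 : 0 < y₂) (m i : ℤ) (hi : |i| ≤ 2) :
    lie (matX i) (entry F m) (pt x₁ x₂ x₃ y₁ y₂) =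
      Z i (fun s₁ s₂ s₃ t₁ t₂ => entry F m (pt s₁ s₂ s₃ t₁ t₂)) x₁ x₂ x₃ y₁ y₂ +
        (if i = 2 then (m : ℂ) else if i = -2 then -(m : ℂ) else 0) *
          entry F m (pt x₁ x₂ x₃ y₁ y₂) -
        (if i = 1 then cp d m * entry F (m + 1) (pt x₁ x₂ x₃ y₁ y₂) else
          if i = -1 then cm d m * entry F (m - 1) (pt x₁ x₂ x₃ y₁ y₂) else 0) := by
  have hf := isSmooth_entry hF m
  obtain ⟨e1, e2, e3, e4, e5⟩ := realLie_pt (x₁ := x₁) (x₂ := x₂) (x₃ := x₃) hf h1 h2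
  have eK : realLie (rotGen 2) (entry F m) (pt x₁ x₂ x₃ y₁ y₂) =
      -Complex.I * m * entry F m (pt x₁ x₂ x₃ y₁ y₂) := by
    rw [realLie_rotGen_entry hF]; simp [colDer, coefP, coefM, coefZ]
  rw [abs_le] at hi
  obtain ⟨g1, g2⟩ := hi
  interval_cases i
  · rw [matX_neg_two_eq]
    simp only [lie_add_mat hf, lie_smul_mat hf, lie_ofReal hf, e1, e4, eK, Z]
    norm_num
    linear_combination (m * entry F m (pt x₁ x₂ x₃ y₁ y₂)) * Complex.I_mul_I
  · rw [matX_neg_one_eq]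
    simp only [lie_add_mat hf, lie_smul_mat hf, lie_ofReal hf, e2, e3, lie_matK1_neg_entry hF, Z]
    norm_num
    ring
  · rw [matX_zero_eq]
    simp only [lie_smul_mat hf, lie_ofReal hf, e5, Z]
    norm_num
    ring
  · rw [matX_one_eq]
    simp only [lie_add_mat hf, lie_smul_mat hf, lie_ofReal hf, e2, e3, lie_matK1_entry hF, Z]
    norm_num
    ring
  · rw [matX_two_eq]
    simp only [lie_add_mat hf, lie_smul_mat hf, lie_ofReal hf, e1, e4, eK, Z]
    norm_num
    linear_combination (-m * entry F m (pt x₁ x₂ x₃ y₁ y₂)) * Complex.I_mul_I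

/-- In the `M`-th component, `X_{±1}` shifts the entry `M ∓ 1` to the entry `M`. The sum of these
two contributions is exactly the term with `constB` in `Yentry` at `j = 0`. -/
lemma Wop_pt (he : (e : ℤ) = d + a) (ha : |a| ≤ 2) (hF : F ∈ vectorType d) (h1 : 0 < y₁)
    (h2 : 0 < y₂) (M : ℤ) : Wop d a F M (pt x₁ x₂ x₃ y₁ y₂) = ∑ j ∈ Finset.Icc (-2 : ℤ) 2,
      Yentry d a M j (fun s₁ s₂ s₃ t₁ t₂ => entry F (M - j) (pt s₁ s₂ s₃ t₁ t₂))
        x₁ x₂ x₃ y₁ y₂ := by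
  have hB : (constB d a : ℂ) * cg d 2 a M 0 * entry F M (pt x₁ x₂ x₃ y₁ y₂) =
      (cp d (M - 1) * cg d 2 a (M - 1) 1 + cm d (M + 1) * cg d 2 a (M + 1) (-1)) *
        entry F M (pt x₁ x₂ x₃ y₁ y₂) := by
    by_cases hM : |M| ≤ d
    · congr 1
      rw [cp_eq_rp, cm_eq_rp, add_sub_cancel_right]
      exact_mod_cast cg_constB he ha hM
    · rw [entry_of_lt F (not_le.mp hM)]; simp
  simp only [Wop, sum_Icc_two, Yentry]
  rw [lie_matX_pt hF h1 h2 _ _ (by norm_num), lie_matX_pt hF h1 h2 _ _ (by norm_num),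
    lie_matX_pt hF h1 h2 _ _ (by norm_num), lie_matX_pt hF h1 h2 _ _ (by norm_num),
    lie_matX_pt hF h1 h2 _ _ (by norm_num)]
  norm_num
  linear_combination hB

/-! ### The Iwasawa decomposition -/

/-- The rotation with rows proportional to `w`, `v × w`, `v`. -/
lemma frame_mem {v w : Fin 3 → ℝ} {s t : ℝ} (hvw : w ⬝ᵥ v = 0) (hs : s ^ 2 * (v ⬝ᵥ v) = 1)
    (ht : t ^ 2 * (w ⬝ᵥ w) = 1) :
    (Matrix.of ![t • w, (s * t) • (v ⨯₃ w), s • v] : Matrix (Fin 3) (Fin 3) ℝ) ∈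
      specialOrthogonalGroup (Fin 3) ℝ := by
  simp only [dotProduct, Fin.sum_univ_three] at hvw hs ht
  -- Lagrange's identity for the squared length of a cross product, with the two factors normalized
  -- and orthogonal.
  have key : ∀ a b c x y z : ℝ, s ^ 2 * (a * a + b * b + c * c) = 1 →
      t ^ 2 * (x * x + y * y + z * z) = 1 → x * a + y * b + z * c = 0 →
      s ^ 2 * t ^ 2 * ((b * z - c * y) ^ 2 + (c * x - a * z) ^ 2 + (a * y - b * x) ^ 2) = 1 := by
    intro a b c x y z h1 h2 h3
    linear_combination t ^ 2 * (x * x + y * y + z * z) * h1 + h2 -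
      s ^ 2 * t ^ 2 * (x * a + y * b + z * c) * h3
  have key' := key _ _ _ _ _ _ hs ht hvw
  rw [mem_specialOrthogonalGroup_iff, mem_orthogonalGroup_iff]
  constructor
  · ext i j
    fin_cases i <;> fin_cases j <;>
      simp [Matrix.mul_apply, Fin.sum_univ_three, cross_apply]
    · linear_combination ht
    · ring
    · linear_combination t * s * hvw
    · ring
    · linear_combination key'
    · ring
    · linear_combination t * s * hvw
    · ring
    · linear_combination hs
  · simp [det_fin_three, cross_apply]
    linear_combination key'

/-- Gram-Schmidt from the last row upwards: `v` is the last row and `w`, the cross product of the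
last two rows, is orthogonal to both. In the resulting frame `M` is upper triangular with positive
diagonal, and `c` is its last diagonal entry. -/
lemma exists_iwasawa_matrix {M : Matrix (Fin 3) (Fin 3) ℝ} (hM : 0 < M.det) :
    ∃ (c x₁ x₂ x₃ y₁ y₂ : ℝ) (k : K), 0 < c ∧ 0 < y₁ ∧ 0 < y₂ ∧
      M = c • (matU x₁ x₂ x₃ * matY y₁ y₂ * k.1) := by
  set v : Fin 3 → ℝ := M 2 with hv
  set w : Fin 3 → ℝ := M 1 ⨯₃ M 2 with hw
  have hdet : M 0 ⬝ᵥ w = M.det := by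
    rw [det_fin_three, hw, cross_apply]; simp [dotProduct, Fin.sum_univ_three]; ring
  have hw0 : 0 < w ⬝ᵥ w := by
    refine lt_of_le_of_ne (Finset.sum_nonneg fun i _ => mul_self_nonneg _) fun h => ?_
    rw [dotProduct_self_eq_zero.mp h.symm, dotProduct_zero] at hdet
    exact hM.ne hdet
  have hv0 : 0 < v ⬝ᵥ v := by
    refine lt_of_le_of_ne (Finset.sum_nonneg fun i _ => mul_self_nonneg _) fun h => ?_
    have : w = 0 := by rw [hw, ← hv, dotProduct_self_eq_zero.mp h.symm, map_zero]
    rw [this, dotProduct_zero] at hdet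
    exact hM.ne hdet
  have hvw : w ⬝ᵥ v = 0 := by
    simp [hw, hv, cross_apply, dotProduct, Fin.sum_univ_three]; ring
  have h1w : M 1 ⬝ᵥ w = 0 := by
    simp [hw, cross_apply, dotProduct, Fin.sum_univ_three]; ring
  set s := (√(v ⬝ᵥ v))⁻¹ with hs
  set t := (√(w ⬝ᵥ w))⁻¹ with ht
  have s0 : 0 < s := by positivity
  have t0 : 0 < t := by positivity
  have hs2 : s ^ 2 * (v ⬝ᵥ v) = 1 := by
    rw [hs, inv_pow, Real.sq_sqrt hv0.le, inv_mul_cancel₀ hv0.ne']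
  have ht2 : t ^ 2 * (w ⬝ᵥ w) = 1 := by
    rw [ht, inv_pow, Real.sq_sqrt hw0.le, inv_mul_cancel₀ hw0.ne']
  set k : K := ⟨_, frame_mem hvw hs2 ht2⟩ with hk
  set A := M * k.1ᵀ with hA
  have hAk : A * k.1 = M := by rw [hA, Matrix.mul_assoc, K_transpose_mul, mul_one]
  have a20 : A 2 0 = 0 := by
    have : A 2 0 = t * (w ⬝ᵥ v) := by
      simp [hA, hk, Matrix.mul_apply, dotProduct, Fin.sum_univ_three, hv]; ring
    rw [this, hvw, mul_zero]
  have a21 : A 2 1 = 0 := by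
    simp [hA, hk, Matrix.mul_apply, Fin.sum_univ_three, cross_apply, hv]; ring
  have a22 : A 2 2 = s * (v ⬝ᵥ v) := by
    simp [hA, hk, Matrix.mul_apply, dotProduct, Fin.sum_univ_three, hv]; ring
  have a10 : A 1 0 = 0 := by
    have : A 1 0 = t * (M 1 ⬝ᵥ w) := by
      simp [hA, hk, Matrix.mul_apply, dotProduct, Fin.sum_univ_three]; ring
    rw [this, h1w, mul_zero]
  have a11 : A 1 1 = s * t * (w ⬝ᵥ w) := by
    have : A 1 1 = s * t * (M 1 ⬝ᵥ (v ⨯₃ w)) := by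
      simp [hA, hk, Matrix.mul_apply, dotProduct, Fin.sum_univ_three, cross_apply]; ring
    have h2 : M 1 ⬝ᵥ (v ⨯₃ w) = w ⬝ᵥ w := by
      rw [hw, hv]; simp [dotProduct, Fin.sum_univ_three, cross_apply]; ring
    rw [this, h2]
  have a00 : A 0 0 = t * M.det := by
    rw [← hdet]
    simp [hA, hk, Matrix.mul_apply, dotProduct, Fin.sum_univ_three]; ring
  have p0 : 0 < A 0 0 := by rw [a00]; positivity
  have p1 : 0 < A 1 1 := by rw [a11]; positivity
  have p2 : 0 < A 2 2 := by rw [a22]; positivity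
  refine ⟨A 2 2, A 1 2 / A 2 2, A 0 1 / A 1 1, A 0 2 / A 2 2, A 1 1 / A 2 2, A 0 0 / A 1 1, k,
    p2, by positivity, by positivity, ?_⟩
  rw [← Matrix.smul_mul]
  nth_rewrite 1 [← hAk]
  congr 1
  rw [matU_mul_matY]
  ext i j
  fin_cases i <;> fin_cases j <;> simp [a20, a21, a10] <;> field_simp

lemma exists_iwasawa (g : G) : ∃ c : Iwasawa,
    0 < c.y₁ ∧ 0 < c.y₂ ∧ pt c.x₁ c.x₂ c.x₃ c.y₁ c.y₂ * ofK c.k = g := by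
  obtain ⟨M, hM, rfl⟩ := exists_cls g
  obtain ⟨N, hN, hMN⟩ : ∃ N : Matrix (Fin 3) (Fin 3) ℝ, 0 < N.det ∧ cls N = cls M := by
    rcases lt_or_gt_of_ne hM with h | h
    -- In odd dimension the scalar `-1` changes the sign of the determinant without changing the
    -- class.
    · refine ⟨(-1 : ℝ) • M, ?_, cls_smul (by norm_num)⟩
      rw [det_smul]; norm_num; exact h
    · exact ⟨M, h, rfl⟩
  obtain ⟨c, x₁, x₂, x₃, y₁, y₂, k, hc, h1, h2, rfl⟩ := exists_iwasawa_matrix hN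
  refine ⟨⟨x₁, x₂, x₃, y₁, y₂, k⟩, h1, h2, ?_⟩
  rw [← hMN, cls_smul hc.ne', cls_mul (det_pt h1 h2) (K_det_ne k)]
  rfl

lemma iwasawa_spec (g : G) : 0 < (iwasawa g).y₁ ∧ 0 < (iwasawa g).y₂ ∧
    pt (iwasawa g).x₁ (iwasawa g).x₂ (iwasawa g).x₃ (iwasawa g).y₁ (iwasawa g).y₂ *
      ofK (iwasawa g).k = g :=
  Classical.epsilon_spec (exists_iwasawa g)

/-! ### Projections -/

lemma integral_expansion {d : ℕ} (b : ℤ → ℤ → ℂ) {n m : ℤ} (hn : |n| ≤ d) (hm : |m| ≤ d) :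
    (2 * d + 1 : ℂ) * ∫ k : K, (∑ n' ∈ Finset.Icc (-(d : ℤ)) d, ∑ m' ∈ Finset.Icc (-(d : ℤ)) d,
      b n' m' * wignerD d n' m' k) * starRingEnd ℂ (wignerD d n m k) ∂haarK = b n m := by
  have hint : ∀ n' m', Integrable (fun k : K => b n' m' * wignerD d n' m' k *
      starRingEnd ℂ (wignerD d n m k)) haarK := fun n' m' => integrable_of_continuous
    ((continuous_const.mul (continuous_wignerD _ _ _)).mul (continuous_conj_wignerD _ _ _))
  simp only [Finset.sum_mul]
  rw [integral_finsetSum _ fun n' _ => integrable_finsetSum _ fun m' _ => hint n' m']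
  simp only [integral_finsetSum _ fun m' _ => hint _ m']
  simp only [mul_assoc, integral_const_mul, Finset.mul_sum]
  have h1 : ∀ n' ∈ Finset.Icc (-(d : ℤ)) d, ∀ m' ∈ Finset.Icc (-(d : ℤ)) d,
      (2 * d + 1 : ℂ) * (b n' m' * ∫ k : K, wignerD d n' m' k *
        starRingEnd ℂ (wignerD d n m k) ∂haarK) = if n' = n then if m' = m then b n m else 0 else 0 := by
    intro n' _ m' hm'
    rw [mul_left_comm, integral_wignerD_mul_conj d (abs_le.mpr (Finset.mem_Icc.mp hm')) hn]
    by_cases e1 : n' = n <;> by_cases e2 : m' = m <;> simp [e1, e2]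
  rw [Finset.sum_congr rfl fun n' hn' => Finset.sum_congr rfl (h1 n' hn')]
  have hn' : n ∈ Finset.Icc (-(d : ℤ)) d := Finset.mem_Icc.mpr (abs_le.mp hn)
  have hm' : m ∈ Finset.Icc (-(d : ℤ)) d := Finset.mem_Icc.mpr (abs_le.mp hm)
  simp [hn', hm']

variable {d e : ℕ} {a : ℤ} {F : G → Idx d → ℂ}

lemma integral_entry (hF : F ∈ vectorType d) {n m : ℤ} (hm : |m| ≤ d) (g : G) :
    (2 * d + 1 : ℂ) * ∫ k : K, entry F m (g * ofK k) * starRingEnd ℂ (wignerD d n m k) ∂haarK =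
      entry F n g := by
  by_cases hn : |n| ≤ d
  · have hm' : m ∈ Finset.Icc (-(d : ℤ)) d := Finset.mem_Icc.mpr (abs_le.mp hm)
    refine Eq.trans ?_ ((integral_expansion (d := d)
      (fun n' m' => if m' = m then entry F n' g else 0) hn hm).trans (if_pos rfl))
    simp [entry_mul_ofK hF, hm']
  · rw [entry_of_lt F (not_le.mp hn)]
    simp [wignerD_of_lt_left (not_le.mp hn)]

/-- Since `D(k⁻¹)` is the conjugate transpose of `D(k)`, the scalar coefficients are the entries of
the vector projection. -/
lemma colCoeff_eq_projVec {f : G → ℂ} {m : ℤ} :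
    colCoeff d f m = fun x₁ x₂ x₃ y₁ y₂ => entry (projVec d 0 f) m (pt x₁ x₂ x₃ y₁ y₂) := by
  funext x₁ x₂ x₃ y₁ y₂
  rw [entry]
  split_ifs with h
  · simp only [projVec, wignerD_inv]; rfl
  · rw [Finset.mem_Icc, ← abs_le, not_le] at h
    simp [colCoeff, wignerD_of_lt_left h]

lemma projVec_entry (hF : F ∈ vectorType d) {m : ℤ} (hm : |m| ≤ d) :
    projVec d m (entry F m) = F := by
  funext g n
  simp only [projVec, wignerD_inv]
  rw [integral_entry hF hm, entry_coe]

/-- `Ytilde` is defined by prescribing values on `U(ℝ) Y⁺` and extending by the central column of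
`D^e`. The component `0` of `Wop` has the same values and extends by the same rule. -/
lemma Ytilde_eq_Wop {f : G → ℂ} (he : (e : ℤ) = d + a) (ha : |a| ≤ 2)
    (hf : projVec d 0 f ∈ vectorType d) : Ytilde d e f = Wop d a (projVec d 0 f) 0 := by
  funext g
  obtain ⟨h1, h2, h3⟩ := iwasawa_spec g
  rw [← congrArg (Wop d a (projVec d 0 f) 0) h3, Wop_mul_ofK he ha hf, Ytilde]
  refine Finset.sum_congr rfl fun M _ => ?_
  rw [Wop_pt he ha hf h1 h2, mul_comm]
  have : (e : ℤ) - d = a := by omega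
  simp only [this, colCoeff_eq_projVec]

/-- On functions of a given `K`-type, projecting the central entry recovers the whole vector. This
is applied once to `F` and once to its image. -/
lemma Y_eq_Wvec (he : (e : ℤ) = d + a) (ha : |a| ≤ 2) (hF : F ∈ vectorType d) :
    Y d e F = Wvec d e a F := by
  have h0 : projVec d 0 (entry F 0) = F := projVec_entry hF (by simp)
  rw [Y, Ytilde_eq_Wop he ha (by rwa [h0]), h0, ← entry_Wvec he,
    projVec_entry (Wvec_mem he ha hF) (by simp)]

/-! ### Scalar functions -/

/-- The definition expands `f` only from base points in `U(ℝ) Y⁺`; multiplicativity of `D^d`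
transports the expansion to an arbitrary base point. -/
lemma scalarType_expansion {f : G → ℂ} (hf : f ∈ scalarType d) (g : G) : ∃ b : ℤ → ℤ → ℂ, ∀ k : K,
    f (g * ofK k) = ∑ n ∈ Finset.Icc (-(d : ℤ)) d, ∑ m ∈ Finset.Icc (-(d : ℤ)) d,
      b n m * wignerD d n m k := by
  obtain ⟨-, c, hc⟩ := hf
  obtain ⟨h1, h2, h3⟩ := iwasawa_spec g
  set p := pt (iwasawa g).x₁ (iwasawa g).x₂ (iwasawa g).x₃ (iwasawa g).y₁ (iwasawa g).y₂
  set k₀ := (iwasawa g).k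
  obtain ⟨c', hc'⟩ : ∃ c' : ℤ → ℤ → ℂ, ∀ m' m : Idx d, c' m' m = c m' m p :=
    ⟨fun m' m => if h : m' ∈ Finset.Icc (-(d : ℤ)) d ∧ m ∈ Finset.Icc (-(d : ℤ)) d then
      c ⟨m', h.1⟩ ⟨m, h.2⟩ p else 0, fun m' m => dif_pos ⟨m'.2, m.2⟩⟩
  refine ⟨fun n m => ∑ m' ∈ Finset.Icc (-(d : ℤ)) d, c' m' m * wignerD d m' n k₀, fun k => ?_⟩
  have h4 : f (g * ofK k) = ∑ m' ∈ Finset.Icc (-(d : ℤ)) d, ∑ m ∈ Finset.Icc (-(d : ℤ)) d,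
      c' m' m * wignerD d m' m (k₀ * k : K) := by
    rw [← h3, mul_assoc, ← ofK_mul, ← sum_Idx]
    simp only [← sum_Idx, hc']
    exact hc _ _ _ _ _ h1 h2 _
  rw [h4]
  simp only [wignerD_mul, Finset.sum_mul, Finset.mul_sum]
  rw [Finset.sum_comm]
  conv_rhs => rw [Finset.sum_comm]
  refine Finset.sum_congr rfl fun m _ => ?_
  rw [Finset.sum_comm]
  exact Finset.sum_congr rfl fun n _ => Finset.sum_congr rfl fun m' _ => by ring

lemma projVec_eq_of_expansion {f : G → ℂ} {g : G} {b : ℤ → ℤ → ℂ}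
    (hb : ∀ k : K, f (g * ofK k) = ∑ n ∈ Finset.Icc (-(d : ℤ)) d,
      ∑ m ∈ Finset.Icc (-(d : ℤ)) d, b n m * wignerD d n m k) {m : ℤ} (hm : |m| ≤ d) (n : Idx d) :
    projVec d m f g n = b n m := by
  simp only [projVec, wignerD_inv, hb]
  exact integral_expansion b (abs_le.mpr (Finset.mem_Icc.mp n.2)) hm

lemma entry_projVec_of_expansion {f : G → ℂ} {g : G} {b : ℤ → ℤ → ℂ}
    (hb : ∀ k : K, f (g * ofK k) = ∑ n ∈ Finset.Icc (-(d : ℤ)) d,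
      ∑ m ∈ Finset.Icc (-(d : ℤ)) d, b n m * wignerD d n m k) {m n : ℤ} (hm : |m| ≤ d)
    (hn : n ∈ Finset.Icc (-(d : ℤ)) d) : entry (projVec d m f) n g = b n m := by
  rw [entry, dif_pos hn]; exact projVec_eq_of_expansion hb hm ⟨n, hn⟩

/-- Coordinates on the span of the entries of `D^d` are linear combinations of point evaluations. -/
lemma exists_evaluation (d : ℕ) {n m : ℤ} (hn : n ∈ Finset.Icc (-(d : ℤ)) d)
    (hm : m ∈ Finset.Icc (-(d : ℤ)) d) : ∃ c : K →₀ ℂ, ∀ b : ℤ → ℤ → ℂ,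
      b n m = c.sum fun k z => z * ∑ n' ∈ Finset.Icc (-(d : ℤ)) d,
        ∑ m' ∈ Finset.Icc (-(d : ℤ)) d, b n' m' * wignerD d n' m' k := by
  set V : K → (Idx d × Idx d → ℂ) := fun k p => wignerD d p.1 p.2 k with hV
  have hexp : ∀ (b : ℤ → ℤ → ℂ) (k : K), ∑ n' ∈ Finset.Icc (-(d : ℤ)) d,
      ∑ m' ∈ Finset.Icc (-(d : ℤ)) d, b n' m' * wignerD d n' m' k =
      ∑ p : Idx d × Idx d, b p.1 p.2 * V k p := by
    intro b k
    rw [Fintype.sum_prod_type, ← sum_Idx]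
    simp only [← sum_Idx]; rfl
  -- Otherwise a nonzero functional would annihilate all evaluation vectors, that is, a nontrivial
  -- combination of matrix entries would vanish on `K`, against orthogonality.
  have htop : Submodule.span ℂ (Set.range V) = ⊤ := by
    by_contra hne
    obtain ⟨l, hl, hker⟩ := Submodule.exists_le_ker_of_lt_top _ (lt_top_iff_ne_top.mpr hne)
    refine hl (LinearMap.ext fun x => ?_)
    have h0 : ∀ p : Idx d × Idx d, l (fun j => if p = j then 1 else 0) = 0 := by
      set b : ℤ → ℤ → ℂ := fun n' m' => if h : n' ∈ Finset.Icc (-(d : ℤ)) d ∧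
        m' ∈ Finset.Icc (-(d : ℤ)) d then
          l (fun j => if ((⟨n', h.1⟩, ⟨m', h.2⟩) : Idx d × Idx d) = j then 1 else 0) else 0 with hb
      have hbp : ∀ p : Idx d × Idx d, b p.1 p.2 = l (fun j => if p = j then 1 else 0) := fun p =>
        dif_pos ⟨p.1.2, p.2.2⟩
      intro p
      rw [← hbp, ← integral_expansion b (abs_le.mpr (Finset.mem_Icc.mp p.1.2))
        (abs_le.mpr (Finset.mem_Icc.mp p.2.2))]
      have : ∀ k : K, ∑ n' ∈ Finset.Icc (-(d : ℤ)) d,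
          ∑ m' ∈ Finset.Icc (-(d : ℤ)) d, b n' m' * wignerD d n' m' k = 0 := by
        intro k
        have h1 : l (V k) = 0 := hker (Submodule.subset_span ⟨k, rfl⟩)
        rw [LinearMap.pi_apply_eq_sum_univ] at h1
        rw [hexp, ← h1]
        exact Finset.sum_congr rfl fun q _ => by rw [hbp, smul_eq_mul, mul_comm]
      simp [this]
    rw [LinearMap.pi_apply_eq_sum_univ]
    simp [h0]
  have hmem : (fun j => if ((⟨n, hn⟩, ⟨m, hm⟩) : Idx d × Idx d) = j then (1 : ℂ) else 0) ∈
      Submodule.span ℂ (Set.range V) := htop ▸ Submodule.mem_top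
  obtain ⟨c, hc⟩ := Finsupp.mem_span_range_iff_exists_finsupp.mp hmem
  refine ⟨c, fun b => ?_⟩
  have h1 : b n m = ∑ p : Idx d × Idx d, b p.1 p.2 *
      (if ((⟨n, hn⟩, ⟨m, hm⟩) : Idx d × Idx d) = p then (1 : ℂ) else 0) := by simp
  rw [h1]
  simp only [hexp, ← fun p => congrFun hc p, Finsupp.sum, Finset.sum_apply, Finset.mul_sum]
  rw [Finset.sum_comm]
  refine Finset.sum_congr rfl fun k _ => Finset.sum_congr rfl fun p _ => ?_
  simp only [Pi.smul_apply, smul_eq_mul]; ring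

/-- Each component is a finite combination of right translates of `f` by `exists_evaluation`, so its
smoothness needs no differentiation under the integral. -/
lemma projVec_mem {f : G → ℂ} (hf : f ∈ scalarType d) {m : ℤ} (hm : |m| ≤ d) :
    projVec d m f ∈ vectorType d := by
  refine ⟨fun n => ?_, fun g k n => ?_⟩
  · obtain ⟨c, hc⟩ := exists_evaluation d n.2 (Finset.mem_Icc.mpr (abs_le.mp hm))
    have : (fun g => projVec d m f g n) = fun g => ∑ k ∈ c.support, c k * f (g * ofK k) := by
      funext g
      obtain ⟨b, hb⟩ := scalarType_expansion hf g
      rw [projVec_eq_of_expansion hb hm, hc b, Finsupp.sum]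
      simp only [hb]
    rw [this]
    exact IsSmooth.sum _ fun k _ => (hf.1.mul_right _).const_mul _
  · obtain ⟨b, hb⟩ := scalarType_expansion hf g
    have h1 : ∀ l : K, f (g * ofK k * ofK l) = ∑ n ∈ Finset.Icc (-(d : ℤ)) d,
        ∑ m ∈ Finset.Icc (-(d : ℤ)) d,
          (∑ m' ∈ Finset.Icc (-(d : ℤ)) d, b m' m * wignerD d m' n k) * wignerD d n m l := by
      intro l
      rw [mul_assoc, ← ofK_mul, hb]
      simp only [wignerD_mul, Finset.sum_mul, Finset.mul_sum]
      rw [Finset.sum_comm]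
      conv_rhs => rw [Finset.sum_comm]
      refine Finset.sum_congr rfl fun m _ => ?_
      rw [Finset.sum_comm]
      exact Finset.sum_congr rfl fun n _ => Finset.sum_congr rfl fun m' _ => by ring
    rw [projVec_eq_of_expansion h1 hm, ← sum_Idx]
    exact Finset.sum_congr rfl fun m' _ => by rw [projVec_eq_of_expansion hb hm]

lemma eq_sum_projVec {f : G → ℂ} (hf : f ∈ scalarType d) (g : G) :
    f g = ∑ m ∈ Finset.Icc (-(d : ℤ)) d, entry (projVec d m f) m g := by
  obtain ⟨b, hb⟩ := scalarType_expansion hf g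
  have h1 := hb 1
  rw [ofK_one, mul_one] at h1
  rw [h1, Finset.sum_comm]
  refine Finset.sum_congr rfl fun m hm => ?_
  have hm' : |m| ≤ d := abs_le.mpr (Finset.mem_Icc.mp hm)
  rw [entry_projVec_of_expansion hb hm' hm]
  simp only [wignerD_one]
  simp [hm', hm]

/-- The projection of `X_j f` onto the `j`-th column of `D^e`. -/
lemma projCol_lie {f : G → ℂ} (he : (e : ℤ) = d + a) (ha : |a| ≤ 2) (hf : f ∈ scalarType d) {j : ℤ}
    (hj : |j| ≤ e) (g : G) :
    projCol e j (lie (matX j) f) g = cg d 2 a 0 j * Wop d a (projVec d 0 f) j g := by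
  have hexp : ∀ k : K, lie (matX j) f (g * ofK k) = ∑ m ∈ Finset.Icc (-(d : ℤ)) d,
      ∑ i ∈ Finset.Icc (-2 : ℤ) 2, ∑ n ∈ Finset.Icc (-(d : ℤ)) d,
        lie (matX i) (entry (projVec d m f) n) g * (wignerD 2 i j k * wignerD d n m k) := by
    intro k
    have h1 : f = fun x => ∑ m ∈ Finset.Icc (-(d : ℤ)) d, (1 : ℂ) * entry (projVec d m f) m x := by
      funext x; simp only [one_mul]; exact eq_sum_projVec hf x
    have hmem : ∀ m ∈ Finset.Icc (-(d : ℤ)) d, projVec d m f ∈ vectorType d := fun m hm =>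
      projVec_mem hf (abs_le.mpr (Finset.mem_Icc.mp hm))
    conv_lhs => rw [h1]
    rw [lie_sum_fun _ fun m hm => isSmooth_entry (hmem m hm) m]
    refine Finset.sum_congr rfl fun m hm => ?_
    rw [one_mul, lie_matX_entry_mul_ofK (hmem m hm)]
    exact Finset.sum_congr rfl fun i _ => Finset.sum_congr rfl fun n _ => by ring
  have hint : ∀ c : ℂ, ∀ i n m, Integrable (fun k : K => c * (wignerD 2 i j k * wignerD d n m k) *
      starRingEnd ℂ (wignerD e j j k)) haarK := fun c i n m => integrable_of_continuous
    ((continuous_const.mul ((continuous_wignerD _ _ _).mul (continuous_wignerD _ _ _))).mul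
      (continuous_conj_wignerD _ _ _))
  rw [projCol]
  simp only [hexp, Finset.sum_mul]
  rw [integral_finsetSum _ fun m _ => integrable_finsetSum _ fun i _ =>
    integrable_finsetSum _ fun n _ => hint _ i n m]
  simp only [integral_finsetSum _ fun i _ => integrable_finsetSum _ fun n _ => hint _ i n _]
  simp only [integral_finsetSum _ fun n _ => hint _ _ n _]
  simp only [mul_assoc (lie _ _ _), integral_const_mul, Finset.mul_sum]
  -- The triple integral forces `j + m = j`, so only the central column of `f` survives, and `i + n
  -- = j`, which selects the terms of the `j`-th component of `Wop`.
  have h2 : ∀ m ∈ Finset.Icc (-(d : ℤ)) d, ∀ i ∈ Finset.Icc (-2 : ℤ) 2,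
      ∀ n ∈ Finset.Icc (-(d : ℤ)) d,
      (2 * e + 1 : ℂ) * (lie (matX i) (entry (projVec d m f) n) g *
        ∫ k : K, wignerD 2 i j k * wignerD d n m k * starRingEnd ℂ (wignerD e j j k) ∂haarK) =
      if m = 0 then (if n = j - i then cg d 2 a n i * cg d 2 a 0 j *
        lie (matX i) (entry (projVec d 0 f) n) g else 0) else 0 := by
    intro m _ i hi n hn
    rw [mul_left_comm, integral_triple he ha (abs_le.mpr (Finset.mem_Icc.mp hi))
      (abs_le.mpr (Finset.mem_Icc.mp hn)) hj]
    by_cases hm0 : m = 0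
    · subst hm0
      have : i + n = j ∧ j + 0 = j ↔ n = j - i := by omega
      simp only [this, if_true]
      split_ifs <;> ring
    · rw [if_neg (by omega), if_neg hm0, mul_zero]
  rw [Finset.sum_congr rfl fun m hm => Finset.sum_congr rfl fun i hi =>
    Finset.sum_congr rfl (h2 m hm i hi)]
  have h00 : (0 : ℤ) ∈ Finset.Icc (-(d : ℤ)) d := by simp
  rw [Finset.sum_eq_single_of_mem 0 h00 fun m _ hm => by simp [hm]]
  simp only [if_true, Wop, Finset.mul_sum, Finset.sum_ite_eq']
  refine Finset.sum_congr rfl fun i _ => ?_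
  split_ifs with h
  · ring
  · rw [Finset.mem_Icc, ← abs_le] at h
    rw [cg_eq_zero he fun h' => h h'.2.1]; simp

lemma lie_matK1_Wop (he : (e : ℤ) = d + a) (ha : |a| ≤ 2) (hF : F ∈ vectorType d) (M : ℤ) (g : G) :
    lie (matK1 1) (Wop d a F M) g = cp e M * Wop d a F (M + 1) g := by
  have := lie_matK1_entry (Wvec_mem he ha hF) M g
  rwa [entry_Wvec he, entry_Wvec he] at this

lemma lie_matK1_neg_Wop (he : (e : ℤ) = d + a) (ha : |a| ≤ 2) (hF : F ∈ vectorType d) (M : ℤ)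
    (g : G) : lie (matK1 (-1)) (Wop d a F M) g = cm e M * Wop d a F (M - 1) g := by
  have := lie_matK1_neg_entry (Wvec_mem he ha hF) M g
  rwa [entry_Wvec he, entry_Wvec he] at this

lemma lie_const_mul {f : G → ℂ} (hf : IsSmooth f) (c : ℂ) (X : Matrix (Fin 3) (Fin 3) ℂ) (g : G) :
    lie X (fun x => c * f x) g = c * lie X f g := by
  have := lie_sum_fun {()} (f := fun _ => f) (fun _ _ => hf) (fun _ => c) X g
  simpa using this

/-- Each projection is a multiple of the `j`-th component of `Wop`. That component is reached from
the component `0`, which is `Ytilde`, by repeated use of `K_{±1}`; the lower bounds on `e` make the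
ladder coefficients invertible. -/
theorem scalar_part (he : (e : ℤ) = d + a) (ha : |a| ≤ 2) {f : G → ℂ} (hf : f ∈ scalarType d) :
      Ytilde d e f ∈ scalarType e ∧
      (projCol e 0 (lie matX0 f) = fun g => (cg d 2 a 0 0 : ℂ) * Ytilde d e f g) ∧
      (∀ ε : ℤ, ε = 1 ∨ ε = -1 → 1 ≤ e → projCol e ε (lie (matX1 ε) f) = fun g =>
          ((1 / √((e : ℝ) * (e + 1)) * cg d 2 a 0 ε : ℝ) : ℂ) *
            lie (matK1 ε) (Ytilde d e f) g) ∧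
      (∀ ε : ℤ, ε = 1 ∨ ε = -1 → 2 ≤ e →
        projCol e (2 * ε) (lie (matX2 ε) f) = fun g =>
          ((1 / (√((e : ℝ) * (e + 1)) * √((e : ℝ) * (e + 1) - 2)) *
              cg d 2 a 0 (2 * ε) : ℝ) : ℂ) *
            lie (matK1 ε) (lie (matK1 ε) (Ytilde d e f)) g) := by
  have hF := projVec_mem hf (m := 0) (by simp)
  have hY := Ytilde_eq_Wop he ha hF
  set F := projVec d 0 f with hFdef
  have cp0 : cp e 0 = (√((e : ℝ) * (e + 1)) : ℝ) := by simp [cp]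
  have cm0 : cm e 0 = (√((e : ℝ) * (e + 1)) : ℝ) := by simp [cm]
  have cp1 : cp e 1 = (√((e : ℝ) * (e + 1) - 2) : ℝ) := by simp [cp]; norm_num
  have cm1 : cm e (-1) = (√((e : ℝ) * (e + 1) - 2) : ℝ) := by simp [cm]; norm_num
  have key : ∀ (r c : ℝ) (w : ℂ), (r : ℂ) ≠ 0 → (c : ℂ) * w = ((1 / r * c : ℝ) : ℂ) * (r * w) := by
    intro r c w hr; push_cast; field_simp
  have key' : ∀ (r s c : ℝ) (w : ℂ), (r : ℂ) ≠ 0 → (s : ℂ) ≠ 0 →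
      (c : ℂ) * w = ((1 / (r * s) * c : ℝ) : ℂ) * (r * (s * w)) := by
    intro r s c w hr hs; push_cast; field_simp
  refine ⟨⟨hY ▸ isSmooth_Wop hF 0, fun m' m x => if (m : ℤ) = 0 then Wop d a F m' x else 0,
    fun x₁ x₂ x₃ y₁ y₂ _ _ k => ?_⟩, ?_, ?_, ?_⟩
  · rw [hY, Wop_mul_ofK he ha hF, ← sum_Idx]
    refine Finset.sum_congr rfl fun m' _ => ?_
    rw [sum_Idx fun m => (if m = 0 then Wop d a F m' _ else 0) * wignerD e m' m k]
    simp
  · funext g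
    rw [hY]; exact projCol_lie he ha hf (j := 0) (by simp) g
  · intro ε hε h1
    have hs : ((√((e : ℝ) * (e + 1)) : ℝ) : ℂ) ≠ 0 := by
      exact Complex.ofReal_ne_zero.mpr (Real.sqrt_pos.mpr (by positivity)).ne'
    funext g
    rcases hε with rfl | rfl
    · rw [hY, lie_matK1_Wop he ha hF, cp0, zero_add]
      refine (projCol_lie he ha hf (j := 1) (by simpa using h1) g).trans ?_
      exact key _ _ _ hs
    · rw [hY, lie_matK1_neg_Wop he ha hF, cm0, zero_sub]
      refine (projCol_lie he ha hf (j := -1) (by simpa using h1) g).trans ?_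
      exact key _ _ _ hs
  · intro ε hε h1
    have h1' : (2 : ℝ) ≤ e := by exact_mod_cast h1
    have hs : ((√((e : ℝ) * (e + 1)) : ℝ) : ℂ) ≠ 0 := by
      exact Complex.ofReal_ne_zero.mpr (Real.sqrt_pos.mpr (by positivity)).ne'
    have hs' : ((√((e : ℝ) * (e + 1) - 2) : ℝ) : ℂ) ≠ 0 := by
      exact Complex.ofReal_ne_zero.mpr (Real.sqrt_pos.mpr (by nlinarith)).ne'
    funext g
    rcases hε with rfl | rfl
    · have h2 : lie (matK1 1) (Ytilde d e f) = fun x => cp e 0 * Wop d a F (0 + 1) x := by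
        funext x; rw [hY, lie_matK1_Wop he ha hF]
      rw [h2, lie_const_mul (isSmooth_Wop hF _), lie_matK1_Wop he ha hF, zero_add, cp0, cp1,
        one_add_one_eq_two]
      have h3 := projCol_lie he ha hf (j := 2) (by simpa using h1) g
      rw [show matX 2 = matX2 1 by simp [matX]] at h3
      rw [mul_one (2 : ℤ), h3]
      exact key' _ _ _ _ hs hs'
    · have h2 : lie (matK1 (-1)) (Ytilde d e f) = fun x => cm e 0 * Wop d a F (0 - 1) x := by
        funext x; rw [hY, lie_matK1_neg_Wop he ha hF]
      rw [h2, lie_const_mul (isSmooth_Wop hF _), lie_matK1_neg_Wop he ha hF, zero_sub, cm0, cm1,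
        show (-1 - 1 : ℤ) = -2 by norm_num]
      have h3 := projCol_lie he ha hf (j := -2) (by simpa using h1) g
      rw [show matX (-2) = matX2 (-1) by simp [matX]] at h3
      rw [show (2 * -1 : ℤ) = -2 by norm_num, h3]
      exact key' _ _ _ _ hs hs'

/-! ### Parametric integrals over the unit cube -/

lemma continuous_unitIntegral {α : Type*} [TopologicalSpace α] {H : α → ℝ → ℂ}
    (hH : Continuous fun p : α × ℝ => H p.1 p.2) : Continuous fun a => ∫ x in (0 : ℝ)..1, H a x :=
  intervalIntegral.continuous_parametric_intervalIntegral_of_continuous' hH _ _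

lemma hasDerivAt_unitIntegral {H H' : ℝ → ℝ → ℂ} (hH : Continuous fun p : ℝ × ℝ => H p.1 p.2)
    (hH' : Continuous fun p : ℝ × ℝ => H' p.1 p.2)
    (h : ∀ t x, HasDerivAt (fun s => H s x) (H' t x) t) (t : ℝ) :
    HasDerivAt (fun s => ∫ x in (0 : ℝ)..1, H s x) (∫ x in (0 : ℝ)..1, H' t x) t := by
  -- A bound for the derivative on a compact neighbourhood of the parameter serves as the dominating
  -- function.
  have hK : IsCompact (Set.Icc (t - 1) (t + 1) ×ˢ Set.Icc (0 : ℝ) 1) :=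
    isCompact_Icc.prod isCompact_Icc
  obtain ⟨C, hC⟩ := hK.exists_bound_of_continuousOn hH'.continuousOn
  refine (intervalIntegral.hasDerivAt_integral_of_dominated_loc_of_deriv_le (μ := volume)
    (bound := fun _ => C) (s := Set.Icc (t - 1) (t + 1))
    (Icc_mem_nhds (by linarith) (by linarith)) ?_ ?_ ?_ ?_ ?_ ?_).2
  · exact Filter.Eventually.of_forall fun s =>
      (hH.comp (by fun_prop : Continuous fun x : ℝ => (s, x))).aestronglyMeasurable
  · exact (hH.comp (by fun_prop : Continuous fun x : ℝ => (t, x))).intervalIntegrable _ _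
  · exact (hH'.comp (by fun_prop : Continuous fun x : ℝ => (t, x))).aestronglyMeasurable
  · refine Filter.Eventually.of_forall fun x hx s hs => hC (s, x) ⟨hs, ?_⟩
    rw [Set.uIoc_of_le zero_le_one] at hx
    exact ⟨hx.1.le, hx.2⟩
  · exact intervalIntegrable_const
  · exact Filter.Eventually.of_forall fun x _ s _ => h s x

/-- The iterated integral over the unit cube. -/
def cubeIntegral (H : ℝ → ℝ → ℝ → ℂ) : ℂ :=
  ∫ x₁ in (0 : ℝ)..1, ∫ x₂ in (0 : ℝ)..1, ∫ x₃ in (0 : ℝ)..1, H x₁ x₂ x₃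

lemma hasDerivAt_cubeIntegral {H H' : ℝ → ℝ → ℝ → ℝ → ℂ}
    (hH : Continuous fun p : ℝ × ℝ × ℝ × ℝ => H p.1 p.2.1 p.2.2.1 p.2.2.2)
    (hH' : Continuous fun p : ℝ × ℝ × ℝ × ℝ => H' p.1 p.2.1 p.2.2.1 p.2.2.2)
    (h : ∀ t x y z, HasDerivAt (fun s => H s x y z) (H' t x y z) t) (t : ℝ) :
    HasDerivAt (fun s => cubeIntegral (H s)) (cubeIntegral (H' t)) t := by
  have c3 : ∀ {H : ℝ → ℝ → ℝ → ℝ → ℂ},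
      (Continuous fun p : ℝ × ℝ × ℝ × ℝ => H p.1 p.2.1 p.2.2.1 p.2.2.2) →
      Continuous fun p : ℝ × ℝ × ℝ => ∫ z in (0 : ℝ)..1, H p.1 p.2.1 p.2.2 z := fun hH =>
    continuous_unitIntegral (hH.comp (by fun_prop :
      Continuous fun q : (ℝ × ℝ × ℝ) × ℝ => (q.1.1, q.1.2.1, q.1.2.2, q.2)))
  have c2 : ∀ {H : ℝ → ℝ → ℝ → ℂ}, (Continuous fun p : ℝ × ℝ × ℝ => H p.1 p.2.1 p.2.2) →
      Continuous fun p : ℝ × ℝ => ∫ z in (0 : ℝ)..1, H p.1 p.2 z := fun hH =>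
    continuous_unitIntegral (hH.comp (by fun_prop :
      Continuous fun q : (ℝ × ℝ) × ℝ => (q.1.1, q.1.2, q.2)))
  refine hasDerivAt_unitIntegral (H := fun t x => ∫ y in (0 : ℝ)..1, ∫ z in (0 : ℝ)..1, H t x y z)
    (H' := fun t x => ∫ y in (0 : ℝ)..1, ∫ z in (0 : ℝ)..1, H' t x y z)
    (c2 (H := fun t x y => ∫ z in (0 : ℝ)..1, H t x y z) (c3 hH))
    (c2 (H := fun t x y => ∫ z in (0 : ℝ)..1, H' t x y z) (c3 hH')) (fun t x => ?_) t
  refine hasDerivAt_unitIntegral (H := fun t y => ∫ z in (0 : ℝ)..1, H t x y z)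
    (H' := fun t y => ∫ z in (0 : ℝ)..1, H' t x y z)
    ((c3 hH).comp (by fun_prop : Continuous fun q : ℝ × ℝ => (q.1, x, q.2)))
    ((c3 hH').comp (by fun_prop : Continuous fun q : ℝ × ℝ => (q.1, x, q.2))) (fun t y => ?_) t
  exact hasDerivAt_unitIntegral (H := fun t z => H t x y z) (H' := fun t z => H' t x y z)
    (hH.comp (by fun_prop : Continuous fun q : ℝ × ℝ => (q.1, x, y, q.2)))
    (hH'.comp (by fun_prop : Continuous fun q : ℝ × ℝ => (q.1, x, y, q.2))) (fun t z => h t x y z) t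

lemma unitIntegral_sum {ι : Type*} (s : Finset ι) (c : ι → ℂ) {h : ι → ℝ → ℂ}
    (hh : ∀ i ∈ s, Continuous (h i)) :
    ∫ x in (0 : ℝ)..1, ∑ i ∈ s, c i * h i x = ∑ i ∈ s, c i * ∫ x in (0 : ℝ)..1, h i x := by
  rw [intervalIntegral.integral_finsetSum fun i hi =>
    ((hh i hi).intervalIntegrable _ _).const_mul (c i)]
  simp only [intervalIntegral.integral_const_mul]

lemma cubeIntegral_sum {ι : Type*} (s : Finset ι) (c : ι → ℂ) {H : ι → ℝ → ℝ → ℝ → ℂ}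
    (hH : ∀ i ∈ s, Continuous fun p : ℝ × ℝ × ℝ => H i p.1 p.2.1 p.2.2) :
    cubeIntegral (fun x y z => ∑ i ∈ s, c i * H i x y z) = ∑ i ∈ s, c i * cubeIntegral (H i) := by
  have c3 : ∀ i ∈ s, Continuous fun p : ℝ × ℝ => ∫ z in (0 : ℝ)..1, H i p.1 p.2 z := fun i hi =>
    continuous_unitIntegral ((hH i hi).comp (by fun_prop :
      Continuous fun q : (ℝ × ℝ) × ℝ => (q.1.1, q.1.2, q.2)))
  have e3 : ∀ x y, ∫ z in (0 : ℝ)..1, ∑ i ∈ s, c i * H i x y z =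
      ∑ i ∈ s, c i * ∫ z in (0 : ℝ)..1, H i x y z := fun x y =>
    unitIntegral_sum s c fun i hi => (hH i hi).comp (by fun_prop : Continuous fun z : ℝ => (x, y, z))
  have e2 : ∀ x, ∫ y in (0 : ℝ)..1, ∑ i ∈ s, c i * ∫ z in (0 : ℝ)..1, H i x y z =
      ∑ i ∈ s, c i * ∫ y in (0 : ℝ)..1, ∫ z in (0 : ℝ)..1, H i x y z := fun x =>
    unitIntegral_sum s c fun i hi => (c3 i hi).comp (by fun_prop : Continuous fun y : ℝ => (x, y))
  simp only [cubeIntegral, e3, e2]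
  exact unitIntegral_sum s c fun i hi => continuous_unitIntegral (c3 i hi)

/-! ### Translates along one-parameter groups -/

lemma IsSmooth.continuous_comp {α : Type*} [TopologicalSpace α] {f : G → ℂ} (hf : IsSmooth f)
    {γ : α → Matrix (Fin 3) (Fin 3) ℝ} (hγ : ∀ i j, Continuous fun a => γ a i j)
    (hdet : ∀ a, (γ a).det ≠ 0) : Continuous fun a => f (cls (γ a)) :=
  ContinuousOn.comp_continuous hf.continuousOn
    (f := fun a => (Matrix.of.symm (γ a) : Fin 3 → Fin 3 → ℝ))
    (continuous_pi fun i => continuous_pi fun j => hγ i j) hdet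

lemma exp_add_smul (s t : ℝ) (X : Matrix (Fin 3) (Fin 3) ℝ) :
    NormedSpace.exp ((s + t) • X) = NormedSpace.exp (s • X) * NormedSpace.exp (t • X) := by
  rw [add_smul]
  exact Matrix.exp_add_of_commute _ _ ((Commute.refl X).smul_left _ |>.smul_right _)

lemma curveDeriv_exp_at (X : Matrix (Fin 3) (Fin 3) ℝ) (t : ℝ) :
    CurveDeriv (fun s : ℝ => NormedSpace.exp (s • X)) (NormedSpace.exp (t • X) * X) t := by
  intro i j
  have h := (curveDeriv_exp X).mul_left (NormedSpace.exp (t • X)) i j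
  rw [← sub_self t] at h
  refine (h.comp_sub_const t t).congr_of_eventuallyEq (Filter.Eventually.of_forall fun s => ?_)
  simp only [← exp_add_smul, add_sub_cancel]

lemma continuous_exp_smul (X : Matrix (Fin 3) (Fin 3) ℝ) (i j : Fin 3) :
    Continuous fun s : ℝ => NormedSpace.exp (s • X) i j :=
  continuous_iff_continuousAt.mpr fun t => (curveDeriv_exp_at X t i j).continuousAt

lemma hasDerivAt_realLie_at {f : G → ℂ} (hf : IsSmooth f) (X : Matrix (Fin 3) (Fin 3) ℝ) (g : G)
    (t : ℝ) : HasDerivAt (fun s : ℝ => f (g * cls (NormedSpace.exp (s • X))))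
      (realLie X f (g * cls (NormedSpace.exp (t • X)))) t := by
  have h := hasDerivAt_realLie hf X (g * cls (NormedSpace.exp (t • X)))
  rw [← sub_self t] at h
  refine (h.comp_sub_const t t).congr_of_eventuallyEq (Filter.Eventually.of_forall fun s => ?_)
  simp only []
  rw [mul_assoc, ← cls_mul (det_exp_ne _) (det_exp_ne _), ← exp_add_smul, add_sub_cancel]

lemma det_matU (x₁ x₂ x₃ : ℝ) : (matU x₁ x₂ x₃).det = 1 := by simp [matU, det_fin_three]

lemma det_matU_ne (x₁ x₂ x₃ : ℝ) : (matU x₁ x₂ x₃).det ≠ 0 := by rw [det_matU]; exact one_ne_zero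

lemma continuous_matU_entry (i j : Fin 3) :
    Continuous fun p : ℝ × ℝ × ℝ => matU p.1 p.2.1 p.2.2 i j := by
  fin_cases i <;> fin_cases j <;> simp [matU] <;> fun_prop

lemma continuous_unipotent {f : G → ℂ} (hf : IsSmooth f) (g : G) :
    Continuous fun p : ℝ × ℝ × ℝ => f (cls (matU p.1 p.2.1 p.2.2) * g) := by
  obtain ⟨M, hM, rfl⟩ := exists_cls g
  simp only [← cls_mul (det_matU_ne _ _ _) hM]
  refine hf.continuous_comp (fun i j => ?_) fun p => ?_
  · simp only [Matrix.mul_apply]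
    exact continuous_finsetSum _ fun k _ => (continuous_matU_entry i k).mul continuous_const
  · rw [det_mul]; exact mul_ne_zero (det_matU_ne _ _ _) hM

/-! ### Scalar cusp forms -/

/-- The character `ψ_n` of `U(ℝ)`. -/
def chi (n₁ n₂ : ℤ) (x₁ x₂ : ℝ) : ℂ :=
  Complex.exp (2 * Real.pi * Complex.I * (n₁ * x₁ + n₂ * x₂))

lemma continuous_chi (n₁ n₂ : ℤ) : Continuous fun p : ℝ × ℝ × ℝ => chi n₁ n₂ p.1 p.2.1 := by
  unfold chi; fun_prop

/-- Smooth scalar cusp forms of uniform moderate growth with exponent `r`. -/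
structure CuspScalar (r : ℝ) (f : G → ℂ) : Prop where
  smooth : IsSmooth f
  invariant : ∀ γ ∈ Γ, ∀ g, f (γ * g) = f g
  cuspidal : ∀ n₁ n₂ : ℤ, n₁ * n₂ = 0 → ∀ g : G,
    cubeIntegral (fun x₁ x₂ x₃ => f (cls (matU x₁ x₂ x₃) * g) * chi n₁ n₂ x₁ x₂) = 0
  growth : ∀ Xs : List (Matrix (Fin 3) (Fin 3) ℂ), (∀ X ∈ Xs, X.trace = 0) →
    ∃ C : ℝ, ∀ M : Matrix.SpecialLinearGroup (Fin 3) ℝ,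
      ‖Xs.foldr lie f (cls (M : Matrix (Fin 3) (Fin 3) ℝ))‖ ≤
        C * √(∑ i, ∑ j, (M : Matrix (Fin 3) (Fin 3) ℝ) i j ^ 2) ^ r

lemma isSmooth_foldr_lie {f : G → ℂ} (hf : IsSmooth f) (Xs : List (Matrix (Fin 3) (Fin 3) ℂ)) :
    IsSmooth (Xs.foldr lie f) := by
  induction Xs with
  | nil => exact hf
  | cons X Xs ih => exact ih.lie X

lemma foldr_lie_sum {ι : Type*} (s : Finset ι) (c : ι → ℂ) {f : ι → G → ℂ}
    (hf : ∀ i ∈ s, IsSmooth (f i)) (Xs : List (Matrix (Fin 3) (Fin 3) ℂ)) :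
    Xs.foldr lie (fun g => ∑ i ∈ s, c i * f i g) = fun g => ∑ i ∈ s, c i * Xs.foldr lie (f i) g := by
  induction Xs with
  | nil => rfl
  | cons X Xs ih =>
    funext g
    simp only [List.foldr_cons, ih]
    exact lie_sum_fun s (fun i hi => isSmooth_foldr_lie (hf i hi) Xs) c X g

lemma CuspScalar.sum {r : ℝ} {ι : Type*} (s : Finset ι) (c : ι → ℂ) {f : ι → G → ℂ}
    (hf : ∀ i ∈ s, CuspScalar r (f i)) : CuspScalar r fun g => ∑ i ∈ s, c i * f i g where
  smooth := IsSmooth.sum _ fun i hi => (hf i hi).smooth.const_mul _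
  invariant γ hγ g := Finset.sum_congr rfl fun i hi => by rw [(hf i hi).invariant γ hγ]
  cuspidal n₁ n₂ hn g := by
    simp only [Finset.sum_mul, mul_assoc (c _)]
    rw [cubeIntegral_sum s c fun i hi =>
      (continuous_unipotent (hf i hi).smooth g).mul (continuous_chi n₁ n₂)]
    exact Finset.sum_eq_zero fun i hi => by rw [(hf i hi).cuspidal n₁ n₂ hn g, mul_zero]
  growth Xs hXs := by
    classical
    choose! C hC using fun i hi => (hf i hi).growth Xs hXs
    refine ⟨∑ i ∈ s, ‖c i‖ * C i, fun M => ?_⟩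
    rw [foldr_lie_sum s c fun i hi => (hf i hi).smooth, Finset.sum_mul]
    refine (norm_sum_le _ _).trans (Finset.sum_le_sum fun i hi => ?_)
    rw [norm_mul, mul_assoc]
    exact mul_le_mul_of_nonneg_left (hC i hi M) (norm_nonneg _)

lemma CuspScalar.zero (r : ℝ) : CuspScalar r fun _ => 0 := by
  simpa using CuspScalar.sum (r := r) (∅ : Finset ℕ) (fun _ => 0) (f := fun _ _ => 0) (by simp)

/-- The constant term vanishes at the base points `g exp(tX)` for every `t`; its derivative at `t =
0` under the integral is the assertion. -/
lemma CuspScalar.cuspidal_realLie {r : ℝ} {f : G → ℂ} (hf : CuspScalar r f)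
    (X : Matrix (Fin 3) (Fin 3) ℝ) {n₁ n₂ : ℤ} (hn : n₁ * n₂ = 0) (g : G) :
    cubeIntegral (fun x₁ x₂ x₃ => realLie X f (cls (matU x₁ x₂ x₃) * g) * chi n₁ n₂ x₁ x₂) = 0 := by
  obtain ⟨M, hM, rfl⟩ := exists_cls g
  have hcont : ∀ {f : G → ℂ}, IsSmooth f → Continuous fun p : ℝ × ℝ × ℝ × ℝ =>
      f (cls (matU p.2.1 p.2.2.1 p.2.2.2) * cls M * cls (NormedSpace.exp (p.1 • X))) *
        chi n₁ n₂ p.2.1 p.2.2.1 := by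
    intro f hf
    refine Continuous.mul ?_ ((continuous_chi n₁ n₂).comp continuous_snd)
    have hd : ∀ p : ℝ × ℝ × ℝ × ℝ, (matU p.2.1 p.2.2.1 p.2.2.2 * M).det ≠ 0 := fun p => by
      rw [det_mul]; exact mul_ne_zero (det_matU_ne _ _ _) hM
    simp only [← cls_mul (det_matU_ne _ _ _) hM, ← cls_mul (hd _) (det_exp_ne _)]
    refine hf.continuous_comp (fun i j => ?_) fun p => ?_
    · simp only [Matrix.mul_apply]
      refine continuous_finsetSum _ fun k _ => Continuous.mul (continuous_finsetSum _ fun l _ =>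
        ((continuous_matU_entry i l).comp continuous_snd).mul continuous_const) ?_
      exact (continuous_exp_smul X k j).comp continuous_fst
    · rw [det_mul]; exact mul_ne_zero (hd p) (det_exp_ne _)
  have h := hasDerivAt_cubeIntegral (H := fun t x₁ x₂ x₃ =>
      f (cls (matU x₁ x₂ x₃) * cls M * cls (NormedSpace.exp (t • X))) * chi n₁ n₂ x₁ x₂)
    (H' := fun t x₁ x₂ x₃ =>
      realLie X f (cls (matU x₁ x₂ x₃) * cls M * cls (NormedSpace.exp (t • X))) *
        chi n₁ n₂ x₁ x₂) (hcont hf.smooth) (hcont (hf.smooth.realLie X))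
    (fun t x y z => (hasDerivAt_realLie_at hf.smooth X _ t).mul_const _) 0
  have h0 : (fun s : ℝ => cubeIntegral (fun x₁ x₂ x₃ =>
      f (cls (matU x₁ x₂ x₃) * cls M * cls (NormedSpace.exp (s • X))) * chi n₁ n₂ x₁ x₂)) =
      fun _ => 0 := by
    funext s
    simp only [mul_assoc (cls (matU _ _ _))]
    exact hf.cuspidal n₁ n₂ hn _
  rw [h0] at h
  have h1 := h.unique (hasDerivAt_const (0 : ℝ) (0 : ℂ))
  simpa [NormedSpace.exp_zero, cls_one] using h1

/-- Left invariance commutes with right derivatives. Growth with the same exponent is the given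
bound for longer words, which is where uniformity of the exponent matters. -/
lemma CuspScalar.lie {r : ℝ} {f : G → ℂ} (hf : CuspScalar r f) {X : Matrix (Fin 3) (Fin 3) ℂ}
    (hX : X.trace = 0) : CuspScalar r (lie X f) where
  smooth := hf.smooth.lie X
  invariant γ hγ g := by
    rw [← lie_mul_left]
    congr 1
    funext x; exact hf.invariant γ hγ x
  cuspidal n₁ n₂ hn g := by
    have h := cubeIntegral_sum (Finset.univ : Finset (Fin 2)) ![1, Complex.I]
      (H := ![fun x₁ x₂ x₃ => realLie (X.map Complex.re) f (cls (matU x₁ x₂ x₃) * g) *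
          chi n₁ n₂ x₁ x₂, fun x₁ x₂ x₃ => realLie (X.map Complex.im) f (cls (matU x₁ x₂ x₃) * g) *
          chi n₁ n₂ x₁ x₂]) (by
        intro i _
        fin_cases i
        · exact (continuous_unipotent (hf.smooth.realLie _) g).mul (continuous_chi n₁ n₂)
        · exact (continuous_unipotent (hf.smooth.realLie _) g).mul (continuous_chi n₁ n₂))
    simp only [Fin.sum_univ_two, Matrix.cons_val_zero, Matrix.cons_val_one, one_mul,
      hf.cuspidal_realLie _ hn, mul_zero, add_zero] at h
    rw [← h]
    congr 1
    funext x₁ x₂ x₃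
    simp only [SL3.lie]; ring
  growth Xs hXs := by
    -- The operator `X` acts first, so it stands at the right end of the word.
    obtain ⟨C, hC⟩ := hf.growth (Xs ++ X :: List.nil) (by
      intro Y hY
      rcases List.mem_append.mp hY with h | h
      · exact hXs Y h
      · rw [List.mem_singleton.mp h]; exact hX)
    refine ⟨C, fun M => ?_⟩
    have := hC M
    rwa [List.foldr_append] at this

/-! ### Arithmetic unipotents -/

lemma cls_map_intCast_mem (γ : Matrix.SpecialLinearGroup (Fin 3) ℤ) :
    cls ((γ : Matrix (Fin 3) (Fin 3) ℤ).map (Int.cast : ℤ → ℝ)) ∈ Γ := by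
  have hdet : ((γ : Matrix (Fin 3) (Fin 3) ℤ).map (Int.cast : ℤ → ℝ)).det ≠ 0 := by
    have h := (Matrix.SpecialLinearGroup.map (n := Fin 3) (Int.castRingHom ℝ) γ).2
    have : ((γ : Matrix (Fin 3) (Fin 3) ℤ).map (Int.cast : ℤ → ℝ)).det = 1 := h
    rw [this]; exact one_ne_zero
  refine ⟨γ, ?_⟩
  rw [cls_of_det_ne hdet]
  refine congrArg toG (Units.ext ?_)
  rfl

lemma cls_matU_intCast_mem (n₁ n₂ n₃ : ℤ) : cls (matU n₁ n₂ n₃) ∈ Γ := by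
  have h := cls_map_intCast_mem ⟨!![1, n₂, n₃; 0, 1, n₁; 0, 0, 1], by simp [det_fin_three]⟩
  convert h using 2
  ext i j; fin_cases i <;> fin_cases j <;> simp [matU]

lemma matU_mul (a b c x y z : ℝ) :
    matU a b c * matU x y z = matU (x + a) (y + b) (z + c + b * x) := by
  ext i j; fin_cases i <;> fin_cases j <;>
    simp [matU, Matrix.mul_apply, Fin.sum_univ_three] <;> ring

lemma cls_matU_mul (a b c x y z : ℝ) :
    cls (matU a b c) * cls (matU x y z) = cls (matU (x + a) (y + b) (z + c + b * x)) := by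
  rw [← cls_mul (det_matU_ne _ _ _) (det_matU_ne _ _ _), matU_mul]

/-! ### Constant terms -/

lemma continuous_unipotent_comp {α : Type*} [TopologicalSpace α] {f : G → ℂ} (hf : IsSmooth f)
    (g : G) {a b c : α → ℝ} (ha : Continuous a) (hb : Continuous b) (hc : Continuous c) :
    Continuous fun p => f (cls (matU (a p) (b p) (c p)) * g) := by
  obtain ⟨M, hM, rfl⟩ := exists_cls g
  simp only [← cls_mul (det_matU_ne _ _ _) hM]
  refine hf.continuous_comp (fun i j => ?_) fun p => ?_
  · simp only [Matrix.mul_apply]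
    refine continuous_finsetSum _ fun k _ => Continuous.mul ?_ continuous_const
    fin_cases i <;> fin_cases k <;> simp [matU] <;> fun_prop
  · rw [det_mul]; exact mul_ne_zero (det_matU_ne _ _ _) hM

/-- With all coefficients zero the Fourier series is trivially summable, hence converges pointwise
to the continuous function. -/
lemma eq_zero_of_fourier {J : ℝ → ℂ} (hJ : Continuous J) (hper : ∀ x, J (x + 1) = J x)
    (h : ∀ n : ℤ, ∫ x in (0 : ℝ)..1, J x * Complex.exp (2 * Real.pi * Complex.I * (n * x)) = 0)
    (x : ℝ) : J x = 0 := by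
  have : Fact ((0 : ℝ) < 1) := ⟨one_pos⟩
  have hp : Function.Periodic J 1 := hper
  have hc : Continuous hp.lift := hJ.quotient_lift _
  let F : C(AddCircle (1 : ℝ), ℂ) := ⟨hp.lift, hc⟩
  have h0 : ∀ n, fourierCoeff F n = 0 := by
    intro n
    rw [fourierCoeff_eq_intervalIntegral _ _ 0]
    have : ∀ x : ℝ, fourier (T := 1) (-n) (x : AddCircle (1 : ℝ)) • F x =
        J x * Complex.exp (2 * Real.pi * Complex.I * (((-n : ℤ) : ℂ) * x)) := by
      intro x
      rw [fourier_coe_apply, smul_eq_mul, mul_comm]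
      congr 2
      push_cast; ring
    simp only [this, zero_add]
    rw [h (-n), smul_zero]
  have hs : Summable (fourierCoeff F) := by
    rw [show fourierCoeff F = fun _ => 0 from funext h0]; exact summable_zero
  have h1 := has_pointwise_sum_fourier_series_of_summable hs (x : AddCircle (1 : ℝ))
  simp only [h0, zero_smul] at h1
  exact (hasSum_zero.unique h1).symm

lemma integral_shift {H : ℝ → ℂ} (hper : ∀ x, H (x + 1) = H x) (a : ℝ) :
    ∫ x in (0 : ℝ)..1, H (x + a) = ∫ x in (0 : ℝ)..1, H x := by
  have hp : Function.Periodic H 1 := hper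
  rw [intervalIntegral.integral_comp_add_right, zero_add, add_comm 1 a,
    hp.intervalIntegral_add_eq a 0, zero_add]

namespace CuspScalar

variable {r : ℝ} {f : G → ℂ}

lemma apply_matU_mul (hf : CuspScalar r f) (n₁ n₂ n₃ : ℤ) (x₁ x₂ x₃ : ℝ) (g : G) :
    f (cls (matU (x₁ + n₁) (x₂ + n₂) (x₃ + n₃ + n₂ * x₁)) * g) = f (cls (matU x₁ x₂ x₃) * g) := by
  rw [← cls_matU_mul, mul_assoc, hf.invariant _ (cls_matU_intCast_mem n₁ n₂ n₃)]

lemma periodic_three (hf : CuspScalar r f) (x₁ x₂ x₃ : ℝ) (g : G) :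
    f (cls (matU x₁ x₂ (x₃ + 1)) * g) = f (cls (matU x₁ x₂ x₃) * g) := by
  simpa using hf.apply_matU_mul 0 0 1 x₁ x₂ x₃ g

/-- The constant term along the unipotent radical with coordinates `x₁, x₃` vanishes. -/
lemma integral_column (hf : CuspScalar r f) (g : G) :
    ∫ t in (0 : ℝ)..1, ∫ s in (0 : ℝ)..1, f (cls (matU t 0 s) * g) = 0 := by
  set J₂ : ℝ → ℝ → ℂ := fun x₁ x₂ => ∫ s in (0 : ℝ)..1, f (cls (matU x₁ x₂ s) * g) with hJ₂
  have hJ₂c : Continuous fun p : ℝ × ℝ => J₂ p.1 p.2 := continuous_unitIntegral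
    (H := fun (p : ℝ × ℝ) s => f (cls (matU p.1 p.2 s) * g))
    (continuous_unipotent_comp hf.smooth g (by fun_prop) (by fun_prop) (by fun_prop))
  -- As a function of `x₂` this average is periodic and continuous, and its Fourier coefficients are
  -- the cuspidal integrals with `n₁ = 0`.
  suffices key : ∀ x₂ : ℝ, ∫ x₁ in (0 : ℝ)..1, J₂ x₁ x₂ = 0 from key 0
  refine eq_zero_of_fourier ?_ ?_ ?_
  · exact (continuous_unitIntegral (H := fun x₂ x₁ => J₂ x₁ x₂)
      (continuous_unitIntegral (H := fun (p : ℝ × ℝ) s => f (cls (matU p.2 p.1 s) * g))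
        (continuous_unipotent_comp hf.smooth g (by fun_prop) (by fun_prop) (by fun_prop))))
  · intro x₂
    refine intervalIntegral.integral_congr fun x₁ _ => ?_
    simp only [hJ₂]
    -- The integral translation of `x₂` also moves `x₃` by `x₁`; periodicity in `x₃` absorbs this
    -- inside the average.
    rw [← integral_shift (H := fun s => f (cls (matU x₁ (x₂ + 1) s) * g))
      (fun s => hf.periodic_three _ _ _ g) x₁]
    refine intervalIntegral.integral_congr fun s _ => ?_
    simpa using hf.apply_matU_mul 0 1 0 x₁ x₂ s g
  · intro n
    refine Eq.trans ?_ (hf.cuspidal 0 n (by simp) g)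
    rw [cubeIntegral]
    have h1 : ∀ x₁ x₂, ∫ s in (0 : ℝ)..1, f (cls (matU x₁ x₂ s) * g) * chi 0 n x₁ x₂ =
        J₂ x₁ x₂ * Complex.exp (2 * Real.pi * Complex.I * (n * x₂)) := by
      intro x₁ x₂
      rw [intervalIntegral.integral_mul_const]
      simp [chi, hJ₂]
    simp only [h1]
    rw [intervalIntegral_intervalIntegral_swap]
    · exact intervalIntegral.integral_congr fun x₂ _ =>
        (intervalIntegral.integral_mul_const _ _).symm
    · have hcont : Continuous (Function.uncurry fun x₁ x₂ : ℝ =>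
          J₂ x₁ x₂ * Complex.exp (2 * Real.pi * Complex.I * (n * x₂))) :=
        hJ₂c.mul (by fun_prop)
      exact (hcont.continuousOn.integrableOn_compact (isCompact_uIcc.prod isCompact_uIcc)).mono_set
        (Set.prod_mono Set.uIoc_subset_uIcc Set.uIoc_subset_uIcc)

/-- The constant term along the unipotent radical with coordinates `x₂, x₃` vanishes. -/
lemma integral_row (hf : CuspScalar r f) (g : G) :
    ∫ t in (0 : ℝ)..1, ∫ s in (0 : ℝ)..1, f (cls (matU 0 t s) * g) = 0 := by
  suffices key : ∀ x₁ : ℝ, ∫ t in (0 : ℝ)..1, ∫ s in (0 : ℝ)..1, f (cls (matU x₁ t s) * g) = 0 from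
    key 0
  refine eq_zero_of_fourier ?_ ?_ ?_
  · exact (continuous_unitIntegral (H := fun x₁ x₂ => ∫ s in (0 : ℝ)..1, f (cls (matU x₁ x₂ s) * g))
      (continuous_unitIntegral (H := fun (p : ℝ × ℝ) s => f (cls (matU p.1 p.2 s) * g))
        (continuous_unipotent_comp hf.smooth g (by fun_prop) (by fun_prop) (by fun_prop))))
  · intro x₁
    refine intervalIntegral.integral_congr fun t _ => intervalIntegral.integral_congr fun s _ => ?_
    simpa using hf.apply_matU_mul 1 0 0 x₁ t s g
  · intro n
    refine Eq.trans ?_ (hf.cuspidal n 0 (by simp) g)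
    rw [cubeIntegral]
    refine intervalIntegral.integral_congr fun x₁ _ => ?_
    simp only [chi, ← intervalIntegral.integral_mul_const]
    simp

end CuspScalar

/-! ### Periodic functions -/

/-- The mean value inequality for `h s - h t`, averaged over `t` in the unit interval. -/
lemma norm_sub_integral_le {h h' : ℝ → ℂ} {B : ℝ} (hd : ∀ t, HasDerivAt h (h' t) t)
    (hB : ∀ t ∈ Set.Icc (0 : ℝ) 1, ‖h' t‖ ≤ B) {s : ℝ} (hs : s ∈ Set.Icc (0 : ℝ) 1) :
    ‖h s - ∫ t in (0 : ℝ)..1, h t‖ ≤ B := by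
  have hc : Continuous h := continuous_iff_continuousAt.mpr fun t => (hd t).continuousAt
  have h1 : h s - ∫ t in (0 : ℝ)..1, h t = ∫ t in (0 : ℝ)..1, (h s - h t) := by
    rw [intervalIntegral.integral_sub intervalIntegrable_const (hc.intervalIntegrable _ _)]
    simp
  have hB0 : 0 ≤ B := (norm_nonneg _).trans (hB s hs)
  have h2 : ∀ t ∈ Set.uIoc (0 : ℝ) 1, ‖h s - h t‖ ≤ B := by
    intro t ht
    rw [Set.uIoc_of_le zero_le_one] at ht
    have ht' : t ∈ Set.Icc (0 : ℝ) 1 := ⟨ht.1.le, ht.2⟩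
    refine ((convex_Icc (0 : ℝ) 1).norm_image_sub_le_of_norm_hasDerivWithin_le
      (fun x _ => (hd x).hasDerivWithinAt) hB ht' hs).trans ?_
    refine mul_le_of_le_one_right hB0 ?_
    rw [Real.norm_eq_abs, abs_le]
    constructor <;> linarith [hs.1, hs.2, ht'.1, ht'.2]
  rw [h1]
  refine (intervalIntegral.norm_integral_le_of_norm_le_const h2).trans ?_
  simp

/-- Every derivative of a periodic function has mean zero, so a bound for one derivative bounds the
preceding one, and so on down to the function minus its mean. -/
lemma norm_sub_integral_le_of_iterate {h : ℕ → ℝ → ℂ} {n : ℕ} {B : ℝ}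
    (hd : ∀ i t, HasDerivAt (h i) (h (i + 1) t) t) (hper : ∀ i, h i 1 = h i 0)
    (hB : ∀ t ∈ Set.Icc (0 : ℝ) 1, ‖h (n + 1) t‖ ≤ B) {s : ℝ} (hs : s ∈ Set.Icc (0 : ℝ) 1) :
    ‖h 0 s - ∫ t in (0 : ℝ)..1, h 0 t‖ ≤ B := by
  have hmean : ∀ i, ∫ t in (0 : ℝ)..1, h (i + 1) t = 0 := by
    intro i
    rw [intervalIntegral.integral_eq_sub_of_hasDerivAt (fun t _ => hd i t), hper, sub_self]
    exact (continuous_iff_continuousAt.mpr fun t => (hd (i + 1) t).continuousAt).intervalIntegrable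
      _ _
  have key : ∀ j i, i + j = n → ∀ t ∈ Set.Icc (0 : ℝ) 1, ‖h (i + 1) t‖ ≤ B := by
    intro j
    induction j with
    | zero => intro i hi; rw [show i = n by omega]; exact hB
    | succ j ih =>
      intro i hi t ht
      have := norm_sub_integral_le (hd (i + 1)) (ih (i + 1) (by omega)) ht
      rwa [hmean, sub_zero] at this
  exact norm_sub_integral_le (hd 0) (key n 0 (by omega)) hs

/-! ### Derivatives along unipotent one-parameter groups -/

lemma realLie_eq_lie {f : G → ℂ} (hf : IsSmooth f) (X : Matrix (Fin 3) (Fin 3) ℝ) :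
    realLie X f = lie (X.map Complex.ofReal) f := funext fun g => (lie_ofReal hf X g).symm

lemma isSmooth_iterate_realLie {f : G → ℂ} (hf : IsSmooth f) (X : Matrix (Fin 3) (Fin 3) ℝ) (n : ℕ) :
    IsSmooth ((realLie X)^[n] f) := by
  induction n generalizing f with
  | zero => exact hf
  | succ n ih => exact ih (hf.realLie X)

lemma iterate_realLie_sum {ι : Type*} (s : Finset ι) (c : ι → ℂ) {f : ι → G → ℂ}
    (hf : ∀ i ∈ s, IsSmooth (f i)) (X : Matrix (Fin 3) (Fin 3) ℝ) (n : ℕ) :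
    (realLie X)^[n] (fun g => ∑ i ∈ s, c i * f i g) =
      fun g => ∑ i ∈ s, c i * (realLie X)^[n] (f i) g := by
  induction n generalizing f with
  | zero => rfl
  | succ n ih =>
    simp only [Function.iterate_succ_apply]
    rw [← ih fun i hi => (hf i hi).realLie X]
    congr 1
    funext g
    exact realLie_sum_fun s hf c X g

lemma iterate_realLie_mul_left {f : G → ℂ} {h : G} (hf : ∀ g, f (h * g) = f g)
    (X : Matrix (Fin 3) (Fin 3) ℝ) (n : ℕ) (g : G) :
    (realLie X)^[n] f (h * g) = (realLie X)^[n] f g := by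
  induction n generalizing f with
  | zero => exact hf g
  | succ n ih =>
    refine ih (f := realLie X f) fun g => ?_
    rw [← realLie_mul_left]
    congr 1
    funext x; exact hf x

/-- The Euclidean norm of a matrix. -/
def frob (M : Matrix (Fin 3) (Fin 3) ℝ) : ℝ := √(∑ i, ∑ j, M i j ^ 2)

namespace CuspScalar

variable {r : ℝ} {f : G → ℂ}

lemma realLie (hf : CuspScalar r f) {X : Matrix (Fin 3) (Fin 3) ℝ} (hX : X.trace = 0) :
    CuspScalar r (realLie X f) := by
  rw [realLie_eq_lie hf.smooth]
  refine hf.lie ?_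
  have : (X.map Complex.ofReal).trace = (X.trace : ℂ) := by
    simp [Matrix.trace, Matrix.diag]
  rw [this, hX, Complex.ofReal_zero]

/-- Expanding the `n`-th power of `a E₁ + b E₂` gives words in `E₁` and `E₂`, each with `n` small
coefficients and each bounded with the same exponent `r`. -/
lemma iterate_bound {E₁ E₂ : Matrix (Fin 3) (Fin 3) ℝ} (h₁ : E₁.trace = 0) (h₂ : E₂.trace = 0)
    (n : ℕ) (hf : CuspScalar r f) : ∃ C : ℝ, 0 ≤ C ∧ ∀ a b ε : ℝ, |a| ≤ ε → |b| ≤ ε →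
      ∀ M : Matrix.SpecialLinearGroup (Fin 3) ℝ,
        ‖(SL3.realLie (a • E₁ + b • E₂))^[n] f (cls (M : Matrix (Fin 3) (Fin 3) ℝ))‖ ≤
          C * ε ^ n * frob M ^ r := by
  induction n generalizing f with
  | zero =>
    obtain ⟨C, hC⟩ := hf.growth [] (by simp)
    refine ⟨max C 0, le_max_right _ _, fun a b ε _ _ M => (hC M).trans ?_⟩
    rw [pow_zero, mul_one]
    exact mul_le_mul_of_nonneg_right (le_max_left _ _) (Real.rpow_nonneg (Real.sqrt_nonneg _) _)
  | succ n ih =>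
    obtain ⟨C₁, hC₁0, hC₁⟩ := ih (hf.realLie h₁)
    obtain ⟨C₂, hC₂0, hC₂⟩ := ih (hf.realLie h₂)
    refine ⟨C₁ + C₂, by positivity, fun a b ε ha hb M => ?_⟩
    have hε : 0 ≤ ε := (abs_nonneg a).trans ha
    have h3 : SL3.realLie (a • E₁ + b • E₂) f = fun g => ∑ i : Fin 2,
        (![(a : ℂ), (b : ℂ)] i) * (![SL3.realLie E₁ f, SL3.realLie E₂ f] i) g := by
      funext g
      rw [realLie_add_mat hf.smooth, realLie_smul_mat hf.smooth, realLie_smul_mat hf.smooth]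
      simp
    rw [Function.iterate_succ_apply, h3, iterate_realLie_sum]
    swap
    · intro i _
      fin_cases i
      · exact hf.smooth.realLie E₁
      · exact hf.smooth.realLie E₂
    simp only [Fin.sum_univ_two, Matrix.cons_val_zero, Matrix.cons_val_one]
    refine (norm_add_le _ _).trans ?_
    rw [norm_mul, norm_mul, Complex.norm_real, Complex.norm_real]
    have k1 := mul_le_mul ha (hC₁ a b ε ha hb M) (norm_nonneg _) hε
    have k2 := mul_le_mul hb (hC₂ a b ε ha hb M) (norm_nonneg _) hε
    calc _ ≤ ε * (C₁ * ε ^ n * frob M ^ r) + ε * (C₂ * ε ^ n * frob M ^ r) := add_le_add k1 k2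
      _ = _ := by ring

/-- Comparison of `f` with its average over a unipotent one-parameter group. -/
lemma sub_average_le (hf : CuspScalar r f) {E₁ E₂ : Matrix (Fin 3) (Fin 3) ℝ} (h₁ : E₁.trace = 0)
    (h₂ : E₂.trace = 0) (n : ℕ) : ∃ C : ℝ, 0 ≤ C ∧ ∀ (E A : Matrix (Fin 3) (Fin 3) ℝ)
      (u : ℝ → Matrix (Fin 3) (Fin 3) ℝ) (a b ε R : ℝ), E * E = 0 → (∀ t, u t = 1 + t • E) →
      (∀ t, (u t).det ≠ 0) → cls (u 1) ∈ Γ → A.det ≠ 0 → A * (a • E₁ + b • E₂) = E * A →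
      |a| ≤ ε → |b| ≤ ε → 0 ≤ r →
      (∀ t ∈ Set.Icc (0 : ℝ) 1, ∃ M : Matrix.SpecialLinearGroup (Fin 3) ℝ,
        cls (M : Matrix (Fin 3) (Fin 3) ℝ) = cls (u t * A) ∧ frob M ≤ R) →
      ‖f (cls A) - ∫ t in (0 : ℝ)..1, f (cls (u t * A))‖ ≤ C * ε ^ (n + 1) * R ^ r := by
  obtain ⟨C, hC0, hC⟩ := hf.iterate_bound h₁ h₂ (n + 1)
  refine ⟨C, hC0, fun E A u a b ε R hE hu hdet hΓ hA hX ha hb hr hR => ?_⟩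
  set X := a • E₁ + b • E₂ with hXdef
  have hε : 0 ≤ ε := (abs_nonneg a).trans ha
  have hdetA : ∀ t, (u t * A).det ≠ 0 := fun t => by rw [det_mul]; exact mul_ne_zero (hdet t) hA
  have hcurve : ∀ t, CurveDeriv (fun s => u s * A) (E * A) t := by
    intro t
    refine CurveDeriv.mul_right (γ := u) (v := E) (fun i j => ?_) A
    simp only [hu, Matrix.add_apply, Matrix.smul_apply, smul_eq_mul]
    simpa using ((hasDerivAt_id' t).mul_const (E i j)).const_add ((1 : Matrix (Fin 3) (Fin 3) ℝ) i j)
  -- Since `E² = 0`, left multiplication by `u t` fixes `E A`; hence the curve `u t * A` moves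
  -- throughout in the single right direction `X`.
  have hEA : ∀ t, u t * A * X = E * A := by
    intro t
    rw [Matrix.mul_assoc, hX, hu, add_mul, one_mul, Matrix.smul_mul, ← Matrix.mul_assoc, hE]
    simp
  have hd : ∀ i t, HasDerivAt (fun s => (SL3.realLie X)^[i] f (cls (u s * A)))
      ((SL3.realLie X)^[i + 1] f (cls (u t * A))) t := by
    intro i t
    have hs := isSmooth_iterate_realLie hf.smooth X i
    rw [Function.iterate_succ_apply', realLie_cls hs X (hdetA t), hEA]
    exact hasDerivAt_curve hs (hcurve t) (hdetA t)
  have hu0 : u 0 = 1 := by rw [hu]; simp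
  have key := norm_sub_integral_le_of_iterate
    (h := fun i s => (SL3.realLie X)^[i] f (cls (u s * A))) (n := n)
    (B := C * ε ^ (n + 1) * R ^ r) hd (fun i => ?_) (fun t ht => ?_) (s := 0) (by simp)
  · simpa [hu0] using key
  · simp only [hu0, one_mul]
    rw [cls_mul (hdet 1) hA]
    exact iterate_realLie_mul_left (hf.invariant _ hΓ) X i _
  · obtain ⟨M, hM, hMR⟩ := hR t ht
    simp only [← hM]
    refine (hC a b ε ha hb M).trans ?_
    have : frob M ^ r ≤ R ^ r := Real.rpow_le_rpow (Real.sqrt_nonneg _) hMR hr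
    exact mul_le_mul_of_nonneg_left this (by positivity)

end CuspScalar

/-! ### Estimates on Siegel sets -/

/-- The growth bound refers to representatives of determinant one. The rescaling factor is `(y₁²
y₂)^(-1/3)`, at most `2` because `y₁, y₂ ≥ 1/2`. -/
lemma exists_sl_pt {x₁ x₂ x₃ y₁ y₂ Y : ℝ} (hx₁ : |x₁| ≤ 3) (hx₂ : |x₂| ≤ 3) (hx₃ : |x₃| ≤ 3)
    (hy₁ : 1 / 2 ≤ y₁) (hy₂ : 1 / 2 ≤ y₂) (h₁ : y₁ ≤ Y) (h₂ : y₂ ≤ Y) :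
    ∃ M : Matrix.SpecialLinearGroup (Fin 3) ℝ, cls (M : Matrix (Fin 3) (Fin 3) ℝ) =
      cls (matU x₁ x₂ x₃ * matY y₁ y₂) ∧ frob M ≤ 72 * Y ^ 2 := by
  have hY : 1 / 2 ≤ Y := hy₁.trans h₁
  have p1 : 0 < y₁ := by linarith
  have p2 : 0 < y₂ := by linarith
  set q := y₁ ^ 2 * y₂ with hq
  have hq8 : (1 / 2 : ℝ) ^ 3 ≤ q := by
    rw [hq, pow_succ]
    exact mul_le_mul (pow_le_pow_left₀ (by norm_num) hy₁ 2) hy₂ (by norm_num) (by positivity)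
  have hq0 : 0 < q := by positivity
  set c := q ^ (-(1 / 3) : ℝ) with hc
  have hc0 : 0 < c := Real.rpow_pos_of_pos hq0 _
  have hc3 : c ^ 3 * q = 1 := by
    rw [hc, ← Real.rpow_natCast, ← Real.rpow_mul hq0.le]
    norm_num
    rw [Real.rpow_neg_one, inv_mul_cancel₀ hq0.ne']
  have hc2 : c ≤ 2 := by
    by_contra hcon
    push Not at hcon
    have : (2 : ℝ) ^ 3 * (1 / 2) ^ 3 < c ^ 3 * q :=
      mul_lt_mul (pow_lt_pow_left₀ hcon (by norm_num) (by norm_num)) hq8 (by positivity)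
        (by positivity)
    rw [hc3] at this
    norm_num at this
  set A := matU x₁ x₂ x₃ * matY y₁ y₂ with hA
  have hdetA : A.det = q := by
    rw [hA, matU_mul_matY, det_fin_three]; simp; ring
  refine ⟨⟨c • A, by rw [det_smul, hdetA]; simpa using hc3⟩, cls_smul hc0.ne', ?_⟩
  have hY2 : 1 / 4 ≤ Y ^ 2 := by nlinarith
  have hent : ∀ i j, |A i j| ≤ 12 * Y ^ 2 := by
    have e1 : y₁ * y₂ ≤ Y ^ 2 := by nlinarith
    have e2 : |x₂| * y₁ ≤ 3 * Y := mul_le_mul hx₂ h₁ p1.le (by norm_num)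
    have e3 : Y ≤ 2 * Y ^ 2 := by nlinarith
    have e4 : 0 < y₁ * y₂ := by positivity
    intro i j
    rw [hA, matU_mul_matY]
    fin_cases i <;> fin_cases j <;> simp [abs_of_pos, p1, p2] <;>
      first
        | positivity
        | linarith
  have hent2 : ∀ i j, (c • A) i j ^ 2 ≤ (24 * Y ^ 2) ^ 2 := by
    intro i j
    rw [← sq_abs]
    refine pow_le_pow_left₀ (abs_nonneg _) ?_ 2
    rw [Matrix.smul_apply, smul_eq_mul, abs_mul, abs_of_pos hc0]
    nlinarith [hent i j, abs_nonneg (A i j)]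
  -- Nine entries of size at most `2 * 12 Y²` give the Euclidean norm `3 * 24 Y² = 72 Y²`.
  refine Real.sqrt_le_iff.mpr ⟨by positivity, ?_⟩
  refine (Finset.sum_le_sum fun i _ => Finset.sum_le_sum fun j _ => hent2 i j).trans (le_of_eq ?_)
  simp only [Finset.sum_const, Finset.card_univ, Fintype.card_fin, nsmul_eq_mul]
  push_cast; ring

lemma cls_matU_mul_pt (a b c x₁ x₂ x₃ : ℝ) {y₁ y₂ : ℝ} (h₁ : 0 < y₁) (h₂ : 0 < y₂) :
    cls (matU a b c) * pt x₁ x₂ x₃ y₁ y₂ = pt (x₁ + a) (x₂ + b) (x₃ + c + b * x₁) y₁ y₂ := by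
  rw [pt, ← cls_mul (det_matU_ne _ _ _) (det_pt h₁ h₂), ← Matrix.mul_assoc, matU_mul, pt]

/-- With `2k + 1` derivatives and `k ≥ r`, the gain `Y^-(2k+1)` beats the growth `Y^(2r)` and leaves
one factor `1 / Y`. -/
lemma rpow_bound {r C Y : ℝ} {k : ℕ} (hC : 0 ≤ C) (hY : 1 / 2 ≤ Y) (hr : r ≤ k) :
    C * (6 / Y) ^ (2 * k + 1) * (72 * Y ^ 2) ^ r ≤ C * (6 ^ (2 * k + 1) * 72 ^ k) / Y := by
  have hY0 : 0 < Y := by linarith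
  have h1 : (72 * Y ^ 2) ^ r ≤ (72 * Y ^ 2) ^ k := by
    exact (Real.rpow_le_rpow_of_exponent_le (show 1 ≤ 72 * Y ^ 2 by nlinarith) hr).trans
      (le_of_eq (Real.rpow_natCast _ _))
  have hC' : 0 ≤ C * (6 / Y) ^ (2 * k + 1) := by positivity
  refine (mul_le_mul_of_nonneg_left h1 hC').trans (le_of_eq ?_)
  rw [div_pow, mul_pow, ← pow_mul, pow_succ Y]
  field_simp

namespace CuspScalar

variable {r : ℝ} {f : G → ℂ}

/-- Carrying the directions of `x₁` and `x₃` to the right through `x y` divides them by `y₁` or `y₁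
y₂`. With `x₂` bounded and `y₂ ≥ 1/2` all coefficients are at most `6 / y₁`. -/
lemma column_average (hf : CuspScalar r f) (hr : 0 ≤ r) (n : ℕ) : ∃ C : ℝ, 0 ≤ C ∧
    ∀ x₁ x₂ x₃ y₁ y₂ : ℝ, |x₁| ≤ 2 → |x₂| ≤ 2 → |x₃| ≤ 2 → 1 / 2 ≤ y₁ → 1 / 2 ≤ y₂ → y₂ ≤ y₁ →
      ‖f (pt x₁ x₂ x₃ y₁ y₂) - ∫ t in (0 : ℝ)..1, f (pt (x₁ + t) x₂ x₃ y₁ y₂)‖ ≤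
        C * (6 / y₁) ^ (n + 1) * (72 * y₁ ^ 2) ^ r ∧
      ‖f (pt x₁ x₂ x₃ y₁ y₂) - ∫ t in (0 : ℝ)..1, f (pt x₁ x₂ (x₃ + t) y₁ y₂)‖ ≤
        C * (6 / y₁) ^ (n + 1) * (72 * y₁ ^ 2) ^ r := by
  obtain ⟨C, hC0, hC⟩ := hf.sub_average_le (E₁ := !![0, 0, 1; 0, 0, 0; 0, 0, 0])
    (E₂ := !![0, 0, 0; 0, 0, 1; 0, 0, 0]) (by simp [Matrix.trace_fin_three])
    (by simp [Matrix.trace_fin_three]) n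
  refine ⟨C, hC0, fun x₁ x₂ x₃ y₁ y₂ hx₁ hx₂ hx₃ hy₁ hy₂ hy => ?_⟩
  have p1 : 0 < y₁ := by linarith
  have p2 : 0 < y₂ := by linarith
  have hdet : (matU x₁ x₂ x₃ * matY y₁ y₂).det ≠ 0 := det_pt p1 p2
  rw [abs_le] at hx₁ hx₂ hx₃
  have b1 : |1 / (y₁ * y₂)| ≤ 6 / y₁ := by
    rw [abs_of_pos (by positivity), div_le_div_iff₀ (by positivity) p1]; nlinarith
  have b2 : |(0 : ℝ)| ≤ 6 / y₁ := by rw [abs_zero]; positivity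
  have b3 : |-x₂ / (y₁ * y₂)| ≤ 6 / y₁ := by
    rw [abs_div, abs_neg, abs_of_pos (by positivity : 0 < y₁ * y₂),
      div_le_div_iff₀ (by positivity) p1]
    have : |x₂| ≤ 2 := abs_le.mpr hx₂
    nlinarith [mul_le_mul_of_nonneg_right this p1.le, mul_pos p1 p2]
  have b4 : |1 / y₁| ≤ 6 / y₁ := by
    rw [abs_of_pos (by positivity)]; gcongr; norm_num
  have e1 : ∀ t, matU t 0 0 * (matU x₁ x₂ x₃ * matY y₁ y₂) = matU (x₁ + t) x₂ x₃ * matY y₁ y₂ := by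
    intro t; rw [← Matrix.mul_assoc, matU_mul]; simp
  have e2 : ∀ t, matU 0 0 t * (matU x₁ x₂ x₃ * matY y₁ y₂) = matU x₁ x₂ (x₃ + t) * matY y₁ y₂ := by
    intro t; rw [← Matrix.mul_assoc, matU_mul]; simp
  constructor
  · have := hC !![0, 0, 0; 0, 0, 1; 0, 0, 0] (matU x₁ x₂ x₃ * matY y₁ y₂) (fun t => matU t 0 0)
      (-x₂ / (y₁ * y₂)) (1 / y₁) (6 / y₁) (72 * y₁ ^ 2) (by simp [← Matrix.ext_iff, Fin.forall_fin_succ])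
      (fun t => by ext i j; fin_cases i <;> fin_cases j <;> simp [matU])
      (fun t => det_matU_ne _ _ _) (by simpa using cls_matU_intCast_mem 1 0 0) hdet
      (by
        rw [matU_mul_matY]
        ext i j; fin_cases i <;> fin_cases j <;> simp <;> field_simp
        ring) b3 b4 hr
      (fun t ht => by
        simp only [e1]
        exact exists_sl_pt (abs_le.mpr ⟨by linarith [ht.1], by linarith [ht.2]⟩)
          (abs_le.mpr ⟨by linarith, by linarith⟩) (abs_le.mpr ⟨by linarith, by linarith⟩) hy₁ hy₂
          le_rfl hy)
    simpa only [e1, pt] using this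
  · have := hC !![0, 0, 1; 0, 0, 0; 0, 0, 0] (matU x₁ x₂ x₃ * matY y₁ y₂) (fun t => matU 0 0 t)
      (1 / (y₁ * y₂)) 0 (6 / y₁) (72 * y₁ ^ 2) (by simp [← Matrix.ext_iff, Fin.forall_fin_succ])
      (fun t => by ext i j; fin_cases i <;> fin_cases j <;> simp [matU])
      (fun t => det_matU_ne _ _ _) (by simpa using cls_matU_intCast_mem 0 0 1) hdet
      (by
        rw [matU_mul_matY]
        ext i j; fin_cases i <;> fin_cases j <;> simp
        field_simp) b1 b2 hr
      (fun t ht => by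
        simp only [e2]
        exact exists_sl_pt (abs_le.mpr ⟨by linarith, by linarith⟩)
          (abs_le.mpr ⟨by linarith, by linarith⟩)
          (abs_le.mpr ⟨by linarith [ht.1], by linarith [ht.2]⟩) hy₁ hy₂ le_rfl hy)
    simpa only [e2, pt] using this

/-- The counterpart for `y₁ ≤ y₂`, with the directions of `x₂` and `x₃`. Left translation along `x₂`
also moves `x₃` by `t x₁`, which is why the first estimate needs the smaller box for `x₃`. -/
lemma row_average (hf : CuspScalar r f) (hr : 0 ≤ r) (n : ℕ) : ∃ C : ℝ, 0 ≤ C ∧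
    ∀ x₁ x₂ x₃ y₁ y₂ : ℝ, |x₁| ≤ 1 → |x₂| ≤ 2 → |x₃| ≤ 2 → 1 / 2 ≤ y₁ → 1 / 2 ≤ y₂ → y₁ ≤ y₂ →
      (|x₃| ≤ 1 → ‖f (pt x₁ x₂ x₃ y₁ y₂) -
        ∫ t in (0 : ℝ)..1, f (pt x₁ (x₂ + t) (x₃ + t * x₁) y₁ y₂)‖ ≤
        C * (6 / y₂) ^ (n + 1) * (72 * y₂ ^ 2) ^ r) ∧
      ‖f (pt x₁ x₂ x₃ y₁ y₂) - ∫ t in (0 : ℝ)..1, f (pt x₁ x₂ (x₃ + t) y₁ y₂)‖ ≤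
        C * (6 / y₂) ^ (n + 1) * (72 * y₂ ^ 2) ^ r := by
  obtain ⟨C, hC0, hC⟩ := hf.sub_average_le (E₁ := !![0, 1, 0; 0, 0, 0; 0, 0, 0])
    (E₂ := !![0, 0, 1; 0, 0, 0; 0, 0, 0]) (by simp [Matrix.trace_fin_three])
    (by simp [Matrix.trace_fin_three]) n
  refine ⟨C, hC0, fun x₁ x₂ x₃ y₁ y₂ hx₁ hx₂ hx₃ hy₁ hy₂ hy => ?_⟩
  have p1 : 0 < y₁ := by linarith
  have p2 : 0 < y₂ := by linarith
  have hdet : (matU x₁ x₂ x₃ * matY y₁ y₂).det ≠ 0 := det_pt p1 p2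
  rw [abs_le] at hx₁ hx₂ hx₃
  have b1 : |1 / (y₁ * y₂)| ≤ 6 / y₂ := by
    rw [abs_of_pos (by positivity), div_le_div_iff₀ (by positivity) p2]; nlinarith
  have b2 : |(0 : ℝ)| ≤ 6 / y₂ := by rw [abs_zero]; positivity
  have b3 : |x₁ / (y₁ * y₂)| ≤ 6 / y₂ := by
    rw [abs_div, abs_of_pos (by positivity : 0 < y₁ * y₂),
      div_le_div_iff₀ (by positivity) p2]
    have : |x₁| ≤ 1 := abs_le.mpr hx₁
    nlinarith [mul_le_mul_of_nonneg_right this p2.le, mul_pos p1 p2]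
  have b4 : |1 / y₂| ≤ 6 / y₂ := by
    rw [abs_of_pos (by positivity)]; gcongr; norm_num
  have e1 : ∀ t, matU 0 t 0 * (matU x₁ x₂ x₃ * matY y₁ y₂) =
      matU x₁ (x₂ + t) (x₃ + t * x₁) * matY y₁ y₂ := by
    intro t; rw [← Matrix.mul_assoc, matU_mul]; simp
  have e2 : ∀ t, matU 0 0 t * (matU x₁ x₂ x₃ * matY y₁ y₂) = matU x₁ x₂ (x₃ + t) * matY y₁ y₂ := by
    intro t; rw [← Matrix.mul_assoc, matU_mul]; simp
  constructor
  · intro hx₃'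
    rw [abs_le] at hx₃'
    have := hC !![0, 1, 0; 0, 0, 0; 0, 0, 0] (matU x₁ x₂ x₃ * matY y₁ y₂) (fun t => matU 0 t 0)
      (1 / y₂) (x₁ / (y₁ * y₂)) (6 / y₂) (72 * y₂ ^ 2) (by simp [← Matrix.ext_iff, Fin.forall_fin_succ])
      (fun t => by ext i j; fin_cases i <;> fin_cases j <;> simp [matU])
      (fun t => det_matU_ne _ _ _) (by simpa using cls_matU_intCast_mem 0 1 0) hdet
      (by
        rw [matU_mul_matY]
        ext i j; fin_cases i <;> fin_cases j <;> simp <;> field_simp) b4 b3 hr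
      (fun t ht => by
        simp only [e1]
        have h1 : |t * x₁| ≤ 1 := by
          rw [abs_mul]
          exact mul_le_one₀ (abs_le.mpr ⟨by linarith [ht.1], ht.2⟩) (abs_nonneg _) (abs_le.mpr hx₁)
        rw [abs_le] at h1
        exact exists_sl_pt (abs_le.mpr ⟨by linarith, by linarith⟩)
          (abs_le.mpr ⟨by linarith [ht.1], by linarith [ht.2]⟩)
          (abs_le.mpr ⟨by linarith, by linarith⟩) hy₁ hy₂ hy le_rfl)
    simpa only [e1, pt] using this
  · have := hC !![0, 0, 1; 0, 0, 0; 0, 0, 0] (matU x₁ x₂ x₃ * matY y₁ y₂) (fun t => matU 0 0 t)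
      0 (1 / (y₁ * y₂)) (6 / y₂) (72 * y₂ ^ 2) (by simp [← Matrix.ext_iff, Fin.forall_fin_succ])
      (fun t => by ext i j; fin_cases i <;> fin_cases j <;> simp [matU])
      (fun t => det_matU_ne _ _ _) (by simpa using cls_matU_intCast_mem 0 0 1) hdet
      (by
        rw [matU_mul_matY]
        ext i j; fin_cases i <;> fin_cases j <;> simp
        field_simp) b2 b1 hr
      (fun t ht => by
        simp only [e2]
        exact exists_sl_pt (abs_le.mpr ⟨by linarith, by linarith⟩)
          (abs_le.mpr ⟨by linarith, by linarith⟩)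
          (abs_le.mpr ⟨by linarith [ht.1], by linarith [ht.2]⟩) hy₁ hy₂ hy le_rfl)
    simpa only [e2, pt] using this

end CuspScalar

/-- One error comes from replacing the value by its first average, another from replacing the
integrand by its second average; the double average vanishes. -/
lemma norm_le_of_averages {h : ℝ → ℝ → ℂ} {z : ℂ} {B : ℝ} {h₀ : ℝ → ℂ} (hc₀ : Continuous h₀)
    (hc : Continuous fun p : ℝ × ℝ => h p.1 p.2)
    (h1 : ‖z - ∫ t in (0 : ℝ)..1, h₀ t‖ ≤ B)
    (h2 : ∀ t ∈ Set.Icc (0 : ℝ) 1, ‖h₀ t - ∫ s in (0 : ℝ)..1, h t s‖ ≤ B)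
    (h3 : ∫ t in (0 : ℝ)..1, ∫ s in (0 : ℝ)..1, h t s = 0) : ‖z‖ ≤ 2 * B := by
  have h4 : ‖∫ t in (0 : ℝ)..1, h₀ t‖ ≤ B := by
    have h5 : ∫ t in (0 : ℝ)..1, h₀ t = ∫ t in (0 : ℝ)..1, (h₀ t - ∫ s in (0 : ℝ)..1, h t s) := by
      rw [intervalIntegral.integral_sub (hc₀.intervalIntegrable _ _)
        ((continuous_unitIntegral hc).intervalIntegrable _ _), h3, sub_zero]
    rw [h5]
    refine (intervalIntegral.norm_integral_le_of_norm_le_const (C := B) fun t ht => ?_).trans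
      (by simp)
    rw [Set.uIoc_of_le zero_le_one] at ht
    exact h2 t ⟨ht.1.le, ht.2⟩
  calc ‖z‖ = ‖(z - ∫ t in (0 : ℝ)..1, h₀ t) + ∫ t in (0 : ℝ)..1, h₀ t‖ := by rw [sub_add_cancel]
    _ ≤ B + B := (norm_add_le _ _).trans (add_le_add h1 h4)
    _ = 2 * B := by ring

/-- Decay of cusp forms on Siegel sets. -/
lemma CuspScalar.siegel_bound {r : ℝ} {f : G → ℂ} (hf : CuspScalar r f) (hr : 0 ≤ r) : ∃ C : ℝ,
    0 ≤ C ∧ ∀ x₁ x₂ x₃ y₁ y₂ : ℝ, |x₁| ≤ 1 → |x₂| ≤ 1 → |x₃| ≤ 1 → 1 / 2 ≤ y₁ → 1 / 2 ≤ y₂ →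
      ‖f (pt x₁ x₂ x₃ y₁ y₂)‖ ≤ C / max y₁ y₂ := by
  set k := ⌈r⌉₊
  have hk : r ≤ k := Nat.le_ceil r
  obtain ⟨C₁, hC₁0, hC₁⟩ := hf.column_average hr (2 * k)
  obtain ⟨C₂, hC₂0, hC₂⟩ := hf.row_average hr (2 * k)
  set D : ℝ := 6 ^ (2 * k + 1) * 72 ^ k with hD
  refine ⟨2 * ((C₁ + C₂) * D), by positivity, fun x₁ x₂ x₃ y₁ y₂ hx₁ hx₂ hx₃ hy₁ hy₂ => ?_⟩
  have p1 : 0 < y₁ := by linarith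
  have p2 : 0 < y₂ := by linarith
  have hx₁' := abs_le.mp hx₁
  have hx₂' := abs_le.mp hx₂
  have hx₃' := abs_le.mp hx₃
  -- The larger of the two coordinates decides which unipotent radical is averaged over.
  rcases le_total y₂ y₁ with hy | hy
  · rw [max_eq_left hy]
    refine (norm_le_of_averages (B := C₁ * D / y₁)
      (h₀ := fun t => f (pt (x₁ + t) x₂ x₃ y₁ y₂))
      (h := fun t s => f (pt (x₁ + t) x₂ (x₃ + s) y₁ y₂)) ?_ ?_ ?_ ?_ ?_).trans ?_
    · have := continuous_unipotent_comp hf.smooth (pt x₁ x₂ x₃ y₁ y₂) (α := ℝ) continuous_id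
        (continuous_const (y := (0 : ℝ))) (continuous_const (y := (0 : ℝ)))
      simpa [cls_matU_mul_pt _ _ _ _ _ _ p1 p2] using this
    · have := continuous_unipotent_comp hf.smooth (pt x₁ x₂ x₃ y₁ y₂) (α := ℝ × ℝ) continuous_fst
        (continuous_const (y := (0 : ℝ))) continuous_snd
      simpa [cls_matU_mul_pt _ _ _ _ _ _ p1 p2] using this
    · exact (hC₁ x₁ x₂ x₃ y₁ y₂ (by linarith) (by linarith) (by linarith) hy₁ hy₂ hy).1.trans
        (rpow_bound hC₁0 hy₁ hk)
    · intro t ht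
      exact (hC₁ (x₁ + t) x₂ x₃ y₁ y₂ (abs_le.mpr ⟨by linarith [ht.1], by linarith [ht.2]⟩)
        (by linarith) (by linarith) hy₁ hy₂ hy).2.trans (rpow_bound hC₁0 hy₁ hk)
    · have := hf.integral_column (pt x₁ x₂ x₃ y₁ y₂)
      simpa [cls_matU_mul_pt _ _ _ _ _ _ p1 p2] using this
    · rw [← mul_div_assoc]; gcongr; linarith
  · rw [max_eq_right hy]
    refine (norm_le_of_averages (B := C₂ * D / y₂)
      (h₀ := fun t => f (pt x₁ (x₂ + t) (x₃ + t * x₁) y₁ y₂))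
      (h := fun t s => f (pt x₁ (x₂ + t) (x₃ + s + t * x₁) y₁ y₂)) ?_ ?_ ?_ ?_ ?_).trans ?_
    · have := continuous_unipotent_comp hf.smooth (pt x₁ x₂ x₃ y₁ y₂) (α := ℝ)
        (continuous_const (y := (0 : ℝ))) continuous_id (continuous_const (y := (0 : ℝ)))
      simpa [cls_matU_mul_pt _ _ _ _ _ _ p1 p2] using this
    · have := continuous_unipotent_comp hf.smooth (pt x₁ x₂ x₃ y₁ y₂) (α := ℝ × ℝ)
        (continuous_const (y := (0 : ℝ))) continuous_fst continuous_snd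
      simpa [cls_matU_mul_pt _ _ _ _ _ _ p1 p2] using this
    · exact ((hC₂ x₁ x₂ x₃ y₁ y₂ hx₁ (by linarith) (by linarith) hy₁ hy₂ hy).1 hx₃).trans
        (rpow_bound hC₂0 hy₂ hk)
    · intro t ht
      have h1 : |t * x₁| ≤ 1 := by
        rw [abs_mul]
        exact mul_le_one₀ (abs_le.mpr ⟨by linarith [ht.1], ht.2⟩) (abs_nonneg _) hx₁
      rw [abs_le] at h1
      have := (hC₂ x₁ (x₂ + t) (x₃ + t * x₁) y₁ y₂ hx₁
        (abs_le.mpr ⟨by linarith [ht.1], by linarith [ht.2]⟩)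
        (abs_le.mpr ⟨by linarith, by linarith⟩) hy₁ hy₂ hy).2.trans (rpow_bound hC₂0 hy₂ hk)
      simpa only [add_right_comm x₃ (t * x₁)] using this
    · have := hf.integral_row (pt x₁ x₂ x₃ y₁ y₂)
      simpa [cls_matU_mul_pt _ _ _ _ _ _ p1 p2] using this
    · rw [← mul_div_assoc]; gcongr; linarith

/-! ### Reduction theory -/

/-- The product of the squared norms of the last row of `N` and of the cross product of its last
two rows. -/
def heightForm (N : Matrix (Fin 3) (Fin 3) ℝ) : ℝ := (N * Nᵀ) 2 2 * (N * Nᵀ).adjugate 0 0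

lemma heightForm_smul_mul (c : ℝ) (B : Matrix (Fin 3) (Fin 3) ℝ) (k : K) :
    heightForm (c • (B * k.1)) = c ^ 6 * heightForm B := by
  have h : c • (B * k.1) * (c • (B * k.1))ᵀ = (c ^ 2) • (B * Bᵀ) := by
    rw [transpose_smul, transpose_mul, smul_mul_smul_comm, ← sq, Matrix.mul_assoc B,
      ← Matrix.mul_assoc k.1, K_mul_transpose, Matrix.one_mul]
  rw [heightForm, h, adjugate_smul, heightForm]
  simp
  ring

/-- A nonzero integral vector has a coordinate of absolute value at least one. Recovering that
coordinate through `B` and applying Cauchy-Schwarz bounds the length of the image from below. -/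
lemma exists_sum_mulVec_sq_ge {A B : Matrix (Fin 3) (Fin 3) ℝ} (h : B * A = 1) :
    ∃ l : ℝ, 0 < l ∧ ∀ v : Fin 3 → ℤ, v ≠ 0 →
      l ≤ ∑ i, (A *ᵥ (fun j => (v j : ℝ))) i ^ 2 := by
  set S : ℝ := ∑ i, ∑ j, B i j ^ 2
  have hS : 0 ≤ S := by positivity
  refine ⟨1 / (1 + S), by positivity, fun v hv => ?_⟩
  obtain ⟨i, hi⟩ := Function.ne_iff.mp hv
  set w := A *ᵥ (fun j => (v j : ℝ))
  have h1 : (v i : ℝ) = ∑ j, B i j * w j := by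
    have : (B *ᵥ w) i = v i := by rw [mulVec_mulVec, h, one_mulVec]
    rw [← this]; rfl
  have h2 : (1 : ℝ) ≤ (v i : ℝ) ^ 2 := by
    have : 1 ≤ v i ^ 2 := by
      have hi' : v i ≠ 0 := hi
      have : 0 < v i ^ 2 := by positivity
      omega
    exact_mod_cast this
  have h3 : (v i : ℝ) ^ 2 ≤ (∑ j, B i j ^ 2) * ∑ j, w j ^ 2 := by
    rw [h1]; exact Finset.sum_mul_sq_le_sq_mul_sq _ _ _
  have h4 : ∑ j, B i j ^ 2 ≤ S :=
    Finset.single_le_sum (f := fun i => ∑ j, B i j ^ 2) (fun i _ => by positivity)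
      (Finset.mem_univ i)
  have h5 : 0 ≤ ∑ j, w j ^ 2 := by positivity
  rw [div_le_iff₀ (by positivity)]
  nlinarith [mul_le_mul_of_nonneg_right h4 h5]

lemma heightForm_eq (N : Matrix (Fin 3) (Fin 3) ℝ) :
    heightForm N = (∑ j, N 2 j ^ 2) * ∑ i, N.adjugate i 0 ^ 2 := by
  rw [heightForm, adjugate_mul_distrib, ← adjugate_transpose]
  simp [Matrix.mul_apply, sq]

/-- The real matrix of an element of `SL(3, ℤ)`. -/
abbrev toReal (γ : Matrix.SpecialLinearGroup (Fin 3) ℤ) : Matrix (Fin 3) (Fin 3) ℝ :=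
  (γ : Matrix (Fin 3) (Fin 3) ℤ).map Int.cast

lemma toReal_mul (γ δ : Matrix.SpecialLinearGroup (Fin 3) ℤ) :
    toReal (γ * δ) = toReal γ * toReal δ := by
  ext i j; simp [toReal, Matrix.mul_apply]

lemma det_toReal (γ : Matrix.SpecialLinearGroup (Fin 3) ℤ) : (toReal γ).det = 1 :=
  (Matrix.SpecialLinearGroup.map (n := Fin 3) (Int.castRingHom ℝ) γ).2

/-- The last row of `γ` and the first column of its adjugate are nonzero integral vectors, so both
factors of the height are bounded below. -/
lemma exists_heightForm_ge {M : Matrix (Fin 3) (Fin 3) ℝ} (hM : M.det ≠ 0) :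
    ∃ l : ℝ, 0 < l ∧ ∀ γ : Matrix.SpecialLinearGroup (Fin 3) ℤ, l ≤ heightForm (toReal γ * M) := by
  have hU : IsUnit M.det := hM.isUnit
  obtain ⟨l₁, h₁, H₁⟩ := exists_sum_mulVec_sq_ge (A := Mᵀ) (B := M⁻¹ᵀ)
    (by rw [← transpose_mul, mul_nonsing_inv _ hU, transpose_one])
  obtain ⟨l₂, h₂, H₂⟩ := exists_sum_mulVec_sq_ge (A := M.adjugate) (B := M.det⁻¹ • M)
    (by rw [smul_mul, mul_adjugate, smul_smul, inv_mul_cancel₀ hM, one_smul])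
  refine ⟨l₁ * l₂, by positivity, fun γ => ?_⟩
  rw [heightForm_eq]
  have hdet : (γ : Matrix (Fin 3) (Fin 3) ℤ).det ≠ 0 := by rw [γ.2]; exact one_ne_zero
  have e₁ : (γ : Matrix (Fin 3) (Fin 3) ℤ) 2 ≠ 0 := fun h =>
    hdet (det_eq_zero_of_row_eq_zero 2 fun j => congrFun h j)
  have e₂ : (fun i => (γ : Matrix (Fin 3) (Fin 3) ℤ).adjugate i 0) ≠ 0 := fun h => by
    have h1 : (γ : Matrix (Fin 3) (Fin 3) ℤ).adjugate.det = 1 := by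
      rw [det_adjugate, γ.2, one_pow]
    rw [det_eq_zero_of_column_eq_zero 0 fun i => congrFun h i] at h1
    exact zero_ne_one h1
  refine mul_le_mul ((H₁ _ e₁).trans (le_of_eq ?_)) ((H₂ _ e₂).trans (le_of_eq ?_)) h₂.le
    (by positivity)
  · refine Finset.sum_congr rfl fun i _ => ?_
    simp [mulVec, dotProduct, Matrix.mul_apply, mul_comm]
  · refine Finset.sum_congr rfl fun i _ => ?_
    have : (toReal γ).adjugate = (γ : Matrix (Fin 3) (Fin 3) ℤ).adjugate.map Int.cast :=
      ((Int.castRingHom ℝ).map_adjugate _).symm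
    rw [adjugate_mul_distrib, this]
    simp [mulVec, dotProduct, Matrix.mul_apply]

/-- A near-minimizer suffices for the reduction, so it need not be shown that the infimum is
attained. -/
lemma exists_le_two_mul {ι : Type*} [Nonempty ι] {v : ι → ℝ} {l : ℝ} (hl : 0 < l)
    (h : ∀ i, l ≤ v i) : ∃ i, ∀ j, v i ≤ 2 * v j := by
  have hb : BddBelow (Set.range v) := ⟨l, by rintro _ ⟨i, rfl⟩; exact h i⟩
  have h0 : l ≤ ⨅ i, v i := le_ciInf h
  obtain ⟨i, hi⟩ := exists_lt_of_ciInf_lt (show ⨅ i, v i < 2 * ⨅ i, v i by linarith)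
  exact ⟨i, fun j => hi.le.trans (by linarith [ciInf_le hb j])⟩

lemma exists_int_abs_add_le (x : ℝ) : ∃ n : ℤ, |x + n| ≤ 1 / 2 :=
  ⟨-round x, by push_cast; rw [← sub_eq_add_neg]; exact abs_sub_round x⟩

/-- Every `Γ`-orbit meets the Siegel set `|x₁|, |x₂|, |x₃| ≤ 1/2`, `y₁, y₂ ≥ 1/2`. -/
theorem exists_reduced (g : G) : ∃ γ ∈ Γ, ∃ (x₁ x₂ x₃ y₁ y₂ : ℝ) (k : K),
    |x₁| ≤ 1 / 2 ∧ |x₂| ≤ 1 / 2 ∧ |x₃| ≤ 1 / 2 ∧ 1 / 2 ≤ y₁ ∧ 1 / 2 ≤ y₂ ∧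
      γ * g = pt x₁ x₂ x₃ y₁ y₂ * ofK k := by
  obtain ⟨⟨a₁, a₂, a₃, b₁, b₂, κ⟩, hb₁, hb₂, rfl⟩ := exists_iwasawa g
  dsimp only at hb₁ hb₂ ⊢
  set M : Matrix (Fin 3) (Fin 3) ℝ := matU a₁ a₂ a₃ * matY b₁ b₂ * κ.1 with hM
  have hMdet : 0 < M.det := by
    rw [hM, det_mul, K_det, det_mul, det_matU, matY, det_diagonal, Fin.prod_univ_three]
    simp; positivity
  have hg : pt a₁ a₂ a₃ b₁ b₂ * ofK κ = cls M := by
    rw [pt, ofK, ← cls_mul (det_pt hb₁ hb₂) (K_det_ne κ)]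
  obtain ⟨l, hl, hge⟩ := exists_heightForm_ge hMdet.ne'
  obtain ⟨γ, hγ⟩ := exists_le_two_mul hl hge
  obtain ⟨c, x₁, x₂, x₃, y₁, y₂, k, hc, hy₁, hy₂, e⟩ :=
    exists_iwasawa_matrix (M := toReal γ * M) (by rw [det_mul, det_toReal, one_mul]; exact hMdet)
  obtain ⟨n₁, hn₁⟩ := exists_int_abs_add_le x₁
  obtain ⟨n₂, hn₂⟩ := exists_int_abs_add_le x₂
  obtain ⟨n₃, hn₃⟩ := exists_int_abs_add_le (x₃ + n₂ * x₁)
  -- Near-minimality survives the unipotent translation that reduces the `x`-coordinates, since it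
  -- too lies in `SL(3, ℤ)`; the scalar and the rotation cancel.
  have key : ∀ (σ : Matrix.SpecialLinearGroup (Fin 3) ℤ),
      heightForm (matU x₁ x₂ x₃ * matY y₁ y₂) ≤
        2 * heightForm (toReal σ * (matU (x₁ + n₁) (x₂ + n₂) (x₃ + n₂ * x₁ + n₃) * matY y₁ y₂)) := by
    intro σ
    set τ : Matrix.SpecialLinearGroup (Fin 3) ℤ :=
      ⟨!![1, n₂, n₃; 0, 1, n₁; 0, 0, 1], by simp [det_fin_three]⟩
    have hτ : toReal τ = matU n₁ n₂ n₃ := by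
      ext i j; fin_cases i <;> fin_cases j <;> simp [matU, τ, toReal]
    have h := hγ (σ * τ * γ)
    have h2 : toReal (σ * τ * γ) * M =
        c • (toReal σ * (matU (x₁ + n₁) (x₂ + n₂) (x₃ + n₂ * x₁ + n₃) * matY y₁ y₂) * k.1) := by
      have h3 : x₃ + n₂ * x₁ + n₃ = x₃ + n₃ + n₂ * x₁ := by ring
      rw [toReal_mul, toReal_mul, Matrix.mul_assoc, e, hτ, mul_smul_comm, h3, ← matU_mul]
      simp only [Matrix.mul_assoc]
    rw [h2, e, heightForm_smul_mul, heightForm_smul_mul, mul_left_comm] at h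
    exact le_of_mul_le_mul_left h (by positivity)
  have hy₁' : 1 / 2 ≤ y₁ := by
    -- Exchanging the last two rows multiplies the height `y₁²` by `y₁² + s²`, so this is at least
    -- `1/2`; with `|s| ≤ 1/2` it follows that `y₁ ≥ 1/2`.
    have h := key ⟨!![1, 0, 0; 0, 0, 1; 0, -1, 0], by simp [det_fin_three]⟩
    rw [abs_le] at hn₁
    generalize x₁ + (n₁ : ℝ) = s at *
    simp only [toReal, heightForm, matU_mul_matY, adjugate_fin_three] at h
    simp [Matrix.mul_apply, Fin.sum_univ_three] at h
    by_contra! hlt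
    have h1 : 0 < y₁ ^ 2 := by positivity
    nlinarith [mul_pos h1 (show 0 < 1 / 2 - y₁ ^ 2 - s ^ 2 by nlinarith)]
  refine ⟨cls (matU n₁ n₂ n₃) * cls (toReal γ), Γ.mul_mem (cls_matU_intCast_mem _ _ _)
    (cls_map_intCast_mem γ), x₁ + n₁, x₂ + n₂, x₃ + n₂ * x₁ + n₃, y₁, y₂, k, hn₁, hn₂, hn₃, hy₁',
    ?_, ?_⟩
  -- Exchanging the first two rows multiplies the height by `y₂² + t²`, with the same conclusion for
  -- `y₂`.
  · have h := key ⟨!![0, 1, 0; -1, 0, 0; 0, 0, 1], by simp [det_fin_three]⟩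
    rw [abs_le] at hn₂
    generalize x₁ + (n₁ : ℝ) = s at *
    generalize x₂ + (n₂ : ℝ) = t at *
    simp only [toReal, heightForm, matU_mul_matY, adjugate_fin_three] at h
    simp [Matrix.mul_apply, Fin.sum_univ_three] at h
    by_contra! hlt
    have h1 : 0 < y₁ ^ 2 := by positivity
    nlinarith [mul_pos h1 (show 0 < 1 / 2 - y₂ ^ 2 - t ^ 2 by nlinarith)]
  · rw [hg, mul_assoc, ← cls_mul (by rw [det_toReal]; exact one_ne_zero) hMdet.ne', e,
      cls_smul hc.ne', cls_mul (det_pt hy₁ hy₂) (K_det_ne k), ← mul_assoc]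
    have h3 : x₃ + n₂ * x₁ + n₃ = x₃ + n₃ + n₂ * x₁ := by ring
    rw [h3, ← cls_matU_mul_pt _ _ _ _ _ _ hy₁ hy₂]
    rfl

open scoped ENNReal

/-! ### Cells covering the Siegel set -/

lemma continuous_cls {α : Type*} [TopologicalSpace α] {M : α → Matrix (Fin 3) (Fin 3) ℝ}
    (hM : Continuous M) (hdet : ∀ a, (M a).det ≠ 0) : Continuous fun a => cls (M a) := by
  have h : Continuous fun a => Matrix.GeneralLinearGroup.mkOfDetNeZero (M a) (hdet a) := by
    refine Units.continuous_iff.mpr ⟨hM, ?_⟩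
    have e : (fun a => ((Matrix.GeneralLinearGroup.mkOfDetNeZero (M a) (hdet a))⁻¹).1) =
        fun a => (M a).det⁻¹ • (M a).adjugate := by
      funext a
      rw [Matrix.coe_units_inv, Matrix.inv_def, Ring.inverse_eq_inv']
      rfl
    exact e ▸ (hM.matrix_det.inv₀ hdet).smul hM.matrix_adjugate
  simp only [cls_of_det_ne (hdet _)]
  exact continuous_quotient_mk'.comp h

/-- The Hausdorff property makes the compact set `baseCell` closed, hence the cells measurable. -/
instance : T2Space G := by
  have : IsClosed ((Subgroup.center (GL (Fin 3) ℝ) : Subgroup (GL (Fin 3) ℝ)) :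
      Set (GL (Fin 3) ℝ)) := by
    rw [Subgroup.coe_center, ← Set.centralizer_univ]
    exact Set.isClosed_centralizer _
  exact inferInstanceAs (T2Space (GL (Fin 3) ℝ ⧸ Subgroup.center (GL (Fin 3) ℝ)))

instance : Countable Γ :=
  have : Countable (Matrix.SpecialLinearGroup (Fin 3) ℤ) :=
    (Subtype.val_injective (p := fun M : Fin 3 → Fin 3 → ℤ => Matrix.det (Matrix.of M) = 1)).countable
  (MonoidHom.rangeRestrict_surjective (toG.comp (Matrix.SpecialLinearGroup.toGL.comp
    (Matrix.SpecialLinearGroup.map (n := Fin 3) (Int.castRingHom ℝ))))).countable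

/-- The compact set `|x₁|, |x₂|, |x₃| ≤ 1/2`, `1/2 ≤ y₁, y₂ ≤ 1`. -/
def baseCell : Set G := Set.range fun p : Set.Icc (-1 / 2 : ℝ) (1 / 2) × Set.Icc (-1 / 2 : ℝ) (1 / 2) ×
  Set.Icc (-1 / 2 : ℝ) (1 / 2) × Set.Icc (1 / 2 : ℝ) 1 × Set.Icc (1 / 2 : ℝ) 1 × K =>
    pt p.1 p.2.1 p.2.2.1 p.2.2.2.1 p.2.2.2.2.1 * ofK p.2.2.2.2.2

lemma isCompact_baseCell : IsCompact baseCell := by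
  refine isCompact_range (Continuous.mul ?_ ?_)
  · refine continuous_cls ?_ fun p => det_pt ?_ ?_
    · refine continuous_matrix fun i j => ?_
      simp only [matU_mul_matY]
      fin_cases i <;> fin_cases j <;> simp <;> fun_prop
    · linarith [p.2.2.2.1.2.1]
    · linarith [p.2.2.2.2.1.2.1]
  · exact continuous_cls (by fun_prop) fun p => K_det_ne _

/-- The translate of the compact set `baseCell` by `y₁ = 2^m`, `y₂ = 2^n`. -/
def cell (p : ℕ × ℕ) : Set G := (fun g => (pt 0 0 0 (2 ^ p.1) (2 ^ p.2))⁻¹ * g) ⁻¹' baseCell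

lemma measurableSet_cell (p : ℕ × ℕ) : MeasurableSet (cell p) :=
  (isCompact_baseCell.isClosed.preimage (continuous_const_mul _)).measurableSet

instance : haarG.IsMulLeftInvariant := inferInstanceAs (Measure.haar : Measure G).IsMulLeftInvariant

instance : IsFiniteMeasureOnCompacts haarG :=
  inferInstanceAs (IsFiniteMeasureOnCompacts (Measure.haar : Measure G))

lemma haarG_cell (p : ℕ × ℕ) : haarG (cell p) = haarG baseCell := measure_preimage_mul _ _ _

lemma pt_zero_mul {a b x₁ x₂ x₃ y₁ y₂ : ℝ} (ha : 0 < a) (hb : 0 < b) (h₁ : 0 < y₁) (h₂ : 0 < y₂) :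
    pt 0 0 0 a b * pt x₁ x₂ x₃ y₁ y₂ = pt (a * x₁) (b * x₂) (a * b * x₃) (a * y₁) (b * y₂) := by
  rw [pt, pt, ← cls_mul (det_pt ha hb) (det_pt h₁ h₂), pt, matU_mul_matY, matU_mul_matY,
    matU_mul_matY]
  congr 1
  ext i j; fin_cases i <;> fin_cases j <;> simp [Matrix.mul_apply, Fin.sum_univ_three] <;> ring

lemma exists_pow_two_near {y : ℝ} (hy : 1 / 2 ≤ y) :
    ∃ n : ℕ, 1 / 2 ≤ y / 2 ^ n ∧ y / 2 ^ n ≤ 1 := by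
  obtain ⟨n, h1, h2⟩ := exists_nat_pow_near (show 1 ≤ 2 * y by linarith) one_lt_two
  have h0 : (0 : ℝ) < 2 ^ n := by positivity
  refine ⟨n, ?_, ?_⟩
  · rw [le_div_iff₀ h0]; linarith
  · rw [div_le_iff₀ h0]; rw [pow_succ] at h2; linarith

lemma mem_cell {x₁ x₂ x₃ y₁ y₂ : ℝ} (k : K) (hx₁ : |x₁| ≤ 1 / 2) (hx₂ : |x₂| ≤ 1 / 2)
    (hx₃ : |x₃| ≤ 1 / 2) (hy₁ : 1 / 2 ≤ y₁) (hy₂ : 1 / 2 ≤ y₂) :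
    ∃ p, pt x₁ x₂ x₃ y₁ y₂ * ofK k ∈ cell p := by
  obtain ⟨m, hm⟩ := exists_pow_two_near hy₁
  obtain ⟨n, hn⟩ := exists_pow_two_near hy₂
  have hM : (1 : ℝ) ≤ 2 ^ m := one_le_pow₀ one_le_two
  have hN : (1 : ℝ) ≤ 2 ^ n := one_le_pow₀ one_le_two
  have hM0 : (0 : ℝ) < 2 ^ m := by positivity
  have hN0 : (0 : ℝ) < 2 ^ n := by positivity
  -- Division by powers of two at least `1` keeps the `x`-coordinates in the box.
  have aux : ∀ {x c : ℝ}, |x| ≤ 1 / 2 → 1 ≤ c → x / c ∈ Set.Icc (-1 / 2 : ℝ) (1 / 2) := by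
    intro x c hx hc
    have h : |x / c| ≤ 1 / 2 := by
      rw [abs_div, abs_of_pos (show 0 < c by linarith)]
      exact (div_le_self (abs_nonneg _) hc).trans hx
    rw [abs_le] at h
    exact ⟨by linarith [h.1], h.2⟩
  refine ⟨(m, n), ⟨⟨x₁ / 2 ^ m, aux hx₁ hM⟩, ⟨x₂ / 2 ^ n, aux hx₂ hN⟩,
    ⟨x₃ / (2 ^ m * 2 ^ n), aux hx₃ (one_le_mul_of_one_le_of_one_le hM hN)⟩, ⟨_, hm⟩, ⟨_, hn⟩, k⟩, ?_⟩
  rw [eq_inv_mul_iff_mul_eq, ← mul_assoc,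
    pt_zero_mul hM0 hN0 (by linarith [hm.1]) (by linarith [hn.1])]
  congr 2 <;> field_simp

lemma exists_of_mem_cell {p : ℕ × ℕ} {g : G} (hg : g ∈ cell p) :
    ∃ (x₁ x₂ x₃ y₁ y₂ : ℝ) (k : K), 2 ^ p.1 / 2 ≤ y₁ ∧ 2 ^ p.2 / 2 ≤ y₂ ∧
      g = pt x₁ x₂ x₃ y₁ y₂ * ofK k := by
  obtain ⟨⟨x₁, x₂, x₃, y₁, y₂, k⟩, h⟩ := hg
  have h₁ := y₁.2.1
  have h₂ := y₂.2.1
  rw [eq_inv_mul_iff_mul_eq, ← mul_assoc,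
    pt_zero_mul (by positivity) (by positivity) (by linarith) (by linarith)] at h
  refine ⟨_, _, _, _, _, k, ?_, ?_, h.symm⟩
  · dsimp only; nlinarith [show (0 : ℝ) < 2 ^ p.1 by positivity]
  · dsimp only; nlinarith [show (0 : ℝ) < 2 ^ p.2 by positivity]

lemma exists_mul_mem_cell (g : G) : ∃ γ : Γ, ∃ p, (γ : G) * g ∈ cell p := by
  obtain ⟨γ, hγ, x₁, x₂, x₃, y₁, y₂, k, hx₁, hx₂, hx₃, hy₁, hy₂, h⟩ := exists_reduced g
  obtain ⟨p, hp⟩ := mem_cell k hx₁ hx₂ hx₃ hy₁ hy₂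
  exact ⟨⟨γ, hγ⟩, p, h ▸ hp⟩

/-- Unfolding: the integral over a cell is the sum over `Γ` of the integrals over the parts of its
translates in `D`, and all these parts together cover `D`. -/
lemma lintegral_fundamentalDomain_le {D : Set G} (hD : IsFundamentalDomain Γ D haarG)
    {h : G → ℝ≥0∞} (hinv : ∀ γ ∈ Γ, ∀ g, h (γ * g) = h g) :
    ∫⁻ g in D, h g ∂haarG ≤ ∑' p : ℕ × ℕ, ∫⁻ g in cell p, h g ∂haarG := by
  have e : ∀ p, ∫⁻ g in cell p, h g ∂haarG =
      ∑' γ : Γ, ∫⁻ g in (fun g => (γ : G)⁻¹ * g) ⁻¹' cell p ∩ D, h g ∂haarG := fun p => by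
    rw [hD.setLIntegral_eq_tsum']
    refine tsum_congr fun γ => ?_
    have h1 : ∀ g, h (γ⁻¹ • g) = h g := fun g => hinv _ (γ⁻¹).2 g
    simp only [h1]
    congr 3
    ext g
    rw [Set.mem_smul_set_iff_inv_smul_mem]
    rfl
  have hsub : D ⊆ ⋃ q : (ℕ × ℕ) × Γ, (fun g => (q.2 : G)⁻¹ * g) ⁻¹' cell q.1 ∩ D := fun g hg => by
    obtain ⟨γ, p, hp⟩ := exists_mul_mem_cell g
    refine Set.mem_iUnion.mpr ⟨(p, γ⁻¹), ?_, hg⟩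
    simpa using hp
  calc ∫⁻ g in D, h g ∂haarG
      ≤ ∑' q : (ℕ × ℕ) × Γ, ∫⁻ g in (fun g => (q.2 : G)⁻¹ * g) ⁻¹' cell q.1 ∩ D, h g ∂haarG :=
        (lintegral_mono_set hsub).trans (lintegral_iUnion_le _ _)
    _ = ∑' p : ℕ × ℕ, ∫⁻ g in cell p, h g ∂haarG := by
        rw [ENNReal.tsum_prod']
        exact tsum_congr fun p => (e p).symm

lemma tsum_geometric_two : ∑' p : ℕ × ℕ, ((2⁻¹ : ℝ≥0∞) ^ p.1 * 2⁻¹ ^ p.2) < ⊤ := by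
  rw [ENNReal.tsum_prod' (f := fun p : ℕ × ℕ => (2⁻¹ : ℝ≥0∞) ^ p.1 * 2⁻¹ ^ p.2)]
  simp only [ENNReal.tsum_mul_left, ENNReal.tsum_mul_right, ENNReal.tsum_geometric,
    ENNReal.one_sub_inv_two, inv_inv]
  exact ENNReal.mul_lt_top (by simp) (by simp)

/-- Integral unipotent translations bring any `x₁, x₂, x₃` into the box without changing `y₁, y₂`.
-/
lemma CuspScalar.bound {r : ℝ} {f : G → ℂ} (hf : CuspScalar r f) (hr : 0 ≤ r) : ∃ C : ℝ,
    0 ≤ C ∧ ∀ x₁ x₂ x₃ y₁ y₂ : ℝ, 1 / 2 ≤ y₁ → 1 / 2 ≤ y₂ →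
      ‖f (pt x₁ x₂ x₃ y₁ y₂)‖ ≤ C / max y₁ y₂ := by
  obtain ⟨C, hC0, hC⟩ := hf.siegel_bound hr
  refine ⟨C, hC0, fun x₁ x₂ x₃ y₁ y₂ hy₁ hy₂ => ?_⟩
  obtain ⟨n₁, hn₁⟩ := exists_int_abs_add_le x₁
  obtain ⟨n₂, hn₂⟩ := exists_int_abs_add_le x₂
  obtain ⟨n₃, hn₃⟩ := exists_int_abs_add_le (x₃ + n₂ * x₁)
  have h := hf.invariant _ (cls_matU_intCast_mem n₁ n₂ n₃) (pt x₁ x₂ x₃ y₁ y₂)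
  rw [cls_matU_mul_pt _ _ _ _ _ _ (by linarith) (by linarith)] at h
  rw [← h]
  refine hC _ _ _ _ _ (by linarith) (by linarith) ?_ hy₁ hy₂
  rw [add_right_comm]; linarith

/-! ### Square integrability over a fundamental domain. -/

/-- A vector valued function all of whose entries are cuspidal of uniform moderate growth is square
integrable over any fundamental domain. -/
theorem finite_norm_of_cuspScalar {e : ℕ} {F : G → Idx e → ℂ} (hF : F ∈ vectorType e) {r : ℝ}
    (hr : 0 ≤ r) (h : ∀ m, CuspScalar r (entry F m)) {D : Set G}
    (hD : IsFundamentalDomain Γ D haarG) : ∫⁻ g in D, ∑ m : Idx e, ‖F g m‖ₑ ^ 2 ∂haarG < ⊤ := by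
  choose C hC0 hC using fun m => (h m).bound hr
  have hw : ∀ n m : ℤ, ∃ B : ℝ, 0 ≤ B ∧ ∀ k : K, ‖wignerD e n m k‖ ≤ B := fun n m => by
    obtain ⟨B, hB⟩ := isCompact_univ.exists_bound_of_continuousOn (continuous_wignerD e n m).continuousOn
    exact ⟨B, (norm_nonneg _).trans (hB 1 trivial), fun k => hB k trivial⟩
  choose B hB0 hB using hw
  set A : ℤ → ℝ := fun m => ∑ n ∈ Finset.Icc (-(e : ℤ)) e, C n * B n m with hA
  have hA0 : ∀ m, 0 ≤ A m := fun m => Finset.sum_nonneg fun n _ => mul_nonneg (hC0 n) (hB0 n m)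
  have hentry : ∀ (m : ℤ) x₁ x₂ x₃ y₁ y₂ (k : K), 1 / 2 ≤ y₁ → 1 / 2 ≤ y₂ →
      ‖entry F m (pt x₁ x₂ x₃ y₁ y₂ * ofK k)‖ ≤ A m / max y₁ y₂ := by
    intro m x₁ x₂ x₃ y₁ y₂ k hy₁ hy₂
    rw [entry_mul_ofK hF, hA, Finset.sum_div]
    refine (norm_sum_le _ _).trans (Finset.sum_le_sum fun n _ => ?_)
    rw [norm_mul, mul_div_right_comm]
    have hm : 0 < max y₁ y₂ := lt_max_of_lt_left (by linarith)
    exact mul_le_mul (hC n _ _ _ _ _ hy₁ hy₂) (hB n m k) (norm_nonneg _) (div_nonneg (hC0 n) hm.le)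
  set S : ℝ := ∑ m : Idx e, A m ^ 2 with hS
  have hcell : ∀ p : ℕ × ℕ, ∀ g ∈ cell p, ∑ m : Idx e, ‖F g m‖ₑ ^ 2 ≤
      ENNReal.ofReal (4 * S) * (2⁻¹ ^ p.1 * 2⁻¹ ^ p.2) := by
    intro p g hg
    obtain ⟨x₁, x₂, x₃, y₁, y₂, k, hy₁, hy₂, rfl⟩ := exists_of_mem_cell hg
    have hP : (1 : ℝ) ≤ 2 ^ p.1 := one_le_pow₀ one_le_two
    have hQ : (1 : ℝ) ≤ 2 ^ p.2 := one_le_pow₀ one_le_two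
    set Y := max y₁ y₂ with hY
    have hY1 : 2 ^ p.1 / 2 ≤ Y := hy₁.trans (le_max_left _ _)
    have hY2 : 2 ^ p.2 / 2 ≤ Y := hy₂.trans (le_max_right _ _)
    have hYpos : 0 < Y := by linarith
    have h1 : ∀ m : Idx e, ‖F (pt x₁ x₂ x₃ y₁ y₂ * ofK k) m‖ ^ 2 ≤ A m ^ 2 / Y ^ 2 := fun m => by
      rw [← entry_coe F, ← div_pow]
      exact pow_le_pow_left₀ (norm_nonneg _)
        (hentry m x₁ x₂ x₃ y₁ y₂ k (by linarith) (by linarith)) 2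
    have h2 : ∑ m : Idx e, ‖F (pt x₁ x₂ x₃ y₁ y₂ * ofK k) m‖ₑ ^ 2 =
        ENNReal.ofReal (∑ m : Idx e, ‖F (pt x₁ x₂ x₃ y₁ y₂ * ofK k) m‖ ^ 2) := by
      rw [ENNReal.ofReal_sum_of_nonneg fun _ _ => by positivity]
      refine Finset.sum_congr rfl fun m _ => ?_
      rw [ENNReal.ofReal_pow (norm_nonneg _), ofReal_norm]
    have h3 : (2⁻¹ : ℝ≥0∞) ^ p.1 * 2⁻¹ ^ p.2 = ENNReal.ofReal (2⁻¹ ^ p.1 * 2⁻¹ ^ p.2) := by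
      rw [ENNReal.ofReal_mul (by positivity), ENNReal.ofReal_pow (by norm_num),
        ENNReal.ofReal_pow (by norm_num), ENNReal.ofReal_inv_of_pos two_pos]
      norm_num
    rw [h2, h3, ← ENNReal.ofReal_mul (by positivity)]
    refine ENNReal.ofReal_le_ofReal ((Finset.sum_le_sum fun m _ => h1 m).trans ?_)
    rw [← Finset.sum_div, ← hS, div_le_iff₀ (by positivity)]
    -- `Y` dominates both scales, so `Y²` dominates their product. The squared decay thus splits
    -- into two geometric factors.
    have h4 : (2 ^ p.1 * 2 ^ p.2 : ℝ) ≤ 4 * Y ^ 2 := by nlinarith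
    have h5 : (0 : ℝ) < 2 ^ p.1 * 2 ^ p.2 := by positivity
    rw [inv_pow, inv_pow, ← mul_inv, mul_assoc, mul_assoc, mul_left_comm]
    have hS0 : 0 ≤ S := by positivity
    refine le_mul_of_one_le_right hS0 ?_
    rw [mul_left_comm, inv_mul_eq_div, le_div_iff₀ h5]
    linarith
  have hinv : ∀ γ ∈ Γ, ∀ g, ∑ m : Idx e, ‖F (γ * g) m‖ₑ ^ 2 = ∑ m : Idx e, ‖F g m‖ₑ ^ 2 :=
    fun γ hγ g => Finset.sum_congr rfl fun m _ => by
      rw [← entry_coe F, ← entry_coe F, (h m).invariant γ hγ]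
  refine (lintegral_fundamentalDomain_le hD hinv).trans_lt ?_
  -- All cells have the measure of `baseCell`, so the bounds sum to a double geometric series.
  refine (ENNReal.tsum_le_tsum fun p => setLIntegral_mono' (measurableSet_cell p)
    (hcell p)).trans_lt ?_
  simp only [setLIntegral_const, haarG_cell]
  rw [ENNReal.tsum_mul_right, ENNReal.tsum_mul_left]
  exact ENNReal.mul_lt_top (ENNReal.mul_lt_top ENNReal.ofReal_lt_top tsum_geometric_two)
    isCompact_baseCell.measure_lt_top

/-! ### Cusp forms -/

variable {d e : ℕ} {a : ℤ} {F : G → Idx d → ℂ}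

lemma mul_left_mem_vectorType (hF : F ∈ vectorType d) (h : G) :
    (fun g => F (h * g)) ∈ vectorType d :=
  ⟨fun m => (hF.1 m).mul_left h, fun g k m => by dsimp only; rw [← mul_assoc, hF.2]⟩

lemma IsCuspForm.cuspScalar (hF : IsCuspForm d F) :
    ∃ r : ℝ, 0 < r ∧ ∀ m, CuspScalar r (entry F m) := by
  obtain ⟨r, hr, hgrowth⟩ := hF.growth
  refine ⟨r, hr, fun m => ?_⟩
  by_cases hm : m ∈ Finset.Icc (-(d : ℤ)) d
  · have e : entry F m = fun g => F g ⟨m, hm⟩ := by funext g; rw [entry, dif_pos hm]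
    rw [e]
    exact
      { smooth := hF.type_mem.1 _
        invariant := fun γ hγ g => by rw [hF.invariant γ hγ]
        cuspidal := fun n₁ n₂ hn g => hF.cuspidal n₁ n₂ hn g ⟨m, hm⟩
        growth := fun Xs hXs => by
          obtain ⟨C, hC⟩ := hgrowth Xs hXs
          exact ⟨C, fun M => hC M ⟨m, hm⟩⟩ }
  · have e : entry F m = fun _ => 0 := by funext g; rw [entry, dif_neg hm]
    rw [e]
    exact CuspScalar.zero r

lemma isCuspForm_of_cuspScalar (hF : F ∈ vectorType d) {r : ℝ} (hr : 0 < r)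
    (h : ∀ m, CuspScalar r (entry F m)) {D : Set G} (hD : IsFundamentalDomain Γ D haarG) :
    IsCuspForm d F where
  type_mem := hF
  invariant γ hγ g := by
    funext m
    rw [← entry_coe F, ← entry_coe F, (h m).invariant γ hγ]
  cuspidal n₁ n₂ hn g m := by
    simp only [← entry_coe F]
    exact (h m).cuspidal n₁ n₂ hn g
  growth := by
    refine ⟨r, hr, fun Xs hXs => ?_⟩
    choose C hC using fun m => (h m).growth Xs hXs
    refine ⟨∑ m : Idx d, |C m|, fun M m => ?_⟩
    simp only [← entry_coe F]
    refine (hC m M).trans (mul_le_mul_of_nonneg_right ?_ (by positivity))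
    exact (le_abs_self _).trans (Finset.single_le_sum (f := fun m : Idx d => |C m|)
      (fun _ _ => abs_nonneg _) (Finset.mem_univ m))
  finite_norm := ⟨D, hD, finite_norm_of_cuspScalar hF hr.le h hD⟩

/-- Each component is a linear combination of derivatives of entries of `F` along the traceless
matrices `X_i`, and scalar cusp forms of exponent `r` are closed under both operations. -/
theorem IsCuspForm.Wvec (he : (e : ℤ) = d + a) (ha : |a| ≤ 2) (hF : IsCuspForm d F) :
    IsCuspForm e (Wvec d e a F) := by
  obtain ⟨r, hr, h⟩ := hF.cuspScalar
  obtain ⟨D, hD, _⟩ := hF.finite_norm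
  refine isCuspForm_of_cuspScalar (Wvec_mem he ha hF.type_mem) hr (fun M => ?_) hD
  rw [entry_Wvec he]
  exact CuspScalar.sum _ _ fun i _ => (h (M - i)).lie (matX_trace i)

theorem vector_part (he : (e : ℤ) = d + a) (ha : |a| ≤ 2) (hF : F ∈ vectorType d) :
    Y d e F ∈ vectorType e ∧
    (∀ h : G, Y d e (fun g => F (h * g)) = fun g => Y d e F (h * g)) ∧
    (∀ x₁ x₂ x₃ y₁ y₂ : ℝ, 0 < y₁ → 0 < y₂ → ∀ m' : Idx e,
      Y d e F (pt x₁ x₂ x₃ y₁ y₂) m' = ∑ j ∈ Finset.Icc (-2 : ℤ) 2,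
        Yentry d a m' j (fun s₁ s₂ s₃ t₁ t₂ => entry F (m' - j) (pt s₁ s₂ s₃ t₁ t₂))
          x₁ x₂ x₃ y₁ y₂) := by
  rw [Y_eq_Wvec he ha hF]
  refine ⟨Wvec_mem he ha hF, fun h => ?_, fun x₁ x₂ x₃ y₁ y₂ h₁ h₂ m' =>
    Wop_pt he ha hF h₁ h₂ m'⟩
  rw [Y_eq_Wvec he ha (mul_left_mem_vectorType hF h)]
  funext g m
  exact Wop_mul_left h m g

end SL3

end

/-! ### The three statements combined. -/

theorem mainTheorem12 (d e : ℕ) (a : ℤ) (ha : |a| ≤ 2) (he : (e : ℤ) = d + a) :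
    -- the action of `X_j` on functions in the span of the entries of `D^d`
    (∀ f ∈ SL3.scalarType d,
      SL3.Ytilde d e f ∈ SL3.scalarType e ∧
      (SL3.projCol e 0 (SL3.lie SL3.matX0 f) =
        fun g => (SL3.cg d 2 a 0 0 : ℂ) * SL3.Ytilde d e f g) ∧
      (∀ ε : ℤ, ε = 1 ∨ ε = -1 → 1 ≤ e →
        SL3.projCol e ε (SL3.lie (SL3.matX1 ε) f) = fun g =>
          ((1 / √((e : ℝ) * (e + 1)) * SL3.cg d 2 a 0 ε : ℝ) : ℂ) *
            SL3.lie (SL3.matK1 ε) (SL3.Ytilde d e f) g) ∧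
      (∀ ε : ℤ, ε = 1 ∨ ε = -1 → 2 ≤ e →
        SL3.projCol e (2 * ε) (SL3.lie (SL3.matX2 ε) f) = fun g =>
          ((1 / (√((e : ℝ) * (e + 1)) * √((e : ℝ) * (e + 1) - 2)) *
              SL3.cg d 2 a 0 (2 * ε) : ℝ) : ℂ) *
            SL3.lie (SL3.matK1 ε) (SL3.lie (SL3.matK1 ε) (SL3.Ytilde d e f)) g)) ∧
    -- the operator `Y^a` on smooth vector-valued functions of `K`-type `D^d`
    (∀ f ∈ SL3.vectorType d,
      SL3.Y d e f ∈ SL3.vectorType e ∧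
      (∀ h : SL3.G, SL3.Y d e (fun g => f (h * g)) = fun g => SL3.Y d e f (h * g)) ∧
      (∀ x₁ x₂ x₃ y₁ y₂ : ℝ, 0 < y₁ → 0 < y₂ → ∀ m' : SL3.Idx e,
        SL3.Y d e f (SL3.pt x₁ x₂ x₃ y₁ y₂) m' =
          ∑ j ∈ Finset.Icc (-2 : ℤ) 2,
            SL3.Yentry d a m' j
              (fun s₁ s₂ s₃ t₁ t₂ => SL3.entry f (m' - j) (SL3.pt s₁ s₂ s₃ t₁ t₂))
              x₁ x₂ x₃ y₁ y₂)) ∧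
    -- `Y^a` maps cusp forms of `K`-type `D^d` to cusp forms of `K`-type `D^{d+a}`
    (∀ f : SL3.G → SL3.Idx d → ℂ, SL3.IsCuspForm d f → SL3.IsCuspForm e (SL3.Y d e f)) := by
  refine ⟨fun f hf => SL3.scalar_part he ha hf, fun f hf => SL3.vector_part he ha hf,
    fun f hf => ?_⟩
  rw [SL3.Y_eq_Wvec he ha hf.type_mem]
  exact hf.Wvec he ha
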